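/- **Model.** Time is slotted, $t=0,1,2,\dots$. One server attends $N$ parallel queues. Let $\mathcal I=\{\mathbf I^{(1)},\dots,\mathbf I^{(J)}\}$, $J\ge 1$, be the family of maximal feasible schedules, i.e. of sets of queues that may be served simultaneously (written as $0/1$ vectors, none containing another), and let $T_s\ge 1$ be the integer switching time. When the server decides at time $t$ to switch to a schedule, it is in SWITCH mode (serving nobody) during the slots $t,\dots,t+T_s-1$ and then in ACTIVE mode with that schedule until the next switch. Let $\mathbf I(t)$ be the current schedule and $M(t)\in\{0,1\}$ the indicator of ACTIVE mode. Let $t_k$ be the time of the $k$-th switch, with $t_0=0$. The service vectors $\mathbf S(t)\in\mathbb N_0^N$ are bounded and i.i.d. over $t$. The jobs of queue $i$ arrive with inter-arrival times $V_i(m)\in\mathbb N_0$, $m\ge 0$ (the first job arrives in slot $V_i(0)$), which are i.i.d. in $m$, bounded by a constant and not almost surely $0$; the arrivals at different queues and the services are independent. Put $\lambda_i=1/\mathbb E[V_i(0)]$ and let $A_i(t)$ be the number of jobs that arrive at queue $i$ in slot $t$. The queue lengths satisfy $Q_i(0)=0$ and $Q_i(t+1)=Q_i(t)-\min\{Q_i(t),M(t)I_i(t)S_i(t)\}+A_i(t)$,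 with first-come-first-served order in each queue. The head-of-line waiting time $W_i(t)$ is the time since the arrival slot of the oldest job in queue $i$ at time $t$, and $W_i(t)=0$ if the queue is empty. A scheduling policy decides at the beginning of each slot, from the past arrivals, services and decisions, whether to start a switch, and to which schedule. The system is *strongly stable* if $\limsup_{t\to\infty}\frac1t\sum_{\tau=0}^{t-1}\mathbb E\big[\sum_i Q_i(\tau)\big]<\infty$. For given $\mathcal I$, $T_s$ and service law, a rate vector $\boldsymbol\lambda$ is *admissible* if there are inter-arrival laws as above with rates $\boldsymbol\lambda$ and a policy under which the system is strongly stable. The *capacity region* $\Lambda$ is the closure in $\mathbb R^N$ of the set of admissible rate vectors. A policy is *throughput-optimal* if the system is strongly stable under it for all inter-arrival laws as above with $\boldsymbol\lambda$ in the interior of $\Lambda$. **W-BMW policy with exponent $\alpha$.** Let $G(\mathbf w)=\max\{1,(\mathbf 1^T\mathbf w)^\alpha\}$. At a time $t$ of the $k$-th interval $[t_k,t_{k+1})$, if $$\Big(1+\frac{T_s}{G(\mathbf W(t_k))}\Big)\,\mathbf I(t)^T\mathbf W(t)\;\le\;\max_{1\le j\le J}(\mathbf I^{(j)})^T\mathbf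 W(t),$$ the server starts a switch to a schedule that maximizes $(\mathbf I^{(j)})^T\mathbf W(t)$; otherwise it goes on with the current schedule. Ties are broken by an arbitrary fixed rule that depends on $\mathbf W(t)$, the current schedule, the remaining switching time and $\mathbf W(t_k)$. If the condition holds while a switch is in progress, the server may either restart or complete the switch, again by an arbitrary fixed rule of this kind. The initial schedule is arbitrary. **Theorem.** Let $\alpha\in(0,1)$. Then the W-BMW policy is throughput-optimal. Moreover, suppose that $\boldsymbol\lambda$ lies in the interior of $\Lambda$. Let $U_i(t)\in\mathbb Z$ be $t$ minus the arrival slot of the first uncompleted job of queue $i$, so that $W_i(t)=\max\{0,U_i(t)\}$ almost surely. Then the process formed by $(U_i(t))_{i\le N}$, the current schedule, the remaining switching time and the stored vector $\mathbf W(t_k)$ is a time-homogeneous Markov chain on a countable state space, whose transition probabilities are those of one slot of the system with a service vector and inter-arrival times drawn afresh. This chain is positive recurrent in the sense that, from every state, it reaches the set of positive recurrent states (those with finite expected return time) in finite expected time; if the chain is irreducible, this says that all states are positive recurrent. -/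

import Mathlib

open MeasureTheory Filter
open scoped ENNReal

noncomputable section

namespace BMW

/-! ### The switched queueing system -/

/-- A slotted system of `N` parallel queues with one server. A schedule is the set of the queues
that it serves; `schedules` is the (nonempty) family of all maximal feasible schedules, and no
maximal one contains another. A switch takes `Ts ≥ 1` slots. -/
structure Network (N : ℕ) where
  schedules : Finset (Finset (Fin N))
  nonempty : schedules.Nonempty
  antichain : IsAntichain (· ⊆ ·) (schedules : Set (Finset (Fin N)))
  Ts : ℕ
  Ts_pos : 0 < Ts

/-- A maximal feasible schedule of the network. -/
abbrev Network.Sched {N : ℕ} (net : Network N) : Type := {I : Finset (Fin N) // I ∈ net.schedules}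

/-- The law of the service vector `(S_1(t), …, S_N(t))` of one slot, with bounded entries.
Services of different queues in the same slot may be dependent. -/
structure ServiceLaw (N : ℕ) where
  law : PMF (Fin N → ℕ)
  Smax : ℕ
  bounded : ∀ s ∈ law.support, ∀ i, s i ≤ Smax

/-- The laws of the inter-arrival times of the queues: bounded and not identically zero.
An inter-arrival time may vanish (batch arrivals). -/
structure ArrivalLaw (N : ℕ) where
  law : Fin N → PMF ℕ
  Vmax : ℕ
  bounded : ∀ i, ∀ n ∈ (law i).support, n ≤ Vmax
  nonzero : ∀ i, ∃ n ∈ (law i).support, n ≠ 0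

/-- The vector of the mean arrival rates, `λ_i = 1 / E[V_i]`. -/
def ArrivalLaw.rate {N : ℕ} (arr : ArrivalLaw N) : Fin N → ℝ :=
  fun i => (∫ n, (n : ℝ) ∂(arr.law i).toMeasure)⁻¹

/-- A sample point: the inter-arrival times `V_i(m)` and the services `S_i(t)`. -/
abbrev Sample (N : ℕ) : Type := (Fin N → ℕ → ℕ) × (ℕ → Fin N → ℕ)

/-- The probability measure under which the `V_i(m)` are independent, `V_i(m)` with law
`arr.law i`, the service vectors are i.i.d. over the slots with law `svc.law`, and services are
independent of arrivals. -/
def prob {N : ℕ} (svc : ServiceLaw N) (arr : ArrivalLaw N) : Measure (Sample N) :=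
  (Measure.pi fun i => Measure.infinitePi fun _ : ℕ => (arr.law i).toMeasure).prod
    (Measure.infinitePi fun _ : ℕ => svc.law.toMeasure)

/-- The slot in which job `n` of queue `i` arrives. Jobs are numbered from `0` here: job `0` arrives
in slot `V_i(0)`, and `V_i(n+1)` separates the jobs `n` and `n+1`. -/
def arrivalSlot {N : ℕ} (ω : Sample N) (i : Fin N) (n : ℕ) : ℕ :=
  ∑ l ∈ Finset.range (n + 1), ω.1 i l

/-- The number `A_i(t)` of the jobs that arrive at queue `i` in slot `t`. -/
def arrivals {N : ℕ} (ω : Sample N) (t : ℕ) (i : Fin N) : ℕ :=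
  {n : ℕ | arrivalSlot ω i n = t}.ncard

/-- The state of the system at the beginning of a slot, before the server's decision. -/
structure SysState {N : ℕ} (net : Network N) where
  /-- the queue lengths -/
  queue : Fin N → ℕ
  /-- the numbers of completed jobs -/
  done : Fin N → ℕ
  /-- the current schedule -/
  sched : net.Sched
  /-- the number of slots that the switch in progress still needs (`0`: none in progress) -/
  rem : ℕ
  /-- the vector `W(t_k)` at the latest switching time -/
  mem : Fin N → ℕ

/-- The waiting time of the head-of-line job at time `t`, which is `0` for an empty queue. -/
def SysState.wait {N : ℕ} {net : Network N} (x : SysState net) (ω : Sample N) (t : ℕ) :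
    Fin N → ℕ :=
  fun i => if x.queue i = 0 then 0 else t - arrivalSlot ω i (x.done i)

/-- What a server can see at the beginning of a slot, besides the past arrivals and services. -/
structure View {N : ℕ} (net : Network N) where
  queue : Fin N → ℕ
  wait : Fin N → ℕ
  sched : net.Sched
  rem : ℕ
  mem : Fin N → ℕ

/-- A scheduling policy: an initial schedule, and for each slot `t` a decision that may depend on
the arrivals and the services in the slots before `t` and on the current view. The decision `none`
goes on as before, and `some J` starts a switch to the schedule `J`. -/
structure Policy {N : ℕ} (net : Network N) where
  init : net.Sched
  act : (t : ℕ) → (pastArrivals pastServices : Fin t → Fin N → ℕ) → View net → Option net.Sched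

/-- Schedule, remaining switching slots and `W(t_k)` after a decision, with `w = W(t)`. -/
def decide' {N : ℕ} (net : Network N) (w : Fin N → ℕ) (I : net.Sched) (r : ℕ) (m : Fin N → ℕ) :
    Option net.Sched → net.Sched × ℕ × (Fin N → ℕ)
  | none => (I, r, m)
  | some J => (J, net.Ts, w)

/-- The service that is offered to each queue: `S_i` if the server is ACTIVE and serves queue `i`,
and `0` otherwise. -/
def offered {N : ℕ} {net : Network N} (I : net.Sched) (r : ℕ) (s : Fin N → ℕ) : Fin N → ℕ :=
  fun i => if r = 0 ∧ i ∈ I.1 then s i else 0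

/-- The evolution of the system under a policy, starting with empty queues at `t_0 = 0`. -/
def run {N : ℕ} {net : Network N} (η : Policy net) (ω : Sample N) : ℕ → SysState net
  | 0 => ⟨0, 0, η.init, 0, 0⟩
  | t + 1 =>
    let x := run η ω t
    let w := x.wait ω t
    let c := decide' net w x.sched x.rem x.mem
      (η.act t (fun τ => arrivals ω τ) (fun τ => ω.2 τ) ⟨x.queue, w, x.sched, x.rem, x.mem⟩)
    let used : Fin N → ℕ := fun i => min (x.queue i) (offered c.1 c.2.1 (ω.2 t) i)
    ⟨fun i => x.queue i - used i + arrivals ω t i, fun i => x.done i + used i,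
      c.1, c.2.1 - 1, c.2.2⟩

/-! ### Stability -/

/-- Strong stability: the time averages of the expected total queue length stay bounded. -/
def StronglyStable {N : ℕ} {net : Network N} (svc : ServiceLaw N) (arr : ArrivalLaw N)
    (η : Policy net) : Prop :=
  limsup (fun t : ℕ => (∑ τ ∈ Finset.range t,
    ∫⁻ ω, ∑ i, ((run η ω τ).queue i : ℝ≥0∞) ∂(prob svc arr)) / (t : ℝ≥0∞)) atTop < ⊤

/-- A rate vector is admissible if some policy makes the system with these rates strongly stable. -/
def Admissible {N : ℕ} (net : Network N) (svc : ServiceLaw N) (r : Fin N → ℝ) : Prop :=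
  ∃ (arr : ArrivalLaw N) (η : Policy net), arr.rate = r ∧ StronglyStable svc arr η

/-- The capacity region: the closure of the set of the admissible rate vectors. -/
def capacityRegion {N : ℕ} (net : Network N) (svc : ServiceLaw N) : Set (Fin N → ℝ) :=
  closure {r | Admissible net svc r}

/-- Throughput-optimality: strong stability for all rates in the interior of the region. -/
def ThroughputOptimal {N : ℕ} (net : Network N) (svc : ServiceLaw N) (η : Policy net) : Prop :=
  ∀ arr : ArrivalLaw N, arr.rate ∈ interior (capacityRegion net svc) → StronglyStable svc arr η

/-! ### The waiting-time-based biased max-weight policy -/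

/-- The total head-of-line waiting time `I^T W` of a schedule. -/
def weight {N : ℕ} (I : Finset (Fin N)) (w : Fin N → ℕ) : ℝ := ∑ i ∈ I, (w i : ℝ)

/-- `G(W) = max {1, (1^T W)^a}`. -/
def G {N : ℕ} (a : ℝ) (w : Fin N → ℕ) : ℝ := max 1 ((∑ i, (w i : ℝ)) ^ a)

/-- The switching condition
`(1 + T_s / G(W(t_k))) I(t)^T W(t) ≤ max_j (I^(j))^T W(t)`, with `w = W(t)`, `m = W(t_k)`. -/
def SwitchCond {N : ℕ} (net : Network N) (a : ℝ) (w : Fin N → ℕ) (I : net.Sched)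
    (m : Fin N → ℕ) : Prop :=
  (1 + (net.Ts : ℝ) / G a m) * weight I.1 w
    ≤ net.schedules.sup' net.nonempty (fun J => weight J w)

/-- A stationary decision rule based on `W(t)`, the schedule, the remaining switching slots
and `W(t_k)`. -/
abbrev Rule {N : ℕ} (net : Network N) : Type :=
  (w : Fin N → ℕ) → (I : net.Sched) → (r : ℕ) → (m : Fin N → ℕ) → Option net.Sched

/-- The policy with a given initial schedule that follows a stationary rule. -/
def Rule.toPolicy {N : ℕ} {net : Network N} (d : Rule net) (I₀ : net.Sched) : Policy net where
  init := I₀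
  act := fun _ _ _ v => d v.wait v.sched v.rem v.mem

/-- The rule is a W-BMW rule for the exponent `a`: a switch is started only under the switching
condition and only to a schedule of largest weight (ties are broken in any way), and in ACTIVE mode
the switching condition forces a switch. While a switch is in progress, a rule may react to the
condition or first complete the switch. -/
structure IsWBMW {N : ℕ} (net : Network N) (a : ℝ) (d : Rule net) : Prop where
  switch_only : ∀ w I r m J, d w I r m = some J →
    SwitchCond net a w I m ∧ ∀ J' : net.Sched, weight J'.1 w ≤ weight J.1 w
  switch_if : ∀ w I m, SwitchCond net a w I m → d w I 0 m ≠ none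

/-! ### The Markov chain of the waiting times -/

/-- A state of the waiting-time chain. `age i` is the time since the arrival of the first
uncompleted job of queue `i`; it is `≤ 0` if this job has not joined the queue yet, and then its
absolute value is the time until its arrival. Hence `W_i` is the positive part of `age i`. -/
@[ext]
structure ChainState {N : ℕ} (net : Network N) where
  age : Fin N → ℤ
  sched : net.Sched
  rem : ℕ
  mem : Fin N → ℕ

/-- The chain observed along a sample path. -/
def chain {N : ℕ} {net : Network N} (η : Policy net) (t : ℕ) (ω : Sample N) : ChainState net :=
  let x := run η ω t
  ⟨fun i => (t : ℤ) - arrivalSlot ω i (x.done i), x.sched, x.rem, x.mem⟩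

/-- Serving up to `n` waiting jobs in their order: `u` is the age of the first one, and `v` lists
the times between the successive arrivals after it. The result is the age of the first job left. -/
def serve : (n : ℕ) → (u : ℤ) → (v : ℕ → ℕ) → ℤ
  | 0, u, _ => u
  | n + 1, u, v => if u ≤ 0 then u else serve n (u - v 0) (fun l => v (l + 1))

/-- One slot of the chain, with services `s` and fresh inter-arrival times `v`. -/
def chainStep {N : ℕ} {net : Network N} (d : Rule net) (x : ChainState net) (v : Fin N → ℕ → ℕ)
    (s : Fin N → ℕ) : ChainState net :=
  let w : Fin N → ℕ := fun i => (x.age i).toNat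
  let c := decide' net w x.sched x.rem x.mem (d w x.sched x.rem x.mem)
  ⟨fun i => serve (offered c.1 c.2.1 s i) (x.age i) (v i) + 1, c.1, c.2.1 - 1, c.2.2⟩

/-- The transition probabilities of the chain. -/
def transition {N : ℕ} {net : Network N} (svc : ServiceLaw N) (arr : ArrivalLaw N) (d : Rule net)
    (x y : ChainState net) : ℝ≥0∞ :=
  prob svc arr {ω | chainStep d x ω.1 (ω.2 0) = y}

/-- `X` is a time-homogeneous Markov chain with the transition probabilities `p`. -/
def IsMarkovChain {Ω X : Type*} [MeasurableSpace Ω] (P : Measure Ω) (Z : ℕ → Ω → X)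
    (p : X → X → ℝ≥0∞) : Prop :=
  (∀ x, ∑' y, p x y = 1) ∧
  ∀ (n : ℕ) (x : ℕ → X), P {ω | ∀ k ≤ n + 1, Z k ω = x k} =
    P {ω | ∀ k ≤ n, Z k ω = x k} * p (x n) (x (n + 1))

open Classical in
/-- The probability that the chain with transition probabilities `p` that starts in `x` does not
visit `A` at the times `0, …, n`. -/
def survival {X : Type*} (p : X → X → ℝ≥0∞) (A : Set X) : ℕ → X → ℝ≥0∞
  | 0, x => if x ∈ A then 0 else 1
  | n + 1, x => if x ∈ A then 0 else ∑' y, p x y * survival p A n y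

/-- The expectation `∑ P_x(τ > n)` of the first time `τ ≥ 0` at which the chain visits `A`. -/
def expectedHitting {X : Type*} (p : X → X → ℝ≥0∞) (A : Set X) (x : X) : ℝ≥0∞ :=
  ∑' n, survival p A n x

/-- The expectation of the first time `≥ 1` at which the chain that starts in `x` is in `x`. -/
def expectedReturn {X : Type*} (p : X → X → ℝ≥0∞) (x : X) : ℝ≥0∞ :=
  1 + ∑' y, p x y * expectedHitting p {x} y

/-- A state is positive recurrent if its expected return time is finite. -/
def PosRecState {X : Type*} (p : X → X → ℝ≥0∞) (x : X) : Prop := expectedReturn p x < ⊤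

/-- Positive recurrence of a chain that need not be irreducible: from each state the chain reaches
the set of the positive recurrent states in finite expected time. For an irreducible chain this
says that all states are positive recurrent. -/
def PositiveRecurrent {X : Type*} (p : X → X → ℝ≥0∞) : Prop :=
  ∀ x, expectedHitting p {y | PosRecState p y} x < ⊤

end BMW

end

/-!
The ages of the first uncompleted jobs, the schedule, the remaining switching time and the memory
determine what happens in a slot, apart from a fresh service vector and from inter-arrival times
that have not been looked at yet. The numbers of the inter-arrival times used so far are random but
determined by the past, so the unused part of the sample is independent of the past and has the law
of a fresh sample (`map_future_restrict`, proved by splicing two independent samples). This gives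
the Markov property (`isMarkovChain`). It also expresses the queue length by the waiting time: given
the waiting time `u` of a queue, its length is the number of renewals of fresh inter-arrival times
before `u`, so that Wald's identity bounds its mean by a linear function of `u`
(`lintegral_queue_le`). For stability it therefore suffices to control the waiting times.

A stabilizing policy must complete jobs at the rate of their arrivals, and its empirical frequencies
of the schedules form a mixture of the schedules which dominates the loads up to an error. Hence
rates in the interior of the capacity region leave a slack `ε` against some mixture (`exists_slack`),
and the load-weighted waiting times stay `ε 1ᵀW` below the largest weight of a schedule.

The Lyapunov function (`lyapunov`) is `∑ ρ_i W_i²`, `ρ_i` being the load, with corrections. If the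
current schedule has nearly the largest weight, the quadratic part decreases like `2ε 1ᵀW`. The
weight lost in ACTIVE mode is at most `T_s / G(W(t_k)) Iᵀ W`. Where `W_i` is not large against the
memory `W(t_k)`, this is a small fraction of `W_i`, up to a constant. Otherwise the lost weight is
compensated by a further term, the squared excess of the waiting times of the served queues over the
memory, whose drift is negative because these queues are being served (`active_drift_le`). A switch
costs `T_s` slots without service, which is linear in the waiting times. It is paid by two credits.
If the waiting times are not far below the memory, the switching condition bounds the lost weight
times `G(W)` from below by a multiple of `1ᵀW`, and in between switches the product
`(max_j I_jᵀW - IᵀW) G(W)` increases sublinearly only, since `α < 1`. If the waiting times are far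
below the memory, the decrease since the latest switch pays (`lyapunov_switch_le`). The outcome is a
drift condition (`exists_drift`). Summed over the slots, it gives strong stability
(`stronglyStable`).

The drift condition does not give positive recurrence at once, because the set of exceptional states
(`core`) bounds the waiting times but not the memory, so that it is infinite. Two cases arise for an
ACTIVE state of the core. If the current schedule can lose its optimality while it is kept, then with
a positive probability this happens, unless a switch comes earlier; once it has happened, the
switching condition holds unless the memory is bounded, and a switch resets the memory. Hence a
finite box is reached within a time and with a probability that do not depend on the memory
(`eventually_survival_box_le`). Otherwise the state is `frozen`: no further switch happens, and the
memory is an inert label, so that up to a relabeling (`memEquiv`) the frozen core states are finitely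
many. In both cases a positive recurrent state is accessible (`exists_accessible_posRecState`), and
the positive recurrent states are hit from the core within a fixed time with a probability bounded
from below. Foster's criterion with such trials (`expectedHitting_le_of_trials`) bounds the expected
hitting time.
-/

noncomputable section

namespace BMW

/-! ### Hitting times of countable Markov chains -/

section HittingTimes

variable {X : Type*} {p : X → X → ℝ≥0∞}

/-- The transition operator `f ↦ (x ↦ E_x f(X_1))` of a chain. -/
def expStep (p : X → X → ℝ≥0∞) (f : X → ℝ≥0∞) (x : X) : ℝ≥0∞ := ∑' y, p x y * f y

lemma expStep_mono {f g : X → ℝ≥0∞} (x : X) (h : ∀ y, p x y ≠ 0 → f y ≤ g y) :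
    expStep p f x ≤ expStep p g x := by
  refine ENNReal.tsum_le_tsum fun y => ?_
  by_cases hy : p x y = 0
  · simp [hy]
  · gcongr; exact h y hy

lemma expStep_congr {f g : X → ℝ≥0∞} (x : X) (h : ∀ y, p x y ≠ 0 → f y = g y) :
    expStep p f x = expStep p g x :=
  le_antisymm (expStep_mono x fun y hy => (h y hy).le) (expStep_mono x fun y hy => (h y hy).ge)

lemma expStep_add (f g : X → ℝ≥0∞) (x : X) :
    expStep p (fun y => f y + g y) x = expStep p f x + expStep p g x := by
  simp only [expStep, mul_add, ENNReal.tsum_add]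

lemma expStep_const_mul (c : ℝ≥0∞) (f : X → ℝ≥0∞) (x : X) :
    expStep p (fun y => c * f y) x = c * expStep p f x := by
  simp only [expStep, ← ENNReal.tsum_mul_left]
  exact tsum_congr fun y => by ring

lemma expStep_const (hp : ∀ x, ∑' y, p x y = 1) (c : ℝ≥0∞) (x : X) :
    expStep p (fun _ => c) x = c := by
  simp only [expStep, ENNReal.tsum_mul_right, hp, one_mul]

lemma survival_of_mem {A : Set X} {x : X} (hx : x ∈ A) (n : ℕ) : survival p A n x = 0 := by
  cases n <;> simp [survival, hx]

lemma survival_succ_of_notMem {A : Set X} {x : X} (hx : x ∉ A) (n : ℕ) :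
    survival p A (n + 1) x = expStep p (survival p A n) x := by
  simp [survival, hx, expStep]

lemma survival_zero_of_notMem {A : Set X} {x : X} (hx : x ∉ A) : survival p A 0 x = 1 := by
  simp [survival, hx]

lemma survival_le_one (hp : ∀ x, ∑' y, p x y = 1) (A : Set X) (n : ℕ) (x : X) :
    survival p A n x ≤ 1 := by
  by_cases hx : x ∈ A
  · simp [survival_of_mem hx]
  induction n generalizing x with
  | zero => simp [survival_zero_of_notMem hx]
  | succ n ih =>
    rw [survival_succ_of_notMem hx, ← expStep_const hp 1 x]
    refine expStep_mono x fun y _ => ?_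
    by_cases hy : y ∈ A
    · simp [survival_of_mem hy]
    · exact ih y hy

lemma survival_succ_le (hp : ∀ x, ∑' y, p x y = 1) (A : Set X) (n : ℕ) (x : X) :
    survival p A (n + 1) x ≤ survival p A n x := by
  by_cases hx : x ∈ A
  · simp [survival_of_mem hx]
  induction n generalizing x with
  | zero => rw [survival_zero_of_notMem hx]; exact survival_le_one hp A _ x
  | succ n ih =>
    rw [survival_succ_of_notMem hx, survival_succ_of_notMem hx]
    refine expStep_mono x fun y _ => ?_
    by_cases hy : y ∈ A
    · simp [survival_of_mem hy]
    · exact ih y hy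

lemma survival_antitone (hp : ∀ x, ∑' y, p x y = 1) (A : Set X) (x : X) :
    Antitone fun n => survival p A n x :=
  antitone_nat_of_succ_le fun n => survival_succ_le hp A n x

/-- A larger target is hit earlier. -/
lemma survival_anti_set {A B : Set X} (hAB : A ⊆ B) (n : ℕ) (x : X) :
    survival p B n x ≤ survival p A n x := by
  by_cases hx : x ∈ B
  · simp [survival_of_mem hx]
  have hxA : x ∉ A := fun h => hx (hAB h)
  induction n generalizing x with
  | zero => simp [survival_zero_of_notMem hx, survival_zero_of_notMem hxA]
  | succ n ih =>
    rw [survival_succ_of_notMem hx, survival_succ_of_notMem hxA]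
    refine expStep_mono x fun y _ => ?_
    by_cases hy : y ∈ B
    · simp [survival_of_mem hy]
    · exact ih y hy fun h => hy (hAB h)

/-- On a closed set `Y`, only the part of the target inside `Y` matters. -/
lemma survival_congr_closed {A B Y : Set X} (hY : ∀ x ∈ Y, ∀ y, p x y ≠ 0 → y ∈ Y)
    (hAB : ∀ x ∈ Y, x ∈ A ↔ x ∈ B) (n : ℕ) {x : X} (hx : x ∈ Y) :
    survival p A n x = survival p B n x := by
  by_cases hxA : x ∈ A
  · rw [survival_of_mem hxA, survival_of_mem ((hAB x hx).1 hxA)]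
  have hxB : x ∉ B := fun h => hxA ((hAB x hx).2 h)
  induction n generalizing x with
  | zero => rw [survival_zero_of_notMem hxA, survival_zero_of_notMem hxB]
  | succ n ih =>
    rw [survival_succ_of_notMem hxA, survival_succ_of_notMem hxB]
    refine expStep_congr x fun y hy => ?_
    have hyY := hY x hx y hy
    by_cases hyA : y ∈ A
    · rw [survival_of_mem hyA, survival_of_mem ((hAB y hyY).1 hyA)]
    · exact ih hyY hyA fun h => hyA ((hAB y hyY).2 h)

/-- First-step analysis of the expected hitting time. -/
lemma expectedHitting_of_notMem {A : Set X} {x : X} (hx : x ∉ A) :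
    expectedHitting p A x = 1 + expStep p (expectedHitting p A) x := by
  unfold expectedHitting
  rw [tsum_eq_zero_add' ENNReal.summable, survival_zero_of_notMem hx]
  congr 1
  simp only [survival_succ_of_notMem hx, expStep, ← ENNReal.tsum_mul_left]
  exact ENNReal.tsum_comm

open Classical in
/-- The transition operator of the chain that is killed when it is in `A`. -/
def killedStep (p : X → X → ℝ≥0∞) (A : Set X) (f : X → ℝ≥0∞) (x : X) : ℝ≥0∞ :=
  if x ∈ A then 0 else expStep p f x

lemma survival_succ_eq_killedStep (A : Set X) (n : ℕ) :
    survival p A (n + 1) = killedStep p A (survival p A n) := by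
  ext x
  by_cases hx : x ∈ A
  · simp [killedStep, hx, survival_of_mem hx]
  · simp [killedStep, hx, survival_succ_of_notMem hx]

lemma survival_add (A : Set X) (T n : ℕ) :
    survival p A (n + T) = (killedStep p A)^[T] (survival p A n) := by
  induction T with
  | zero => rfl
  | succ T ih =>
    rw [← add_assoc, survival_succ_eq_killedStep, ih, Function.iterate_succ_apply']

lemma killedStep_mono {A : Set X} {f g : X → ℝ≥0∞} (h : f ≤ g) :
    killedStep p A f ≤ killedStep p A g := by
  intro x
  unfold killedStep
  split_ifs
  · exact le_rfl
  · exact expStep_mono x fun y _ => h y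

lemma killedStep_iterate_mono {A : Set X} {f g : X → ℝ≥0∞} (h : f ≤ g) (T : ℕ) :
    (killedStep p A)^[T] f ≤ (killedStep p A)^[T] g := by
  induction T with
  | zero => exact h
  | succ T ih => simpa only [Function.iterate_succ_apply'] using killedStep_mono ih

lemma killedStep_iterate_add {A : Set X} (f g : X → ℝ≥0∞) (c : ℝ≥0∞) (T : ℕ) :
    (killedStep p A)^[T] (fun x => f x + c * g x) =
      fun x => (killedStep p A)^[T] f x + c * (killedStep p A)^[T] g x := by
  induction T with
  | zero => rfl
  | succ T ih =>
    simp only [Function.iterate_succ_apply', ih]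
    ext x
    unfold killedStep
    split_ifs
    · simp
    · rw [expStep_add, expStep_const_mul]

lemma killedStep_iterate_finset_sum {A : Set X} (f : ℕ → X → ℝ≥0∞) (n T : ℕ) :
    (killedStep p A)^[T] (fun x => ∑ k ∈ Finset.range n, f k x) =
      fun x => ∑ k ∈ Finset.range n, (killedStep p A)^[T] (f k) x := by
  induction n with
  | zero =>
    ext x
    simp only [Finset.range_zero, Finset.sum_empty]
    induction T generalizing x with
    | zero => rfl
    | succ T ih =>
      rw [Function.iterate_succ_apply']
      by_cases hx : x ∈ A
      · simp [killedStep, hx]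
      · simp only [killedStep, hx, if_false, expStep, ENNReal.tsum_eq_zero]
        exact fun y => mul_eq_zero_of_right _ (ih y)
  | succ n ih =>
    have := killedStep_iterate_add (p := p) (A := A) (fun x => ∑ k ∈ Finset.range n, f k x)
      (f n) 1 T
    simp only [one_mul] at this
    simp only [Finset.sum_range_succ, this, ih]

/-- **Foster's criterion with trials.** A function `Φ` decreases by `1` on average in each step
off the set `F` and increases by at most `b` anywhere. From each state of `F` the target `A` is hit
within `T` steps with probability at least `q`. Each visit to `F` may then be counted as a trial
that costs at most `T * (1 + b)`, and the expected number of trials is at most `1 / q`. Neither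
`F` nor the values of `Φ` on `F` need to be bounded. -/
theorem expectedHitting_le_of_trials {A F : Set X} {Φ : X → ℝ≥0∞} {b q : ℝ≥0∞} {T : ℕ}
    (hT : 0 < T) (hq : q ≠ 0) (hq1 : q ≤ 1)
    (hp : ∀ x, ∑' y, p x y = 1)
    (hout : ∀ x, x ∉ A → x ∉ F → expStep p Φ x + 1 ≤ Φ x)
    (hall : ∀ x, x ∉ A → expStep p Φ x ≤ Φ x + b)
    (htrial : ∀ x ∈ F, survival p A T x ≤ 1 - q) (x : X) :
    expectedHitting p A x ≤ Φ x + T * (1 + b) / q := by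
  have hqt : q ≠ ⊤ := ne_top_of_le_ne_top ENNReal.one_ne_top hq1
  set K : ℝ≥0∞ := T * (1 + b) / q with hK
  have hKq : K * q = T * (1 + b) := ENNReal.div_mul_cancel hq hqt
  have hK1 : (T : ℝ≥0∞) * (1 + b) ≤ K := by
    rw [← hKq]; exact mul_le_of_le_one_right' hq1
  have hTK : (T : ℝ≥0∞) ≤ K := le_trans (le_mul_of_one_le_right' le_self_add) hK1
  have hkill : ∀ t x, (killedStep p A)^[t] Φ x ≤ Φ x + t * b := by
    intro t
    induction t with
    | zero => intro x; simp
    | succ t ih =>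
      intro x
      rw [Function.iterate_succ_apply']
      unfold killedStep
      split_ifs with hx
      · exact zero_le
      · calc expStep p ((killedStep p A)^[t] Φ) x ≤ expStep p (fun y => Φ y + t * b) x :=
              expStep_mono x fun y _ => ih y
          _ = expStep p Φ x + t * b := by rw [expStep_add, expStep_const hp]
          _ ≤ Φ x + b + t * b := by gcongr; exact hall x hx
          _ = _ := by push_cast; ring
  set h : ℕ → X → ℝ≥0∞ := fun n x => ∑ k ∈ Finset.range n, survival p A k x with hh
  have hmono : ∀ x, Monotone fun n => h n x := fun x m n hmn =>
    Finset.sum_le_sum_of_subset (Finset.range_mono hmn)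
  have hzero : ∀ n x, x ∈ A → h n x = 0 := fun n x hx => by simp [hh, survival_of_mem hx]
  have hstep : ∀ n t x, h (n + t) x ≤ t + (killedStep p A)^[t] (h n) x := by
    intro n t x
    have e : (killedStep p A)^[t] (h n) x = ∑ k ∈ Finset.range n, survival p A (k + t) x := by
      simp only [hh, killedStep_iterate_finset_sum, survival_add]
    rw [e, hh]
    simp only
    rw [add_comm n t, Finset.sum_range_add]
    gcongr
    · calc ∑ k ∈ Finset.range t, survival p A k x ≤ ∑ k ∈ Finset.range t, 1 :=
          Finset.sum_le_sum fun k _ => survival_le_one hp A k x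
        _ = t := by simp
    · rw [add_comm]
  have main : ∀ n x, h n x ≤ Φ x + K := by
    intro n
    induction n using Nat.strong_induction_on with
    | _ n ih =>
    intro x
    by_cases hx : x ∈ A
    · simp [hzero n x hx]
    have hle : ∀ m < n, h m ≤ fun y => Φ y + K * survival p A 0 y := by
      intro m hm y
      by_cases hy : y ∈ A
      · simp [hzero m y hy]
      · simpa [survival_zero_of_notMem hy] using ih m hm y
    have hit : ∀ m < n, ∀ t, (killedStep p A)^[t] (h m) x ≤
        (killedStep p A)^[t] Φ x + K * survival p A t x := by
      intro m hm t
      refine (killedStep_iterate_mono (hle m hm) t x).trans (le_of_eq ?_)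
      rw [killedStep_iterate_add, ← survival_add, zero_add]
    rcases Nat.eq_zero_or_pos n with rfl | hn
    · simp [hh]
    by_cases hF : x ∈ F
    · calc h n x ≤ h (n - T + T) x := hmono x (by omega)
        _ ≤ T + (killedStep p A)^[T] (h (n - T)) x := hstep _ _ _
        _ ≤ T + ((killedStep p A)^[T] Φ x + K * survival p A T x) := by
          gcongr; exact hit _ (by omega) T
        _ ≤ T + ((Φ x + T * b) + K * (1 - q)) := by
          gcongr
          · exact hkill T x
          · exact htrial x hF
        _ = Φ x + (K * q + K * (1 - q)) := by rw [hKq]; ring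
        _ = Φ x + K := by rw [← mul_add, add_tsub_cancel_of_le hq1, mul_one]
    · calc h n x ≤ h (n - 1 + 1) x := hmono x (by omega)
        _ ≤ (1 : ℕ) + (killedStep p A)^[1] (h (n - 1)) x := hstep _ _ _
        _ ≤ (1 : ℕ) + ((killedStep p A)^[1] Φ x + K * survival p A 1 x) := by
          gcongr; exact hit _ (by omega) 1
        _ ≤ 1 + (expStep p Φ x + K * 1) := by
          rw [Nat.cast_one]
          gcongr
          · simp [killedStep, hx]
          · exact survival_le_one hp A 1 x
        _ = expStep p Φ x + 1 + K := by ring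
        _ ≤ Φ x + K := by gcongr; exact hout x hx hF
  unfold expectedHitting
  rw [ENNReal.tsum_eq_iSup_nat]
  exact iSup_le fun n => main n x

/-- A state `y` is accessible from `x` if there is a path of possible transitions. -/
def Accessible (p : X → X → ℝ≥0∞) : X → X → Prop := Relation.ReflTransGen fun x y => p x y ≠ 0

lemma exists_survival_lt_one (hp : ∀ x, ∑' y, p x y = 1) {A : Set X} {x a : X}
    (h : Accessible p x a) (ha : a ∈ A) : ∃ n, survival p A n x < 1 := by
  induction h using Relation.ReflTransGen.head_induction_on with
  | refl => exact ⟨0, by simp [survival_of_mem ha]⟩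
  | @head x y hxy _ ih =>
    obtain ⟨n, hn⟩ := ih
    refine ⟨n + 1, ?_⟩
    by_cases hx : x ∈ A
    · simp [survival_of_mem hx]
    rw [survival_succ_of_notMem hx, ← hp x]
    refine ENNReal.tsum_lt_tsum (i := y) ?_ (fun z => ?_) ?_
    · exact ne_top_of_le_ne_top ENNReal.one_ne_top
        ((expStep_mono x fun z _ => survival_le_one hp A n z).trans_eq (expStep_const hp 1 x))
    · exact mul_le_of_le_one_right' (survival_le_one hp A n z)
    · have ht : p x y ≠ ⊤ :=
        ne_top_of_le_ne_top ENNReal.one_ne_top ((ENNReal.le_tsum y).trans_eq (hp x))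
      calc p x y * survival p A n y < p x y * 1 := by
            rw [ENNReal.mul_lt_mul_iff_right hxy ht]; exact hn
        _ = p x y := mul_one _

lemma exists_accessible_of_survival_lt_one (hp : ∀ x, ∑' y, p x y = 1) {A : Set X} {n : ℕ} {x : X}
    (h : survival p A n x < 1) : ∃ a ∈ A, Accessible p x a := by
  by_contra! hcon
  have : survival p A n x = survival p ∅ n x :=
    survival_congr_closed (Y := {y | Accessible p x y}) (fun y hy z hz => hy.tail hz)
      (fun y hy => by simpa using fun hyA => hcon y hyA hy) n Relation.ReflTransGen.refl
  have hone : ∀ n (y : X), survival p ∅ n y = 1 := by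
    intro n
    induction n with
    | zero => intro y; simp [survival]
    | succ n ih =>
      intro y
      rw [survival_succ_of_notMem (by simp), funext ih, expStep_const hp]
  rw [this, hone] at h
  exact lt_irrefl _ h

lemma exists_accessible_of_expectedHitting_lt_top (hp : ∀ x, ∑' y, p x y = 1) {A : Set X} {x : X}
    (h : expectedHitting p A x < ⊤) : ∃ a ∈ A, Accessible p x a := by
  by_contra! hcon
  have : ∀ n, survival p A n x = 1 := fun n => by
    refine le_antisymm (survival_le_one hp A n x) (not_lt.1 fun hn => ?_)
    obtain ⟨a, ha, hxa⟩ := exists_accessible_of_survival_lt_one hp hn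
    exact hcon a ha hxa
  simp [expectedHitting, this] at h

/-- On a finite set of states, pointwise accessibility of `A` is uniform. -/
lemma exists_uniform_trial (hp : ∀ x, ∑' y, p x y = 1) {A F : Set X} (hF : F.Finite)
    (h : ∀ x ∈ F, ∃ n, survival p A n x < 1) :
    ∃ T : ℕ, 0 < T ∧ ∃ q : ℝ≥0∞, q ≠ 0 ∧ q ≤ 1 ∧ ∀ x ∈ F, survival p A T x ≤ 1 - q := by
  induction F, hF using Set.Finite.induction_on with
  | empty => exact ⟨1, one_pos, 1, one_ne_zero, le_rfl, by simp⟩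
  | @insert a s _ _ ih =>
    obtain ⟨T, hT, q, hq, hq1, hs⟩ := ih fun x hx => h x (Set.mem_insert_of_mem _ hx)
    obtain ⟨n, hn⟩ := h a (Set.mem_insert _ _)
    refine ⟨T + n, by omega, min q (1 - survival p A n a), ?_, (min_le_left _ _).trans hq1, ?_⟩
    · exact (lt_min (pos_iff_ne_zero.2 hq) (tsub_pos_iff_lt.2 hn)).ne'
    · rintro x (rfl | hx)
      · refine (survival_antitone hp A x (Nat.le_add_left n T)).trans ?_
        calc survival p A n x = 1 - (1 - survival p A n x) :=
              (ENNReal.sub_sub_cancel ENNReal.one_ne_top hn.le).symm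
          _ ≤ _ := tsub_le_tsub_left (min_le_right _ _) _
      · exact (survival_antitone hp A x (Nat.le_add_right T n)).trans
          ((hs x hx).trans (tsub_le_tsub_left (min_le_left _ _) _))

/-- If a chain returns from a closed set `Y` to a finite set `F` in finite expected time, then a
positive recurrent state is accessible from each state of `Y`: a state of `F` from which as few
states of `F` as possible are accessible is positive recurrent. -/
theorem exists_accessible_posRecState (hp : ∀ x, ∑' y, p x y = 1) {F Y : Set X} (hF : F.Finite)
    (hY : ∀ x ∈ Y, ∀ y, p x y ≠ 0 → y ∈ Y)
    (hhit : ∀ y ∈ Y, expectedHitting p F y < ⊤)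
    (hret : ∀ y ∈ F, y ∈ Y → expStep p (expectedHitting p F) y < ⊤) {x : X} (hx : x ∈ Y) :
    ∃ y, PosRecState p y ∧ Accessible p x y := by
  classical
  have hYacc : ∀ {u v : X}, u ∈ Y → Accessible p u v → v ∈ Y := by
    intro u v hu huv
    induction huv with
    | refl => exact hu
    | tail _ h ih => exact hY _ ih _ h
  let R : X → Set X := fun f => {g ∈ F | Accessible p f g}
  have hRfin : ∀ f, (R f).Finite := fun f => hF.subset fun g hg => hg.1
  obtain ⟨f, ⟨hfF, hxf⟩, hmin⟩ : ∃ f ∈ R x, ∀ g ∈ R x, (R f).ncard ≤ (R g).ncard := by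
    obtain ⟨a, haF, hxa⟩ := exists_accessible_of_expectedHitting_lt_top hp (hhit x hx)
    exact Set.exists_min_image (R x) (fun f => (R f).ncard) (hRfin x) ⟨a, haF, hxa⟩
  have hfY : f ∈ Y := hYacc hx hxf
  have hback : ∀ z, Accessible p f z → Accessible p z f := by
    intro z hz
    obtain ⟨g, hgF, hzg⟩ :=
      exists_accessible_of_expectedHitting_lt_top hp (hhit z (hYacc hfY hz))
    have hsub : R g ⊆ R f := fun k hk => ⟨hk.1, (hz.trans hzg).trans hk.2⟩
    have heq : R g = R f := Set.eq_of_subset_of_ncard_le hsub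
      (hmin g ⟨hgF, (hxf.trans hz).trans hzg⟩) (hRfin f)
    have : f ∈ R g := heq ▸ ⟨hfF, Relation.ReflTransGen.refl⟩
    exact hzg.trans this.2
  set Z : Set X := {z | Accessible p f z} with hZ
  have hZcl : ∀ z ∈ Z, ∀ y, p z y ≠ 0 → y ∈ Z := fun z hz y hy => hz.tail hy
  set A : Set X := {f} ∪ Zᶜ with hA
  obtain ⟨T, hT, q, hq, hq1, htrial⟩ := exists_uniform_trial (p := p) (A := A) hp hF fun z _ => by
    by_cases hz : z ∈ A
    · exact ⟨0, by simp [survival_of_mem hz]⟩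
    · have hzZ : Accessible p f z := by
        by_contra hcon
        exact hz (Or.inr hcon)
      exact exists_survival_lt_one hp (hback z hzZ) (Or.inl rfl)
  set b : ℝ≥0∞ := ∑ y ∈ hF.toFinset.filter (· ∈ Y), expStep p (expectedHitting p F) y with hb
  have hbt : b ≠ ⊤ := by
    rw [hb, ENNReal.sum_ne_top]
    intro y hy
    simp only [Finset.mem_filter, Set.Finite.mem_toFinset] at hy
    exact (hret y hy.1 hy.2).ne
  have hbound := expectedHitting_le_of_trials (A := A) (F := F) (Φ := expectedHitting p F) (b := b)
    hT hq hq1 hp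
    (fun z _ hzF => by rw [expectedHitting_of_notMem hzF, add_comm])
    (fun z hzA => by
      have hzZ : z ∈ Z := by
        by_contra hcon
        exact hzA (Or.inr hcon)
      by_cases hzF : z ∈ F
      · refine le_trans ?_ le_add_self
        refine Finset.single_le_sum (f := fun y => expStep p (expectedHitting p F) y)
          (fun _ _ => zero_le) ?_
        simp [hzF, hYacc hfY hzZ]
      · rw [expectedHitting_of_notMem hzF]
        exact le_self_add.trans' le_add_self)
    htrial
  refine ⟨f, ?_, hxf⟩
  unfold PosRecState expectedReturn
  have heq : ∀ z ∈ Z, expectedHitting p {f} z = expectedHitting p A z := fun z hz =>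
    tsum_congr fun n => survival_congr_closed hZcl (fun y hy => by simp [hA, hy]) n hz
  have h1 : expStep p (expectedHitting p {f}) f ≤
      expStep p (expectedHitting p F) f + T * (1 + b) / q := by
    rw [← expStep_const hp (T * (1 + b) / q) f, ← expStep_add]
    refine expStep_mono f fun y hy => ?_
    rw [heq y (hZcl f Relation.ReflTransGen.refl y hy)]
    exact hbound y
  refine ENNReal.add_lt_top.2 ⟨ENNReal.one_lt_top, h1.trans_lt ?_⟩
  refine ENNReal.add_lt_top.2 ⟨hret f hfF hfY, ENNReal.div_lt_top ?_ hq⟩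
  exact ENNReal.mul_ne_top (ENNReal.natCast_ne_top T)
    (ENNReal.add_ne_top.2 ⟨ENNReal.one_ne_top, hbt⟩)

/-- A bijection of the states that commutes with the transitions on a closed set `Z` preserves the
law of the hitting times on `Z`. -/
lemma survival_equiv (σ : X ≃ X) {Z A B : Set X} (hZ : ∀ x ∈ Z, ∀ y, p x y ≠ 0 → y ∈ Z)
    (hσ : ∀ x ∈ Z, ∀ y, p (σ x) (σ y) = p x y) (hAB : ∀ x ∈ Z, σ x ∈ B ↔ x ∈ A) (n : ℕ) {x : X}
    (hx : x ∈ Z) : survival p B n (σ x) = survival p A n x := by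
  by_cases hxA : x ∈ A
  · rw [survival_of_mem hxA, survival_of_mem ((hAB x hx).2 hxA)]
  have hxB : σ x ∉ B := fun h => hxA ((hAB x hx).1 h)
  induction n generalizing x with
  | zero => rw [survival_zero_of_notMem hxA, survival_zero_of_notMem hxB]
  | succ n ih =>
    rw [survival_succ_of_notMem hxA, survival_succ_of_notMem hxB]
    unfold expStep
    rw [← σ.tsum_eq]
    simp only [hσ x hx]
    refine expStep_congr (f := fun y => survival p B n (σ y)) x fun y hy => ?_
    have hyZ := hZ x hx y hy
    by_cases hyA : y ∈ A
    · rw [survival_of_mem hyA, survival_of_mem ((hAB y hyZ).2 hyA)]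
    · exact ih hyZ hyA fun h => hyA ((hAB y hyZ).1 h)

lemma posRecState_equiv (σ : X ≃ X) {Z : Set X} (hZ : ∀ x ∈ Z, ∀ y, p x y ≠ 0 → y ∈ Z)
    (hσ : ∀ x ∈ Z, ∀ y, p (σ x) (σ y) = p x y) {x : X} (hx : x ∈ Z) :
    PosRecState p (σ x) ↔ PosRecState p x := by
  unfold PosRecState expectedReturn
  rw [← σ.tsum_eq]
  simp only [hσ x hx]
  suffices h : expStep p (fun y => expectedHitting p {σ x} (σ y)) x =
      expStep p (expectedHitting p {x}) x by
    unfold expStep at h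
    rw [h]
  exact expStep_congr x fun y hy => tsum_congr fun n =>
    survival_equiv σ hZ hσ (fun z _ => by simp) n (hZ x hx y hy)

end HittingTimes

/-! ### Splicing independent samples -/

section Splice

/-- The sequence that starts with the first `n` entries of `v` and goes on with `v'`. -/
def spliceSeq {α : Type*} (n : ℕ) (v v' : ℕ → α) (l : ℕ) : α := if l < n then v l else v' (l - n)

lemma spliceSeq_of_lt {α : Type*} {n l : ℕ} (h : l < n) (v v' : ℕ → α) :
    spliceSeq n v v' l = v l := by simp [spliceSeq, h]

lemma spliceSeq_add {α : Type*} (n l : ℕ) (v v' : ℕ → α) :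
    spliceSeq n v v' (n + l) = v' l := by simp [spliceSeq]

lemma measurable_spliceSeq {α : Type*} [MeasurableSpace α] (n : ℕ) :
    Measurable fun q : (ℕ → α) × (ℕ → α) => spliceSeq n q.1 q.2 := by
  refine measurable_pi_lambda _ fun l => ?_
  by_cases h : l < n
  · simp only [spliceSeq, h, if_true]; fun_prop
  · simp only [spliceSeq, h, if_false]; fun_prop

lemma measurePreserving_spliceSeq {α : Type*} [MeasurableSpace α] (μ : Measure α)
    [IsProbabilityMeasure μ] (n : ℕ) :
    MeasurePreserving (fun q : (ℕ → α) × (ℕ → α) => spliceSeq n q.1 q.2)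
      ((Measure.infinitePi fun _ : ℕ => μ).prod (Measure.infinitePi fun _ : ℕ => μ))
      (Measure.infinitePi fun _ : ℕ => μ) := by
  refine ⟨measurable_spliceSeq n, Measure.eq_infinitePi _ fun s t ht => ?_⟩
  rw [Measure.map_apply (measurable_spliceSeq n) (.pi s.countable_toSet fun i _ => ht i)]
  have : (fun q : (ℕ → α) × (ℕ → α) => spliceSeq n q.1 q.2) ⁻¹' (Set.pi s t) =
      (Set.pi (s.filter (· < n) : Finset ℕ) t) ×ˢ
        (Set.pi ((s.filter (¬ · < n)).image (· - n) : Finset ℕ) fun l => t (l + n)) := by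
    ext ⟨v, v'⟩
    simp only [Set.mem_preimage, Set.mem_pi, Set.mem_prod, Finset.mem_coe, Finset.mem_filter,
      Finset.mem_image]
    constructor
    · refine fun h => ⟨fun i hi => ?_, ?_⟩
      · simpa [spliceSeq, hi.2] using h i hi.1
      · rintro _ ⟨i, hi, rfl⟩
        have := h i hi.1
        simp only [spliceSeq, hi.2, if_false] at this
        rwa [Nat.sub_add_cancel (not_lt.1 hi.2)]
    · rintro ⟨h1, h2⟩ i hi
      by_cases hin : i < n
      · simpa [spliceSeq, hin] using h1 i ⟨hi, hin⟩
      · have := h2 (i - n) ⟨i, ⟨hi, hin⟩, rfl⟩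
        rw [Nat.sub_add_cancel (not_lt.1 hin)] at this
        simpa [spliceSeq, hin] using this
  rw [this, Measure.prod_prod, Measure.infinitePi_pi _ fun i _ => ht i,
    Measure.infinitePi_pi _ fun i _ => ht _, Finset.prod_image,
    ← Finset.prod_filter_mul_prod_filter_not s (· < n)]
  · congr 1
    refine Finset.prod_congr rfl fun i hi => ?_
    rw [Nat.sub_add_cancel (not_lt.1 (Finset.mem_filter.1 hi).2)]
  · intro i hi j hj hij
    have h1 := (Finset.mem_filter.1 hi).2
    have h2 := (Finset.mem_filter.1 hj).2
    simp only at hij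
    omega

lemma measurePreserving_prod_prod_comm {α β : Type*} [MeasurableSpace α] [MeasurableSpace β]
    (μ : Measure α) (ν : Measure β) [IsProbabilityMeasure μ] [IsProbabilityMeasure ν] :
    MeasurePreserving (fun q : (α × β) × (α × β) => ((q.1.1, q.2.1), (q.1.2, q.2.2)))
      ((μ.prod ν).prod (μ.prod ν)) ((μ.prod μ).prod (ν.prod ν)) := by
  have h1 := measurePreserving_prodAssoc μ ν (μ.prod ν)
  have h2 := (MeasurePreserving.id μ).prod ((measurePreserving_prodAssoc ν μ ν).symm)
  have h3 := (MeasurePreserving.id μ).prod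
    ((Measure.measurePreserving_swap (μ := ν) (ν := μ)).prod (MeasurePreserving.id ν))
  have h4 := (MeasurePreserving.id μ).prod (measurePreserving_prodAssoc μ ν ν)
  have h5 := (measurePreserving_prodAssoc μ μ (ν.prod ν)).symm
  exact h5.comp (h4.comp (h3.comp (h2.comp h1)))

variable {N : ℕ} (svc : ServiceLaw N) (arr : ArrivalLaw N)

instance : IsProbabilityMeasure (prob svc arr) := by unfold prob; infer_instance

/-- The sample that follows `ω` for the first `D i` inter-arrival times of each queue `i` and for
the services of the first `n` slots, and follows `ω'` afterwards. -/
def splice (D : Fin N → ℕ) (n : ℕ) (ω ω' : Sample N) : Sample N :=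
  (fun i => spliceSeq (D i) (ω.1 i) (ω'.1 i), spliceSeq n ω.2 ω'.2)

lemma measurePreserving_splice (D : Fin N → ℕ) (n : ℕ) :
    MeasurePreserving (fun q : Sample N × Sample N => splice D n q.1 q.2)
      ((prob svc arr).prod (prob svc arr)) (prob svc arr) := by
  have hV := (measurePreserving_pi
      (fun i => (Measure.infinitePi fun _ : ℕ => (arr.law i).toMeasure).prod
        (Measure.infinitePi fun _ : ℕ => (arr.law i).toMeasure))
      (fun i => Measure.infinitePi fun _ : ℕ => (arr.law i).toMeasure)
      (fun i => measurePreserving_spliceSeq (arr.law i).toMeasure (D i))).comp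
    (measurePreserving_arrowProdEquivProdArrow (ℕ → ℕ) (ℕ → ℕ) (Fin N)
      (fun i => Measure.infinitePi fun _ : ℕ => (arr.law i).toMeasure)
      (fun i => Measure.infinitePi fun _ : ℕ => (arr.law i).toMeasure)).symm
  have hS := measurePreserving_spliceSeq svc.law.toMeasure n
  exact (hV.prod hS).comp (measurePreserving_prod_prod_comm _ _)

end Splice

/-! ### Renewal counts and Wald's identity -/

section Wald

/-- The number of the partial sums of `v`, the empty one included, that are less than `u`. -/
def renewalCount (u : ℕ) (v : ℕ → ℕ) : ℝ≥0∞ :=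
  ∑' l, if ∑ j ∈ Finset.range l, v j < u then 1 else 0

/-- The first partial sum of `v` that is at least `u`, written as a series. -/
def renewalEnd (u : ℕ) (v : ℕ → ℕ) : ℝ≥0∞ :=
  ∑' l, if ∑ j ∈ Finset.range l, v j < u then (v l : ℝ≥0∞) else 0

/-- The partial sums of `v` are unbounded. -/
def Unbounded (v : ℕ → ℕ) : Prop := ∀ u, ∃ n, u ≤ ∑ j ∈ Finset.range n, v j

lemma renewalEnd_le {u K : ℕ} {v : ℕ → ℕ} (hv : ∀ l, v l ≤ K) : renewalEnd u v ≤ u + K := by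
  unfold renewalEnd
  rw [ENNReal.tsum_eq_iSup_nat]
  refine iSup_le fun n => ?_
  have h : ∑ l ∈ Finset.range n, (if ∑ j ∈ Finset.range l, v j < u then v l else 0) ≤
      min (∑ j ∈ Finset.range n, v j) (u + K) := by
    induction n with
    | zero => simp
    | succ n ih =>
      rw [Finset.sum_range_succ, Finset.sum_range_succ (fun j => v j)]
      have := hv n
      split_ifs <;> omega
  calc _ = ((∑ l ∈ Finset.range n,
        (if ∑ j ∈ Finset.range l, v j < u then v l else 0) : ℕ) : ℝ≥0∞) := by
        push_cast; rfl
    _ ≤ ((u + K : ℕ) : ℝ≥0∞) := by exact_mod_cast h.trans (min_le_right _ _)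
    _ = _ := by push_cast; rfl

lemma le_renewalEnd {u : ℕ} {v : ℕ → ℕ} (hv : Unbounded v) : (u : ℝ≥0∞) ≤ renewalEnd u v := by
  obtain ⟨n, hn⟩ := hv u
  have h : ∀ n, min (∑ j ∈ Finset.range n, v j) u ≤
      ∑ l ∈ Finset.range n, (if ∑ j ∈ Finset.range l, v j < u then v l else 0) := by
    intro n
    induction n with
    | zero => simp
    | succ n ih =>
      rw [Finset.sum_range_succ v n, Finset.sum_range_succ]
      split_ifs <;> omega
  have hn' := h n
  rw [min_eq_right hn] at hn'
  calc (u : ℝ≥0∞) ≤ ((∑ l ∈ Finset.range n,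
        (if ∑ j ∈ Finset.range l, v j < u then v l else 0) : ℕ) : ℝ≥0∞) := by
        exact_mod_cast hn'
    _ = ∑ l ∈ Finset.range n, (if ∑ j ∈ Finset.range l, v j < u then (v l : ℝ≥0∞) else 0) := by
        push_cast; rfl
    _ ≤ _ := ENNReal.sum_le_tsum _

lemma unbounded_of_renewalCount {v : ℕ → ℕ} (h : ∀ u, renewalCount u v ≠ ⊤) : Unbounded v := by
  intro u
  by_contra! hcon
  exact h u (by simp [renewalCount, hcon])

lemma measurable_natCast_apply (l : ℕ) : Measurable fun v : ℕ → ℕ => (v l : ℝ≥0∞) :=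
  (Measurable.of_discrete (f := fun n : ℕ => (n : ℝ≥0∞))).comp (measurable_pi_apply l)

/-- An event that depends on the entries before `l` only is independent of the entry `l`. -/
lemma lintegral_indicator_past {α : Type*} [MeasurableSpace α] (μ : Measure α)
    [IsProbabilityMeasure μ] {f : α → ℝ≥0∞} (hf : Measurable f) {B : Set (ℕ → α)}
    (hB : MeasurableSet B) {l : ℕ}
    (hpast : ∀ v v' : ℕ → α, (∀ k < l, v k = v' k) → (v ∈ B ↔ v' ∈ B)) :
    ∫⁻ v, B.indicator (fun v => f (v l)) v ∂(Measure.infinitePi fun _ : ℕ => μ) =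
      (∫⁻ n, f n ∂μ) * Measure.infinitePi (fun _ : ℕ => μ) B := by
  have hm : Measurable (B.indicator fun v : ℕ → α => f (v l)) :=
    (hf.comp (measurable_pi_apply l)).indicator hB
  rw [← (measurePreserving_spliceSeq μ l).lintegral_comp hm]
  have : ∀ q : (ℕ → α) × (ℕ → α), B.indicator (fun v => f (v l)) (spliceSeq l q.1 q.2) =
      B.indicator 1 q.1 * f (q.2 0) := by
    intro q
    have h1 : spliceSeq l q.1 q.2 ∈ B ↔ q.1 ∈ B :=
      hpast _ _ fun k hk => spliceSeq_of_lt hk _ _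
    have h2 : spliceSeq l q.1 q.2 l = q.2 0 := by simpa using spliceSeq_add l 0 q.1 q.2
    by_cases hq : q.1 ∈ B
    · simp [Set.indicator, h1, hq, h2]
    · simp [Set.indicator, h1, hq]
  simp only [this]
  rw [lintegral_prod_mul (f := B.indicator 1) (g := fun v : ℕ → α => f (v 0))
    (measurable_one.indicator hB).aemeasurable (hf.comp (measurable_pi_apply 0)).aemeasurable,
    lintegral_indicator_one hB, mul_comm]
  congr 1
  exact (measurePreserving_eval_infinitePi (fun _ : ℕ => μ) 0).lintegral_comp hf

variable (μ : Measure ℕ) [IsProbabilityMeasure μ]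

lemma measurableSet_sum_lt (l u : ℕ) :
    MeasurableSet {v : ℕ → ℕ | ∑ j ∈ Finset.range l, v j < u} :=
  measurableSet_lt (by fun_prop) measurable_const

/-- **Wald's identity** for the number of renewals before `u`. -/
lemma lintegral_renewalEnd (u : ℕ) :
    ∫⁻ v, renewalEnd u v ∂(Measure.infinitePi fun _ : ℕ => μ) =
      (∫⁻ n, (n : ℝ≥0∞) ∂μ) *
        ∫⁻ v, renewalCount u v ∂(Measure.infinitePi fun _ : ℕ => μ) := by
  have h1 : ∀ v, renewalEnd u v = ∑' l, {v : ℕ → ℕ | ∑ j ∈ Finset.range l, v j < u}.indicator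
      (fun v => (v l : ℝ≥0∞)) v := fun v => by
    simp [renewalEnd, Set.indicator]
  have h2 : ∀ v, renewalCount u v = ∑' l, {v : ℕ → ℕ | ∑ j ∈ Finset.range l, v j < u}.indicator
      1 v := fun v => by simp [renewalCount, Set.indicator]
  simp only [h1, h2]
  rw [lintegral_tsum, lintegral_tsum, ← ENNReal.tsum_mul_left]
  · refine tsum_congr fun l => ?_
    rw [lintegral_indicator_past μ (f := fun n : ℕ => (n : ℝ≥0∞)) Measurable.of_discrete
        (measurableSet_sum_lt l u),
      lintegral_indicator_one (measurableSet_sum_lt l u)]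
    intro v v' h
    simp only [Set.mem_ofPred_eq]
    rw [Finset.sum_congr rfl fun k hk => h k (Finset.mem_range.1 hk)]
  · exact fun l => (measurable_one.indicator (measurableSet_sum_lt l u)).aemeasurable
  · exact fun l => ((measurable_natCast_apply l).indicator
      (measurableSet_sum_lt l u)).aemeasurable

variable {μ}

lemma ae_forall_le {K : ℕ} (hK : ∀ᵐ n ∂μ, n ≤ K) :
    ∀ᵐ v ∂(Measure.infinitePi fun _ : ℕ => μ), ∀ l, v l ≤ K := by
  rw [ae_all_iff]
  exact fun l => (measurePreserving_eval_infinitePi (fun _ : ℕ => μ) l).quasiMeasurePreserving.ae hK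

lemma mean_mul_lintegral_renewalCount_le {K : ℕ} (hK : ∀ᵐ n ∂μ, n ≤ K) (u : ℕ) :
    (∫⁻ n, (n : ℝ≥0∞) ∂μ) * ∫⁻ v, renewalCount u v ∂(Measure.infinitePi fun _ : ℕ => μ) ≤
      u + K := by
  rw [← lintegral_renewalEnd]
  calc _ ≤ ∫⁻ _, (u + K : ℝ≥0∞) ∂(Measure.infinitePi fun _ : ℕ => μ) := by
        refine lintegral_mono_ae ?_
        filter_upwards [ae_forall_le hK] with v hv using renewalEnd_le hv
    _ = u + K := by simp

lemma measurable_renewalCount (u : ℕ) : Measurable (renewalCount u) := by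
  refine Measurable.tsum fun l => ?_
  exact Measurable.ite (measurableSet_sum_lt l u) measurable_const measurable_const

lemma ae_unbounded {K : ℕ} (hK : ∀ᵐ n ∂μ, n ≤ K) (h0 : ∫⁻ n, (n : ℝ≥0∞) ∂μ ≠ 0) :
    ∀ᵐ v ∂(Measure.infinitePi fun _ : ℕ => μ), Unbounded v := by
  have h : ∀ᵐ v ∂(Measure.infinitePi fun _ : ℕ => μ), ∀ u, renewalCount u v < ⊤ := by
    rw [ae_all_iff]
    refine fun u => ae_lt_top (measurable_renewalCount u) fun hcon => ?_
    have := mean_mul_lintegral_renewalCount_le hK u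
    rw [hcon, ENNReal.mul_top h0, top_le_iff] at this
    exact ENNReal.add_ne_top.2 ⟨ENNReal.natCast_ne_top _, ENNReal.natCast_ne_top _⟩ this
  filter_upwards [h] with v hv using unbounded_of_renewalCount fun u => (hv u).ne

lemma le_mean_mul_lintegral_renewalCount {K : ℕ} (hK : ∀ᵐ n ∂μ, n ≤ K)
    (h0 : ∫⁻ n, (n : ℝ≥0∞) ∂μ ≠ 0) (u : ℕ) :
    (u : ℝ≥0∞) ≤
      (∫⁻ n, (n : ℝ≥0∞) ∂μ) * ∫⁻ v, renewalCount u v ∂(Measure.infinitePi fun _ : ℕ => μ) := by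
  rw [← lintegral_renewalEnd]
  calc (u : ℝ≥0∞) = ∫⁻ _, (u : ℝ≥0∞) ∂(Measure.infinitePi fun _ : ℕ => μ) := by simp
    _ ≤ _ := by
        refine lintegral_mono_ae ?_
        filter_upwards [ae_unbounded hK h0] with v hv using le_renewalEnd hv

end Wald

/-! ### The chain as a recursion driven by the sample -/

section Recursion

variable {N : ℕ} {net : Network N}

/-- The number of the jobs that `serve n u v` serves. -/
def served : (n : ℕ) → (u : ℤ) → (v : ℕ → ℕ) → ℕ
  | 0, _, _ => 0
  | n + 1, u, v => if u ≤ 0 then 0 else served n (u - v 0) (fun l => v (l + 1)) + 1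

lemma serve_eq (n : ℕ) (u : ℤ) (v : ℕ → ℕ) :
    serve n u v = u - ((∑ l ∈ Finset.range (served n u v), v l : ℕ) : ℤ) := by
  induction n generalizing u v with
  | zero => simp [serve, served]
  | succ n ih =>
    unfold serve served
    split_ifs with h
    · simp
    · rw [ih, Finset.sum_range_succ']
      push_cast
      ring

lemma served_congr {n : ℕ} {u : ℤ} {v v' : ℕ → ℕ} (h : ∀ l < served n u v, v l = v' l) :
    served n u v' = served n u v := by
  induction n generalizing u v v' with
  | zero => rfl
  | succ n ih =>
    unfold served at h ⊢
    split_ifs at h ⊢ with hu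
    · rfl
    · rw [h 0 (Nat.succ_pos _)] at h ⊢
      rw [ih fun l hl => h (l + 1) (by omega)]

lemma serve_congr {n : ℕ} {u : ℤ} {v v' : ℕ → ℕ} (h : ∀ l < served n u v, v l = v' l) :
    serve n u v' = serve n u v := by
  rw [serve_eq, serve_eq, served_congr h,
    Finset.sum_congr rfl fun l hl => h l (Finset.mem_range.1 hl)]

/-- The vector of the head-of-line waiting times in a state of the chain. -/
def ChainState.waits (x : ChainState net) : Fin N → ℕ := fun i => (x.age i).toNat

/-- Schedule, remaining switching slots and memory after the decision in state `x`. -/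
def decision (d : Rule net) (x : ChainState net) : net.Sched × ℕ × (Fin N → ℕ) :=
  decide' net x.waits x.sched x.rem x.mem (d x.waits x.sched x.rem x.mem)

/-- The inter-arrival times behind the first `D i + 1` ones of each queue `i`, and the services from
slot `t` on. -/
def shift (D : Fin N → ℕ) (t : ℕ) (ω : Sample N) : Sample N :=
  (fun i l => ω.1 i (D i + 1 + l), fun τ => ω.2 (t + τ))

/-- The state of the chain and the numbers of completed jobs in slot `t`, computed from the sample
by the one-slot map of the chain. -/
def path (d : Rule net) (I₀ : net.Sched) (ω : Sample N) : ℕ → ChainState net × (Fin N → ℕ)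
  | 0 => (⟨fun i => -(ω.1 i 0 : ℤ), I₀, 0, 0⟩, 0)
  | t + 1 =>
    let z := path d I₀ ω t
    let ω' := shift z.2 t ω
    (chainStep d z.1 ω'.1 (ω'.2 0), fun i => z.2 i +
      served (offered (decision d z.1).1 (decision d z.1).2.1 (ω'.2 0) i) (z.1.age i) (ω'.1 i))

lemma path_done_mono (d : Rule net) (I₀ : net.Sched) (ω : Sample N) (i : Fin N) :
    Monotone fun t => (path d I₀ ω t).2 i :=
  monotone_nat_of_le_succ fun _ => Nat.le_add_right _ _

lemma chainStep_age (d : Rule net) (x : ChainState net) (v : Fin N → ℕ → ℕ) (s : Fin N → ℕ)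
    (i : Fin N) : (chainStep d x v s).age i =
      serve (offered (decision d x).1 (decision d x).2.1 s i) (x.age i) (v i) + 1 := rfl

lemma chainStep_congr {d : Rule net} {x : ChainState net} {v v' : Fin N → ℕ → ℕ} {s : Fin N → ℕ}
    (h : ∀ i, ∀ l < served (offered (decision d x).1 (decision d x).2.1 s i) (x.age i) (v i),
      v i l = v' i l) : chainStep d x v' s = chainStep d x v s := by
  ext i
  · simp only [chainStep_age]
    rw [serve_congr (h i)]
  all_goals rfl

/-- The path up to slot `t` depends on the inter-arrival times only up to the one of the first
uncompleted job, and on the services before slot `t`. -/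
lemma path_congr (d : Rule net) (I₀ : net.Sched) {ω ω' : Sample N} {t : ℕ}
    (hV : ∀ i, ∀ l ≤ (path d I₀ ω t).2 i, ω.1 i l = ω'.1 i l) (hS : ∀ τ < t, ω.2 τ = ω'.2 τ) :
    ∀ k ≤ t, path d I₀ ω' k = path d I₀ ω k := by
  induction t with
  | zero =>
    intro k hk
    obtain rfl : k = 0 := by omega
    have : ∀ i, ω.1 i 0 = ω'.1 i 0 := fun i => hV i 0 (Nat.zero_le _)
    simp [path, this]
  | succ t ih =>
    have ih' := ih (fun i l hl => hV i l (hl.trans (path_done_mono d I₀ ω i (Nat.le_succ t))))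
      fun τ hτ => hS τ (by omega)
    intro k hk
    rcases Nat.lt_or_ge k (t + 1) with hk' | hk'
    · exact ih' k (by omega)
    obtain rfl : k = t + 1 := by omega
    have hz := ih' t le_rfl
    have hs : ω'.2 (t + 0) = ω.2 (t + 0) := (hS t (Nat.lt_succ_self t)).symm
    have hv : ∀ i, ∀ l < served (offered (decision d (path d I₀ ω t).1).1
        (decision d (path d I₀ ω t).1).2.1 (ω.2 (t + 0)) i) ((path d I₀ ω t).1.age i)
        ((shift (path d I₀ ω t).2 t ω).1 i),
        (shift (path d I₀ ω t).2 t ω).1 i l = (shift (path d I₀ ω t).2 t ω').1 i l := by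
      intro i l hl
      refine hV i _ ?_
      change _ ≤ (path d I₀ ω t).2 i + served _ _ _
      change l < served (offered _ _ ((shift (path d I₀ ω t).2 t ω).2 0) i) _ _ at hl
      omega
    rw [path, path]
    simp only [hz]
    refine Prod.ext ?_ ?_
    · simp only [shift] at hv ⊢
      rw [hs]
      exact chainStep_congr hv
    · funext i
      simp only [shift] at hv ⊢
      rw [hs, served_congr (hv i)]

lemma arrivalSlot_succ (ω : Sample N) (i : Fin N) (n : ℕ) :
    arrivalSlot ω i (n + 1) = arrivalSlot ω i n + ω.1 i (n + 1) := by
  simp [arrivalSlot, Finset.sum_range_succ _ (n + 1)]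

lemma arrivalSlot_add (ω : Sample N) (i : Fin N) (n k : ℕ) : arrivalSlot ω i (n + k) =
    arrivalSlot ω i n + ∑ l ∈ Finset.range k, ω.1 i (n + 1 + l) := by
  rw [arrivalSlot, arrivalSlot, ← Finset.sum_range_add_sum_Ico _ (show n + 1 ≤ n + k + 1 by omega),
    Finset.sum_Ico_eq_sum_range, show n + k + 1 - (n + 1) = k by omega]

lemma arrivalSlot_mono (ω : Sample N) (i : Fin N) : Monotone (arrivalSlot ω i) :=
  monotone_nat_of_le_succ fun n => by rw [arrivalSlot_succ]; omega

lemma path_age (d : Rule net) (I₀ : net.Sched) (ω : Sample N) (t : ℕ) (i : Fin N) :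
    (path d I₀ ω t).1.age i = t - arrivalSlot ω i ((path d I₀ ω t).2 i) := by
  induction t with
  | zero => simp [path, arrivalSlot]
  | succ t ih =>
    rw [path]
    simp only [chainStep_age, serve_eq, shift]
    rw [ih]
    generalize served _ _ _ = k
    rw [arrivalSlot_add]
    push_cast
    ring

/-- The queue of `i` holds the jobs that arrived before slot `t` and are not completed. -/
lemma queue_add_done (η : Policy net) (ω : Sample N) (t : ℕ) (i : Fin N) :
    (run η ω t).queue i + (run η ω t).done i = ∑ τ ∈ Finset.range t, arrivals ω τ i := by
  induction t with
  | zero => rfl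
  | succ t ih =>
    rw [Finset.sum_range_succ, ← ih, run]
    simp only
    generalize offered _ _ _ i = o
    omega

/-- On samples with unbounded arrival slots, job `n` is among the arrivals before slot `t` exactly
if its arrival slot is less than `t`. -/
lemma arrivalSlot_lt_iff {ω : Sample N} {i : Fin N} (h : Unbounded (ω.1 i)) (t n : ℕ) :
    arrivalSlot ω i n < t ↔ n < ∑ τ ∈ Finset.range t, arrivals ω τ i := by
  have hex : ∀ t, ∃ n, t ≤ arrivalSlot ω i n := fun t => by
    obtain ⟨n, hn⟩ := h t
    exact ⟨n, hn.trans (by rw [arrivalSlot, Finset.sum_range_succ]; omega)⟩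
  have hfind : ∀ t n, arrivalSlot ω i n < t ↔ n < Nat.find (hex t) := by
    intro t n
    refine ⟨fun hn => ?_, fun hn => not_le.1 (Nat.find_min (hex t) hn)⟩
    by_contra! hcon
    exact absurd ((Nat.find_spec (hex t)).trans (arrivalSlot_mono ω i hcon)) (not_le.2 hn)
  suffices hsum : ∀ t, ∑ τ ∈ Finset.range t, arrivals ω τ i = Nat.find (hex t) by
    rw [hsum, hfind]
  intro t
  induction t with
  | zero => rw [Finset.range_zero, Finset.sum_empty, eq_comm, Nat.find_eq_zero]; exact Nat.zero_le _
  | succ t ih =>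
    have hle : Nat.find (hex t) ≤ Nat.find (hex (t + 1)) :=
      Nat.find_min' (hex t) ((Nat.le_succ t).trans (Nat.find_spec (hex (t + 1))))
    have hset : {n | arrivalSlot ω i n = t} =
        (Finset.Ico (Nat.find (hex t)) (Nat.find (hex (t + 1))) : Set ℕ) := by
      ext n
      have h1 := hfind t n
      have h2 := hfind (t + 1) n
      simp only [Set.mem_ofPred_eq, Finset.coe_Ico, Set.mem_Ico]
      omega
    rw [Finset.sum_range_succ, ih, arrivals, hset, Set.ncard_coe_finset, Nat.card_Ico]
    omega

/-- On samples with unbounded arrival slots, the chain serves all waiting jobs of a queue, or as many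
as the offered service allows. -/
lemma served_eq {ω : Sample N} {i : Fin N} (h : Unbounded (ω.1 i)) (t n D : ℕ) :
    served n (t - arrivalSlot ω i D) (fun l => ω.1 i (D + 1 + l)) =
      min (∑ τ ∈ Finset.range t, arrivals ω τ i - D) n := by
  induction n generalizing D with
  | zero => simp [served]
  | succ n ih =>
    have hlt := arrivalSlot_lt_iff h t D
    unfold served
    split_ifs with hu
    · have : ¬ arrivalSlot ω i D < t := by omega
      rw [hlt] at this
      omega
    · have h1 : D < ∑ τ ∈ Finset.range t, arrivals ω τ i := by rw [← hlt]; omega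
      have h2 := ih (D + 1)
      have h3 : ((t : ℤ) - arrivalSlot ω i D - (ω.1 i (D + 1 + 0) : ℕ)) =
          t - arrivalSlot ω i (D + 1) := by
        rw [arrivalSlot_succ]; push_cast; ring
      have h4 : (fun l => ω.1 i (D + 1 + (l + 1))) = fun l => ω.1 i (D + 1 + 1 + l) := by
        funext l; exact congrArg _ (by omega)
      rw [h3, h4, h2]
      omega

/-- Samples on which the arrival slots of all queues are unbounded. -/
def Regular (ω : Sample N) : Prop := ∀ i, Unbounded (ω.1 i)

/-- On regular samples, the system under the policy of a stationary rule follows the recursion. -/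
lemma run_eq_path (d : Rule net) (I₀ : net.Sched) {ω : Sample N} (hω : Regular ω) (t : ℕ) :
    (run (d.toPolicy I₀) ω t).done = (path d I₀ ω t).2 ∧
    (run (d.toPolicy I₀) ω t).sched = (path d I₀ ω t).1.sched ∧
    (run (d.toPolicy I₀) ω t).rem = (path d I₀ ω t).1.rem ∧
    (run (d.toPolicy I₀) ω t).mem = (path d I₀ ω t).1.mem := by
  induction t with
  | zero => exact ⟨rfl, rfl, rfl, rfl⟩
  | succ t ih =>
    obtain ⟨hd, hs, hr, hm⟩ := ih
    have hq : ∀ i, (run (d.toPolicy I₀) ω t).queue i =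
        ∑ τ ∈ Finset.range t, arrivals ω τ i - (path d I₀ ω t).2 i := fun i => by
      have := queue_add_done (d.toPolicy I₀) ω t i
      rw [hd] at this
      omega
    have hw : (run (d.toPolicy I₀) ω t).wait ω t = (path d I₀ ω t).1.waits := by
      funext i
      have h1 := arrivalSlot_lt_iff (hω i) t ((path d I₀ ω t).2 i)
      have h2 := path_age d I₀ ω t i
      have h3 := hq i
      simp only [SysState.wait, ChainState.waits, h2, hd]
      split_ifs with h0
      · have : ¬ arrivalSlot ω i ((path d I₀ ω t).2 i) < t := by rw [h1]; omega
        omega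
      · omega
    have hc : decide' net ((run (d.toPolicy I₀) ω t).wait ω t) (run (d.toPolicy I₀) ω t).sched
        (run (d.toPolicy I₀) ω t).rem (run (d.toPolicy I₀) ω t).mem
        (d ((run (d.toPolicy I₀) ω t).wait ω t) (run (d.toPolicy I₀) ω t).sched
        (run (d.toPolicy I₀) ω t).rem (run (d.toPolicy I₀) ω t).mem) =
        decision d (path d I₀ ω t).1 := by
      rw [hw, hs, hr, hm]; rfl
    refine ⟨?_, ?_, ?_, ?_⟩
    · funext i
      have h1 : (run (d.toPolicy I₀) ω (t + 1)).done i = (run (d.toPolicy I₀) ω t).done i +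
          min ((run (d.toPolicy I₀) ω t).queue i) (offered (decision d (path d I₀ ω t).1).1
            (decision d (path d I₀ ω t).1).2.1 (ω.2 t) i) := by
        rw [← hc]; rfl
      rw [h1, path]
      simp only [shift, path_age]
      rw [served_eq (hω i), hq, hd, add_zero]
    · change (decide' net _ _ _ _ _).1 = _
      exact congrArg (fun c => c.1) hc
    · change (decide' net _ _ _ _ _).2.1 - 1 = _
      exact congrArg (fun c => c.2.1 - 1) hc
    · change (decide' net _ _ _ _ _).2.2 = _
      exact congrArg (fun c => c.2.2) hc

lemma chain_eq_path (d : Rule net) (I₀ : net.Sched) {ω : Sample N} (hω : Regular ω) (t : ℕ) :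
    chain (d.toPolicy I₀) t ω = (path d I₀ ω t).1 := by
  obtain ⟨hd, hs, hr, hm⟩ := run_eq_path d I₀ hω t
  ext i
  · simp only [chain, hd, path_age]
  all_goals simp [chain, hs, hr, hm]

/-- The queue length is a renewal count over the waiting time, in terms of the inter-arrival times
that the chain has not used yet. -/
lemma queue_eq_renewalCount (d : Rule net) (I₀ : net.Sched) {ω : Sample N} (hω : Regular ω) (t : ℕ)
    (i : Fin N) : ((run (d.toPolicy I₀) ω t).queue i : ℝ≥0∞) =
      renewalCount ((path d I₀ ω t).1.waits i) ((shift (path d I₀ ω t).2 t ω).1 i) := by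
  obtain ⟨hd, -⟩ := run_eq_path d I₀ hω t
  have hq := queue_add_done (d.toPolicy I₀) ω t i
  rw [hd] at hq
  set D := (path d I₀ ω t).2 i with hD
  set q := (run (d.toPolicy I₀) ω t).queue i
  have hiff : ∀ l, ∑ j ∈ Finset.range l, (shift (path d I₀ ω t).2 t ω).1 i j <
      (path d I₀ ω t).1.waits i ↔ l < q := by
    intro l
    have h1 := arrivalSlot_lt_iff (hω i) t (D + l)
    rw [arrivalSlot_add, ← hq] at h1
    simp only [ChainState.waits, path_age, shift, ← hD]
    omega
  unfold renewalCount
  simp only [hiff]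
  rw [tsum_eq_sum (s := Finset.range q) (by simp)]
  rw [Finset.sum_congr rfl fun l hl => if_pos (Finset.mem_range.1 hl)]
  simp

end Recursion

/-! ### The Markov property -/

section Markov

variable {N : ℕ} {net : Network N}

/-- A state of the chain as a tuple. -/
def ChainState.equivProd (net : Network N) :
    ChainState net ≃ (Fin N → ℤ) × net.Sched × ℕ × (Fin N → ℕ) where
  toFun x := (x.age, x.sched, x.rem, x.mem)
  invFun q := ⟨q.1, q.2.1, q.2.2.1, q.2.2.2⟩
  left_inv _ := rfl
  right_inv _ := rfl

instance : Countable (ChainState net) := (ChainState.equivProd net).injective.countable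

instance : MeasurableSpace (ChainState net) := ⊤

instance : DiscreteMeasurableSpace (ChainState net) := ⟨fun _ => trivial⟩

lemma measurable_serve (n : ℕ) : Measurable fun q : ℤ × (ℕ → ℕ) => serve n q.1 q.2 := by
  induction n with
  | zero => exact measurable_fst
  | succ n ih =>
    simp only [serve]
    refine Measurable.ite (measurableSet_le measurable_fst measurable_const) measurable_fst ?_
    have h0 : Measurable fun q : ℤ × (ℕ → ℕ) => (q.2 0 : ℤ) :=
      (Measurable.of_discrete (f := fun n : ℕ => (n : ℤ))).comp
        ((measurable_pi_apply 0).comp measurable_snd)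
    exact ih.comp ((measurable_fst.sub h0).prodMk
      (measurable_pi_lambda _ fun l => (measurable_pi_apply (l + 1)).comp measurable_snd))

lemma measurable_served (n : ℕ) : Measurable fun q : ℤ × (ℕ → ℕ) => served n q.1 q.2 := by
  induction n with
  | zero => exact measurable_const
  | succ n ih =>
    simp only [served]
    refine Measurable.ite (measurableSet_le measurable_fst measurable_const) measurable_const ?_
    have h0 : Measurable fun q : ℤ × (ℕ → ℕ) => (q.2 0 : ℤ) :=
      (Measurable.of_discrete (f := fun n : ℕ => (n : ℤ))).comp
        ((measurable_pi_apply 0).comp measurable_snd)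
    exact (ih.comp ((measurable_fst.sub h0).prodMk
      (measurable_pi_lambda _ fun l => (measurable_pi_apply (l + 1)).comp measurable_snd))).add
        measurable_const

lemma measurable_offered (I : net.Sched) (r : ℕ) (i : Fin N) :
    Measurable fun s : Fin N → ℕ => offered I r s i := by
  unfold offered
  by_cases h : r = 0 ∧ i ∈ I.1
  · simp only [h, and_self, if_true]; exact measurable_pi_apply i
  · simp only [h, if_false]; exact measurable_const

lemma measurable_chainStep (d : Rule net) (x : ChainState net) :
    Measurable fun ω : Sample N => chainStep d x ω.1 (ω.2 0) := by
  have h : Measurable fun ω : Sample N => fun i => serve (offered (decision d x).1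
      (decision d x).2.1 (ω.2 0) i) (x.age i) (ω.1 i) + 1 := by
    refine measurable_pi_lambda _ fun i => Measurable.add_const ?_ _
    have h1 : Measurable fun q : ℕ × (ℕ → ℕ) => serve q.1 (x.age i) q.2 :=
      measurable_from_prod_countable_right fun n =>
        (measurable_serve n).comp (measurable_const.prodMk measurable_id)
    exact h1.comp (((measurable_offered _ _ i).comp
      ((measurable_pi_apply 0).comp measurable_snd)).prodMk ((measurable_pi_apply i).comp measurable_fst))
  exact (Measurable.of_discrete (f := fun a : Fin N → ℤ => (⟨a, (decision d x).1,
    (decision d x).2.1 - 1, (decision d x).2.2⟩ : ChainState net))).comp h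

lemma measurable_shift (D : Fin N → ℕ) (t : ℕ) : Measurable (shift (N := N) D t) := by
  refine Measurable.prodMk ?_ ?_
  · exact measurable_pi_lambda _ fun i => measurable_pi_lambda _ fun l =>
      (measurable_pi_apply (D i + 1 + l)).comp ((measurable_pi_apply i).comp measurable_fst)
  · exact measurable_pi_lambda _ fun τ => (measurable_pi_apply (t + τ)).comp measurable_snd

lemma measurable_path (d : Rule net) (I₀ : net.Sched) (t : ℕ) :
    Measurable fun ω : Sample N => path d I₀ ω t := by
  induction t with
  | zero =>
    refine Measurable.prodMk ?_ measurable_const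
    have h : Measurable fun ω : Sample N => fun i => -(ω.1 i 0 : ℤ) :=
      measurable_pi_lambda _ fun i => (Measurable.of_discrete (f := fun n : ℕ => -(n : ℤ))).comp
        ((measurable_pi_apply 0).comp ((measurable_pi_apply i).comp measurable_fst))
    exact (Measurable.of_discrete (f := fun a : Fin N → ℤ =>
      (⟨a, I₀, 0, 0⟩ : ChainState net))).comp h
  | succ t ih =>
    have h : Measurable fun q : (ChainState net × (Fin N → ℕ)) × Sample N =>
        ((chainStep d q.1.1 (shift q.1.2 t q.2).1 ((shift q.1.2 t q.2).2 0), fun i => q.1.2 i +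
          served (offered (decision d q.1.1).1 (decision d q.1.1).2.1 ((shift q.1.2 t q.2).2 0) i)
            (q.1.1.age i) ((shift q.1.2 t q.2).1 i)) : ChainState net × (Fin N → ℕ)) := by
      refine measurable_from_prod_countable_right fun z => Measurable.prodMk ?_ ?_
      · exact (measurable_chainStep d z.1).comp (measurable_shift z.2 t)
      · refine measurable_pi_lambda _ fun i => ?_
        have h1 : Measurable fun q : ℕ × (ℕ → ℕ) => served q.1 (z.1.age i) q.2 :=
          measurable_from_prod_countable_right fun n =>
            (measurable_served n).comp (measurable_const.prodMk measurable_id)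
        have h2 : Measurable fun ω : Sample N => (offered (decision d z.1).1 (decision d z.1).2.1
            (ω.2 0) i, ω.1 i) :=
          ((measurable_offered _ _ i).comp ((measurable_pi_apply 0).comp measurable_snd)).prodMk
            ((measurable_pi_apply i).comp measurable_fst)
        exact (h1.comp (h2.comp (measurable_shift z.2 t))).const_add (z.2 i)
    exact h.comp (ih.prodMk measurable_id)

/-- The part of the sample that the chain has not used before slot `t`. -/
def future (d : Rule net) (I₀ : net.Sched) (t : ℕ) (ω : Sample N) : Sample N :=
  shift (path d I₀ ω t).2 t ω

lemma measurable_future (d : Rule net) (I₀ : net.Sched) (t : ℕ) :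
    Measurable (future d I₀ t) := by
  have h : Measurable fun q : (Fin N → ℕ) × Sample N => shift q.1 t q.2 :=
    measurable_from_prod_countable_right fun D => measurable_shift D t
  exact h.comp (((measurable_snd).comp (measurable_path d I₀ t)).prodMk measurable_id)

variable (svc : ServiceLaw N) (arr : ArrivalLaw N)

/-- **Strong Markov property.** The unused part of the sample is independent of the path of the
chain up to slot `t`, and it has the law of a fresh sample. -/
theorem map_future_restrict (d : Rule net) (I₀ : net.Sched) (t : ℕ) {E : Set (Sample N)}
    (hE : MeasurableSet E)
    (hpast : ∀ ω ω', (∀ k ≤ t, path d I₀ ω' k = path d I₀ ω k) → ω ∈ E → ω' ∈ E) :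
    ((prob svc arr).restrict E).map (future d I₀ t) = prob svc arr E • prob svc arr := by
  ext A hA
  have hfut := measurable_future d I₀ t
  rw [Measure.map_apply hfut hA, Measure.restrict_apply (hfut hA), Measure.smul_apply, smul_eq_mul]
  let F : (Fin N → ℕ) → Set (Sample N) := fun D => {ω | (path d I₀ ω t).2 = D}
  have hF : ∀ D, MeasurableSet (F D) := fun D =>
    (measurable_snd.comp (measurable_path d I₀ t)) (measurableSet_singleton D)
  have hdisj : Pairwise (Function.onFun Disjoint F) := fun D D' hne =>
    Set.disjoint_left.2 fun ω h h' => hne (h.symm.trans h')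
  have hunion : ⋃ D, F D = Set.univ := Set.eq_univ_of_forall fun ω => Set.mem_iUnion.2 ⟨_, rfl⟩
  have hsum : ∀ B, MeasurableSet B → prob svc arr B = ∑' D, prob svc arr (F D ∩ B) := by
    intro B hB
    rw [← measure_iUnion (fun D D' h => (hdisj h).mono Set.inter_subset_left Set.inter_subset_left)
      fun D => (hF D).inter hB, ← Set.iUnion_inter, hunion, Set.univ_inter]
  rw [hsum _ ((hfut hA).inter hE), hsum E hE, ← ENNReal.tsum_mul_right]
  refine tsum_congr fun D => ?_
  -- On `F D`, the past uses exactly the first `D i + 1` inter-arrival times of queue `i`.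
  have hmp := measurePreserving_splice svc arr (fun i => D i + 1) t
  rw [← hmp.measure_preimage ((hF D).inter ((hfut hA).inter hE)).nullMeasurableSet,
    ← Measure.prod_prod]
  congr 1
  ext ⟨ω, ω'⟩
  set ω₁ := splice (fun i => D i + 1) t ω ω' with hω₁
  have hV : ∀ i, ∀ l ≤ D i, ω₁.1 i l = ω.1 i l := fun i l hl =>
    spliceSeq_of_lt (Nat.lt_succ_of_le hl) _ _
  have hS : ∀ τ < t, ω₁.2 τ = ω.2 τ := fun τ hτ => spliceSeq_of_lt hτ _ _
  have hpath : (path d I₀ ω t).2 = D ∨ (path d I₀ ω₁ t).2 = D →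
      ∀ k ≤ t, path d I₀ ω₁ k = path d I₀ ω k := by
    rintro (h | h)
    · exact path_congr d I₀ (fun i l hl => (hV i l (by rwa [h] at hl)).symm)
        fun τ hτ => (hS τ hτ).symm
    · exact fun k hk => (path_congr d I₀ (fun i l hl => hV i l (by rwa [h] at hl)) hS k hk).symm
  have hfutω : (path d I₀ ω₁ t).2 = D → future d I₀ t ω₁ = ω' := by
    intro h
    rw [future, h]
    refine Prod.ext ?_ ?_
    · funext i l
      exact spliceSeq_add (D i + 1) l _ _
    · funext τ
      exact spliceSeq_add t τ _ _
  change (path d I₀ ω₁ t).2 = D ∧ future d I₀ t ω₁ ∈ A ∧ ω₁ ∈ E ↔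
    ((path d I₀ ω t).2 = D ∧ ω ∈ E) ∧ ω' ∈ A
  constructor
  · rintro ⟨h1, h2, h3⟩
    have hp := hpath (Or.inr h1)
    rw [hfutω h1] at h2
    exact ⟨⟨by rw [← hp t le_rfl, h1], hpast ω₁ ω (fun k hk => (hp k hk).symm) h3⟩, h2⟩
  · rintro ⟨⟨h1, h2⟩, h3⟩
    have hp := hpath (Or.inl h1)
    have h1' : (path d I₀ ω₁ t).2 = D := by rw [hp t le_rfl, h1]
    exact ⟨h1', by rwa [hfutω h1'], hpast ω ω₁ hp h2⟩

lemma lintegral_future (d : Rule net) (I₀ : net.Sched) (t : ℕ) {E : Set (Sample N)}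
    (hE : MeasurableSet E)
    (hpast : ∀ ω ω', (∀ k ≤ t, path d I₀ ω' k = path d I₀ ω k) → ω ∈ E → ω' ∈ E)
    {f : Sample N → ℝ≥0∞} (hf : Measurable f) :
    ∫⁻ ω in E, f (future d I₀ t ω) ∂(prob svc arr) =
      prob svc arr E * ∫⁻ ω, f ω ∂(prob svc arr) := by
  rw [← lintegral_map hf (measurable_future d I₀ t), map_future_restrict svc arr d I₀ t hE hpast,
    lintegral_smul_measure, smul_eq_mul]

lemma transition_tsum (d : Rule net) (x : ChainState net) :
    ∑' y, transition svc arr d x y = 1 := by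
  have h := measurable_chainStep d x
  have : ∀ y, transition svc arr d x y =
      (prob svc arr).map (fun ω => chainStep d x ω.1 (ω.2 0)) {y} := fun y => by
    rw [Measure.map_apply h (measurableSet_singleton y)]; rfl
  simp only [this]
  have := Measure.isProbabilityMeasure_map (μ := prob svc arr) h.aemeasurable
  rw [← measure_univ (μ := (prob svc arr).map fun ω => chainStep d x ω.1 (ω.2 0)),
    ← lintegral_one, lintegral_countable']
  simp

/-- The transition operator is the expectation over one slot. -/
lemma expStep_transition (d : Rule net) (f : ChainState net → ℝ≥0∞) (x : ChainState net) :
    expStep (transition svc arr d) f x =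
      ∫⁻ ω, f (chainStep d x ω.1 (ω.2 0)) ∂(prob svc arr) := by
  have h := measurable_chainStep d x
  rw [← lintegral_map (g := fun ω : Sample N => chainStep d x ω.1 (ω.2 0)) Measurable.of_discrete h,
    lintegral_countable', expStep]
  refine tsum_congr fun y => ?_
  rw [Measure.map_apply h (measurableSet_singleton y), mul_comm]
  rfl

lemma path_succ_fst (d : Rule net) (I₀ : net.Sched) (ω : Sample N) (t : ℕ) :
    (path d I₀ ω (t + 1)).1 =
      chainStep d (path d I₀ ω t).1 (future d I₀ t ω).1 ((future d I₀ t ω).2 0) := rfl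

/-- An event of the path up to slot `t`, followed by a transition. -/
lemma prob_inter_path_succ (d : Rule net) (I₀ : net.Sched) (t : ℕ) {E : Set (Sample N)}
    (hE : MeasurableSet E)
    (hpast : ∀ ω ω', (∀ k ≤ t, path d I₀ ω' k = path d I₀ ω k) → ω ∈ E → ω' ∈ E)
    {x : ChainState net} (hx : ∀ ω ∈ E, (path d I₀ ω t).1 = x) (y : ChainState net) :
    prob svc arr (E ∩ {ω | (path d I₀ ω (t + 1)).1 = y}) =
      prob svc arr E * transition svc arr d x y := by
  have hA : MeasurableSet {ω : Sample N | chainStep d x ω.1 (ω.2 0) = y} :=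
    measurable_chainStep d x (measurableSet_singleton y)
  have h := congrArg (fun ν => ν {ω : Sample N | chainStep d x ω.1 (ω.2 0) = y})
    (map_future_restrict svc arr d I₀ t hE hpast)
  rw [Measure.map_apply (measurable_future d I₀ t) hA,
    Measure.restrict_apply (measurable_future d I₀ t hA), Measure.smul_apply, smul_eq_mul] at h
  rw [transition, ← h]
  congr 1
  ext ω
  simp only [Set.mem_inter_iff, Set.mem_ofPred_eq, Set.mem_preimage]
  constructor
  · rintro ⟨h1, h2⟩
    rw [path_succ_fst, hx ω h1] at h2
    exact ⟨h2, h1⟩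
  · rintro ⟨h2, h1⟩
    rw [path_succ_fst, hx ω h1]
    exact ⟨h1, h2⟩

end Markov

/-! ### Properties of almost all samples -/

section AlmostSure

variable {N : ℕ} (svc : ServiceLaw N) (arr : ArrivalLaw N)

/-- The mean inter-arrival time of a queue. -/
def ArrivalLaw.mean (arr : ArrivalLaw N) (i : Fin N) : ℝ := ∫ n, (n : ℝ) ∂(arr.law i).toMeasure

lemma ArrivalLaw.ae_le (i : Fin N) : ∀ᵐ n ∂(arr.law i).toMeasure, n ≤ arr.Vmax := by
  rw [ae_iff, PMF.toMeasure_apply_eq_zero_iff _ (Set.to_countable _).measurableSet]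
  exact Set.disjoint_left.2 fun n hn hn' => hn' (arr.bounded i n hn)

lemma ServiceLaw.ae_le : ∀ᵐ s ∂svc.law.toMeasure, ∀ i, s i ≤ svc.Smax := by
  rw [ae_iff, PMF.toMeasure_apply_eq_zero_iff _ (Set.to_countable _).measurableSet]
  exact Set.disjoint_left.2 fun n hn hn' => hn' (svc.bounded n hn)

lemma ArrivalLaw.integrable (i : Fin N) :
    Integrable (fun n : ℕ => (n : ℝ)) (arr.law i).toMeasure := by
  refine Integrable.of_bound (C := arr.Vmax) Measurable.of_discrete.aestronglyMeasurable ?_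
  filter_upwards [arr.ae_le i] with n hn
  simpa using hn

lemma ArrivalLaw.lintegral_eq (i : Fin N) :
    ∫⁻ n, (n : ℝ≥0∞) ∂(arr.law i).toMeasure = ENNReal.ofReal (arr.mean i) := by
  rw [mean, ofReal_integral_eq_lintegral_ofReal (arr.integrable i)
    (ae_of_all _ fun n => by positivity)]
  simp

lemma ArrivalLaw.mean_pos (i : Fin N) : 0 < arr.mean i := by
  rw [mean, integral_pos_iff_support_of_nonneg (fun n => by positivity) (arr.integrable i)]
  obtain ⟨n, hn, hn0⟩ := arr.nonzero i
  rw [pos_iff_ne_zero, Ne, PMF.toMeasure_apply_eq_zero_iff _ (Set.to_countable _).measurableSet]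
  exact fun h => Set.disjoint_left.1 h hn (by simpa using hn0)

lemma ArrivalLaw.lintegral_ne_zero (i : Fin N) :
    ∫⁻ n, (n : ℝ≥0∞) ∂(arr.law i).toMeasure ≠ 0 := by
  rw [arr.lintegral_eq]
  simpa using arr.mean_pos i

lemma ArrivalLaw.rate_eq (i : Fin N) : arr.rate i = (arr.mean i)⁻¹ := rfl

lemma measurePreserving_arrivals (i : Fin N) :
    MeasurePreserving (fun ω : Sample N => ω.1 i) (prob svc arr)
      (Measure.infinitePi fun _ : ℕ => (arr.law i).toMeasure) :=
  (measurePreserving_eval (fun i => Measure.infinitePi fun _ : ℕ => (arr.law i).toMeasure) i).comp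
    measurePreserving_fst

lemma measurePreserving_service (t : ℕ) :
    MeasurePreserving (fun ω : Sample N => ω.2 t) (prob svc arr) svc.law.toMeasure :=
  (measurePreserving_eval_infinitePi (fun _ : ℕ => svc.law.toMeasure) t).comp
    measurePreserving_snd

lemma ae_regular : ∀ᵐ ω ∂(prob svc arr), Regular ω := by
  unfold Regular
  rw [ae_all_iff]
  exact fun i => (measurePreserving_arrivals svc arr i).quasiMeasurePreserving.ae
    (ae_unbounded (arr.ae_le i) (arr.lintegral_ne_zero i))

/-- Samples that respect the bounds on the inter-arrival times and the services. -/
def Bounded (svc : ServiceLaw N) (arr : ArrivalLaw N) (ω : Sample N) : Prop :=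
  (∀ i l, ω.1 i l ≤ arr.Vmax) ∧ ∀ t i, ω.2 t i ≤ svc.Smax

lemma ae_bounded : ∀ᵐ ω ∂(prob svc arr), Bounded svc arr ω := by
  have h1 : ∀ᵐ ω ∂(prob svc arr), ∀ i l, ω.1 i l ≤ arr.Vmax := by
    rw [ae_all_iff]
    exact fun i => (measurePreserving_arrivals svc arr i).quasiMeasurePreserving.ae
      (ae_forall_le (arr.ae_le i))
  have h2 : ∀ᵐ ω ∂(prob svc arr), ∀ t i, ω.2 t i ≤ svc.Smax := by
    rw [ae_all_iff]
    exact fun t => (measurePreserving_service svc arr t).quasiMeasurePreserving.ae svc.ae_le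
  filter_upwards [h1, h2] with ω using And.intro

variable {net : Network N}

/-- A possible transition is realized by a bounded sample. -/
lemma exists_bounded_of_transition_ne_zero {d : Rule net} {x y : ChainState net}
    (h : transition svc arr d x y ≠ 0) :
    ∃ ω, Bounded svc arr ω ∧ chainStep d x ω.1 (ω.2 0) = y := by
  by_contra! hcon
  refine h (measure_mono_null (t := {ω | ¬ Bounded svc arr ω}) (fun ω hω hb => hcon ω hb hω) ?_)
  exact ae_iff.1 (ae_bounded svc arr)

theorem isMarkovChain (d : Rule net) (I₀ : net.Sched) :
    IsMarkovChain (prob svc arr) (chain (d.toPolicy I₀)) (transition svc arr d) := by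
  refine ⟨transition_tsum svc arr d, fun n x => ?_⟩
  have hchain : ∀ m, prob svc arr {ω | ∀ k ≤ m, chain (d.toPolicy I₀) k ω = x k} =
      prob svc arr {ω | ∀ k ≤ m, (path d I₀ ω k).1 = x k} := by
    intro m
    refine measure_congr ?_
    filter_upwards [ae_regular svc arr] with ω hω
    refine propext (forall₂_congr fun k _ => ?_)
    rw [chain_eq_path d I₀ hω]
  rw [hchain, hchain, ← prob_inter_path_succ svc arr d I₀ n
    (E := {ω | ∀ k ≤ n, (path d I₀ ω k).1 = x k}) (x := x n) ?_ ?_ fun ω h => h n le_rfl]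
  · congr 1
    ext ω
    simp only [Set.mem_ofPred_eq, Set.mem_inter_iff]
    refine ⟨fun h => ⟨fun k hk => h k (by omega), h _ le_rfl⟩, fun h k hk => ?_⟩
    rcases Nat.lt_or_ge k (n + 1) with hk' | hk'
    · exact h.1 k (by omega)
    · obtain rfl : k = n + 1 := by omega
      exact h.2
  · simp only [Set.ofPred_forall]
    exact MeasurableSet.iInter fun k => MeasurableSet.iInter fun _ =>
      (measurable_fst.comp (measurable_path d I₀ k)) (measurableSet_singleton (x k))
  · intro ω ω' h hω k hk
    rw [h k hk]
    exact hω k hk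

end AlmostSure

/-! ### Rates in the capacity region -/

section Capacity

variable {N : ℕ} {net : Network N}

lemma measurable_arrivalSlot (i : Fin N) (n : ℕ) :
    Measurable fun ω : Sample N => arrivalSlot ω i n := by
  unfold arrivalSlot
  exact Finset.measurable_sum _ fun l _ =>
    (measurable_pi_apply l).comp ((measurable_pi_apply i).comp measurable_fst)

lemma measurable_arrivals (t : ℕ) : Measurable fun ω : Sample N => arrivals ω t := by
  refine measurable_pi_lambda _ fun i => ?_
  have hset : ∀ n, MeasurableSet {ω : Sample N | arrivalSlot ω i n = t} := fun n =>
    measurable_arrivalSlot i n (measurableSet_singleton t)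
  have h : Measurable fun ω : Sample N =>
      ∑' n, {ω : Sample N | arrivalSlot ω i n = t}.indicator (1 : Sample N → ℝ≥0∞) ω :=
    Measurable.tsum fun n => measurable_one.indicator (hset n)
  have hcard : ∀ ω : Sample N, ((arrivals ω t i : ℕ) : ℝ) =
      (∑' n, {ω : Sample N | arrivalSlot ω i n = t}.indicator (1 : Sample N → ℝ≥0∞) ω).toReal := by
    intro ω
    have : ∑' n, {ω : Sample N | arrivalSlot ω i n = t}.indicator (1 : Sample N → ℝ≥0∞) ω =
        ({n : ℕ | arrivalSlot ω i n = t}.encard : ℝ≥0∞) := by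
      rw [← ENNReal.tsum_set_one, tsum_subtype {n : ℕ | arrivalSlot ω i n = t} fun _ => (1 : ℝ≥0∞)]
      rfl
    rw [this, arrivals, Set.ncard]
    generalize Set.encard _ = e
    cases e <;> simp
  refine measurable_to_countable' fun k => ?_
  have : (fun ω : Sample N => arrivals ω t i) ⁻¹' {k} =
      (fun ω => (∑' n, {ω : Sample N | arrivalSlot ω i n = t}.indicator
        (1 : Sample N → ℝ≥0∞) ω).toReal) ⁻¹' {(k : ℝ)} := by
    ext ω
    simp only [Set.mem_preimage, Set.mem_singleton_iff, ← hcard ω, Nat.cast_inj]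
  rw [this]
  exact h.ennreal_toReal (measurableSet_singleton _)

/-- A system state as a tuple. -/
def SysState.equivProd (net : Network N) :
    SysState net ≃ (Fin N → ℕ) × (Fin N → ℕ) × net.Sched × ℕ × (Fin N → ℕ) where
  toFun x := (x.queue, x.done, x.sched, x.rem, x.mem)
  invFun q := ⟨q.1, q.2.1, q.2.2.1, q.2.2.2.1, q.2.2.2.2⟩
  left_inv _ := rfl
  right_inv _ := rfl

instance : Countable (SysState net) := (SysState.equivProd net).injective.countable

instance : MeasurableSpace (SysState net) := ⊤

instance : DiscreteMeasurableSpace (SysState net) := ⟨fun _ => trivial⟩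

/-- One slot of the system from state `x`, given the waiting times `w`, the past arrivals and
services, and the services and the arrivals of the slot. -/
def sysStep (η : Policy net) (t : ℕ) (x : SysState net)
    (q : (Fin N → ℕ) × (Fin t → Fin N → ℕ) × (Fin t → Fin N → ℕ) × (Fin N → ℕ) × (Fin N → ℕ)) :
    SysState net :=
  let c := decide' net q.1 x.sched x.rem x.mem
    (η.act t q.2.1 q.2.2.1 ⟨x.queue, q.1, x.sched, x.rem, x.mem⟩)
  let used : Fin N → ℕ := fun i => min (x.queue i) (offered c.1 c.2.1 q.2.2.2.1 i)
  ⟨fun i => x.queue i - used i + q.2.2.2.2 i, fun i => x.done i + used i, c.1, c.2.1 - 1, c.2.2⟩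

lemma run_succ (η : Policy net) (ω : Sample N) (t : ℕ) :
    run η ω (t + 1) = sysStep η t (run η ω t) ((run η ω t).wait ω t, fun τ => arrivals ω τ,
      fun τ => ω.2 τ, ω.2 t, arrivals ω t) := rfl

lemma measurable_run (η : Policy net) (t : ℕ) : Measurable fun ω : Sample N => run η ω t := by
  induction t with
  | zero => exact measurable_const
  | succ t ih =>
    have h : Measurable fun q : SysState net × Sample N => sysStep η t q.1
        (q.1.wait q.2 t, fun τ => arrivals q.2 τ, fun τ => q.2.2 τ, q.2.2 t, arrivals q.2 t) := by
      refine measurable_from_prod_countable_right fun x => ?_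
      have hw : Measurable fun ω : Sample N => x.wait ω t := by
        refine measurable_pi_lambda _ fun i => ?_
        by_cases hx : x.queue i = 0
        · simp only [SysState.wait, hx, if_true]; exact measurable_const
        · simp only [SysState.wait, hx, if_false]
          exact (Measurable.of_discrete (f := fun n : ℕ => t - n)).comp (measurable_arrivalSlot _ _)
      have hs : ∀ τ, Measurable fun ω : Sample N => ω.2 τ := fun τ =>
        (measurable_pi_apply τ).comp measurable_snd
      exact (Measurable.of_discrete (f := sysStep η t x)).comp
        (hw.prodMk ((measurable_pi_lambda _ fun τ => measurable_arrivals _).prodMk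
          ((measurable_pi_lambda _ fun τ => hs _).prodMk ((hs t).prodMk (measurable_arrivals t)))))
    exact h.comp (ih.prodMk measurable_id)

lemma run_congr (η : Policy net) {ω ω' : Sample N} {t : ℕ} (hV : ω.1 = ω'.1)
    (hS : ∀ τ < t, ω.2 τ = ω'.2 τ) : run η ω t = run η ω' t := by
  have hA : ∀ τ, arrivals ω τ = arrivals ω' τ := fun τ => by
    funext i; simp only [arrivals, arrivalSlot, hV]
  induction t with
  | zero => rfl
  | succ t ih =>
    have ih' := ih fun τ hτ => hS τ (by omega)
    have hw : (run η ω t).wait ω t = (run η ω' t).wait ω' t := by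
      funext i; simp only [SysState.wait, arrivalSlot, hV, ih']
    rw [run_succ, run_succ, hw, ih', hS t (Nat.lt_succ_self t)]
    simp only [hA]
    congr 4
    funext τ
    exact hS τ (by omega)

/-- The decision in slot `t` does not depend on the services in that slot. -/
lemma sched_succ_congr (η : Policy net) {ω ω' : Sample N} {t : ℕ} (hV : ω.1 = ω'.1)
    (hS : ∀ τ < t, ω.2 τ = ω'.2 τ) : (run η ω (t + 1)).sched = (run η ω' (t + 1)).sched := by
  have hA : ∀ τ, arrivals ω τ = arrivals ω' τ := fun τ => by
    funext i; simp only [arrivals, arrivalSlot, hV]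
  have hr := run_congr η hV hS
  have hw : ∀ x : SysState net, x.wait ω t = x.wait ω' t := fun x => by
    funext i; simp only [SysState.wait, arrivalSlot, hV]
  have hs : (fun τ : Fin t => ω.2 τ) = fun τ : Fin t => ω'.2 τ := funext fun τ => hS τ τ.2
  simp only [run_succ, sysStep, hw, hr, hA, hs]

variable (svc : ServiceLaw N) (arr : ArrivalLaw N)

/-- The mean service of a queue in one slot. -/
def ServiceLaw.mean (svc : ServiceLaw N) (i : Fin N) : ℝ := ∫ s, (s i : ℝ) ∂svc.law.toMeasure

lemma ServiceLaw.integrable (i : Fin N) :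
    Integrable (fun s : Fin N → ℕ => (s i : ℝ)) svc.law.toMeasure := by
  refine Integrable.of_bound (C := svc.Smax) Measurable.of_discrete.aestronglyMeasurable ?_
  filter_upwards [svc.ae_le] with s hs
  simpa using hs i

lemma ServiceLaw.mean_nonneg (i : Fin N) : 0 ≤ svc.mean i :=
  integral_nonneg fun s => by positivity

lemma ServiceLaw.lintegral_eq (i : Fin N) :
    ∫⁻ s, (s i : ℝ≥0∞) ∂svc.law.toMeasure = ENNReal.ofReal (svc.mean i) := by
  rw [mean, ofReal_integral_eq_lintegral_ofReal (svc.integrable i)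
    (ae_of_all _ fun n => by positivity)]
  simp

/-- The schedule of a slot is independent of the services in that slot. -/
lemma lintegral_sched_mul_service (η : Policy net) (t : ℕ) (J : net.Sched) (i : Fin N) :
    ∫⁻ ω, {ω | (run η ω (t + 1)).sched = J}.indicator (fun ω => (ω.2 t i : ℝ≥0∞)) ω
      ∂(prob svc arr) =
      ENNReal.ofReal (svc.mean i) * prob svc arr {ω | (run η ω (t + 1)).sched = J} := by
  have hB : MeasurableSet {ω : Sample N | (run η ω (t + 1)).sched = J} :=
    ((Measurable.of_discrete (f := fun x : SysState net => x.sched)).comp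
      (measurable_run η (t + 1))) (measurableSet_singleton J)
  have hs : Measurable fun ω : Sample N => (ω.2 t i : ℝ≥0∞) :=
    (Measurable.of_discrete (f := fun s : Fin N → ℕ => (s i : ℝ≥0∞))).comp
      ((measurable_pi_apply t).comp measurable_snd)
  rw [prob, lintegral_prod _ (hs.indicator hB).aemeasurable, Measure.prod_apply hB,
    ← lintegral_const_mul _ (measurable_measure_prodMk_left hB)]
  refine lintegral_congr fun V => ?_
  rw [← svc.lintegral_eq]
  exact lintegral_indicator_past svc.law.toMeasure (f := fun s : Fin N → ℕ => (s i : ℝ≥0∞))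
    Measurable.of_discrete (measurable_prodMk_left hB) fun v v' h => by
      change _ = J ↔ _ = J
      rw [sched_succ_congr η (ω := (V, v)) (ω' := (V, v')) rfl h]

/-- The completed jobs are bounded in mean by the services of the queues in the chosen schedules. -/
lemma lintegral_done_le (η : Policy net) (t : ℕ) (i : Fin N) :
    ∫⁻ ω, ((run η ω t).done i : ℝ≥0∞) ∂(prob svc arr) ≤
      ∑ τ ∈ Finset.range t, ∑ J : net.Sched, if i ∈ J.1 then
        ENNReal.ofReal (svc.mean i) * prob svc arr {ω | (run η ω (τ + 1)).sched = J} else 0 := by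
  have hB : ∀ τ J, MeasurableSet {ω : Sample N | (run η ω (τ + 1)).sched = J} := fun τ J =>
    ((Measurable.of_discrete (f := fun x : SysState net => x.sched)).comp
      (measurable_run η (τ + 1))) (measurableSet_singleton J)
  have hs : ∀ τ, Measurable fun ω : Sample N => (ω.2 τ i : ℝ≥0∞) := fun τ =>
    (Measurable.of_discrete (f := fun s : Fin N → ℕ => (s i : ℝ≥0∞))).comp
      ((measurable_pi_apply τ).comp measurable_snd)
  have hpt : ∀ ω : Sample N, ((run η ω t).done i : ℝ≥0∞) ≤
      ∑ τ ∈ Finset.range t, ∑ J : net.Sched, if i ∈ J.1 then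
        {ω | (run η ω (τ + 1)).sched = J}.indicator (fun ω => (ω.2 τ i : ℝ≥0∞)) ω else 0 := by
    intro ω
    induction t with
    | zero => simp [run]
    | succ t ih =>
      rw [Finset.sum_range_succ, run_succ]
      simp only [sysStep]
      push_cast
      gcongr
      set c := decide' net _ _ _ _ _ with hc
      have hsched : (run η ω (t + 1)).sched = c.1 := rfl
      refine le_trans (?_ : _ ≤ if i ∈ c.1.1 then
        {ω | (run η ω (t + 1)).sched = c.1}.indicator (fun ω => (ω.2 t i : ℝ≥0∞)) ω else 0)
        (Finset.single_le_sum (f := fun J : net.Sched => if i ∈ J.1 then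
          {ω | (run η ω (t + 1)).sched = J}.indicator (fun ω => (ω.2 t i : ℝ≥0∞)) ω else 0)
          (fun _ _ => zero_le) (Finset.mem_univ c.1))
      rw [Set.indicator_of_mem (show ω ∈ {ω | (run η ω (t + 1)).sched = c.1} from hsched)]
      unfold offered
      by_cases h1 : i ∈ c.1.1
      · by_cases h2 : c.2.1 = 0 <;> simp [h1, h2]
      · simp [h1]
  calc _ ≤ ∫⁻ ω, ∑ τ ∈ Finset.range t, ∑ J : net.Sched, (if i ∈ J.1 then
        {ω | (run η ω (τ + 1)).sched = J}.indicator (fun ω => (ω.2 τ i : ℝ≥0∞)) ω else 0)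
        ∂(prob svc arr) := lintegral_mono hpt
    _ = _ := by
      have hm : ∀ τ J, Measurable fun ω : Sample N => if i ∈ (J : net.Sched).1 then
          {ω | (run η ω (τ + 1)).sched = J}.indicator (fun ω => (ω.2 τ i : ℝ≥0∞)) ω else 0 := by
        intro τ J
        split_ifs
        · exact (hs τ).indicator (hB τ J)
        · exact measurable_const
      rw [lintegral_finsetSum _ fun τ _ => Finset.measurable_sum _ fun J _ => hm τ J]
      refine Finset.sum_congr rfl fun τ _ => ?_
      rw [lintegral_finsetSum _ fun J _ => hm τ J]
      refine Finset.sum_congr rfl fun J _ => ?_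
      split_ifs
      · exact lintegral_sched_mul_service svc arr η τ J i
      · simp

/-- In mean, at least `t λ_i - 1` jobs arrive before slot `t`. -/
lemma le_mean_mul_lintegral_arrivals (t : ℕ) (i : Fin N) :
    (t : ℝ≥0∞) ≤ ENNReal.ofReal (arr.mean i) *
      (∫⁻ ω, ((∑ τ ∈ Finset.range t, arrivals ω τ i : ℕ) : ℝ≥0∞) ∂(prob svc arr) + 1) := by
  have h := le_mean_mul_lintegral_renewalCount (arr.ae_le i) (arr.lintegral_ne_zero i) t
  rw [arr.lintegral_eq, ← (measurePreserving_arrivals svc arr i).lintegral_comp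
    (measurable_renewalCount t)] at h
  refine h.trans ?_
  gcongr
  calc ∫⁻ ω, renewalCount t (ω.1 i) ∂(prob svc arr)
      ≤ ∫⁻ ω, (((∑ τ ∈ Finset.range t, arrivals ω τ i : ℕ) : ℝ≥0∞) + 1) ∂(prob svc arr) := by
        refine lintegral_mono_ae ?_
        filter_upwards [ae_regular svc arr] with ω hω
        set A := ∑ τ ∈ Finset.range t, arrivals ω τ i with hA
        unfold renewalCount
        rw [tsum_eq_zero_add' ENNReal.summable, add_comm]
        gcongr
        · have : ∀ l, (∑ j ∈ Finset.range (l + 1), ω.1 i j < t) ↔ l < A :=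
            arrivalSlot_lt_iff (hω i) t
          simp only [this]
          rw [tsum_eq_sum (s := Finset.range A) (by simp),
            Finset.sum_congr rfl fun l hl => if_pos (Finset.mem_range.1 hl)]
          simp
        · split_ifs <;> simp
    _ = _ := by rw [lintegral_add_right _ measurable_const]; simp

/-- Under strong stability, the mean queue length is small against `t` for some slot `t`. -/
lemma exists_lintegral_queue_le {η : Policy net} (h : StronglyStable svc arr η) {δ : ℝ}
    (hδ : 0 < δ) : ∃ t : ℕ, 0 < t ∧
      ∫⁻ ω, ∑ i, ((run η ω t).queue i : ℝ≥0∞) ∂(prob svc arr) + 1 ≤ ENNReal.ofReal (δ * t) := by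
  obtain ⟨B, hB, hBt⟩ := exists_between h
  have hev := eventually_lt_of_limsup_lt hB
  by_contra! hcon
  set f : ℕ → ℝ≥0∞ := fun τ => ∫⁻ ω, ∑ i, ((run η ω τ).queue i : ℝ≥0∞) ∂(prob svc arr) with hf
  obtain ⟨K, hK⟩ := exists_nat_gt (2 * (B.toReal + 1) / δ + 1)
  obtain ⟨t, ht, htK⟩ := (hev.and (eventually_ge_atTop (K + 1))).exists
  have ht0 : 0 < t := by omega
  have h1 : ∑ τ ∈ Finset.range t, f τ ≤ B * t := by
    rw [ENNReal.div_lt_iff (Or.inl (by positivity)) (Or.inl (ENNReal.natCast_ne_top t))] at ht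
    exact ht.le
  have h2 : ∑ τ ∈ Finset.range t, ENNReal.ofReal (δ * τ) ≤ B * t + t := by
    calc ∑ τ ∈ Finset.range t, ENNReal.ofReal (δ * τ) ≤ ∑ τ ∈ Finset.range t, (f τ + 1) := by
          refine Finset.sum_le_sum fun τ _ => ?_
          rcases Nat.eq_zero_or_pos τ with rfl | hτ
          · simp
          · exact (hcon τ hτ).le
      _ = ∑ τ ∈ Finset.range t, f τ + t := by simp [Finset.sum_add_distrib]
      _ ≤ _ := by gcongr
  rw [← ENNReal.ofReal_sum_of_nonneg fun τ _ => by positivity, ← Finset.mul_sum] at h2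
  have h3 : δ * ∑ τ ∈ Finset.range t, (τ : ℝ) ≤ (B.toReal + 1) * t := by
    rw [show B * (t : ℝ≥0∞) + t = ENNReal.ofReal ((B.toReal + 1) * t) by
      rw [ENNReal.ofReal_mul (by positivity), ENNReal.ofReal_add (by positivity) one_pos.le,
        ENNReal.ofReal_toReal hBt.ne]
      simp
      ring] at h2
    exact (ENNReal.ofReal_le_ofReal_iff (by positivity)).1 h2
  have h4 : (∑ τ ∈ Finset.range t, (τ : ℝ)) = t * (t - 1) / 2 := by
    clear * -
    induction t with
    | zero => simp
    | succ t ih => rw [Finset.sum_range_succ, ih]; push_cast; ring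
  rw [h4] at h3
  have htr : (0 : ℝ) < t := by exact_mod_cast ht0
  have h5 : δ * ((t : ℝ) - 1) ≤ 2 * (B.toReal + 1) := by
    have : (δ * (t - 1)) * (t : ℝ) ≤ 2 * (B.toReal + 1) * t := by nlinarith
    exact le_of_mul_le_mul_right this htr
  have h6 : 2 * (B.toReal + 1) / δ < (t : ℝ) - 1 := by
    have : ((K + 1 : ℕ) : ℝ) ≤ t := by exact_mod_cast htK
    push_cast at this
    linarith
  rw [div_lt_iff₀ hδ] at h6
  linarith

/-- An admissible rate vector is dominated, up to any `δ > 0`, by the service rates of a mixture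
of the schedules: the empirical one of a stabilizing policy. -/
theorem exists_mixture_of_admissible {r : Fin N → ℝ} (h : Admissible net svc r) {δ : ℝ}
    (hδ : 0 < δ) : ∃ q : net.Sched → ℝ, (∀ J, 0 ≤ q J) ∧ ∑ J, q J = 1 ∧
      ∀ i, r i ≤ (∑ J, if i ∈ J.1 then q J else 0) * svc.mean i + δ := by
  obtain ⟨arr, η, rfl, hst⟩ := h
  obtain ⟨t, ht, hQ⟩ := exists_lintegral_queue_le svc arr hst hδ
  have htr : (0 : ℝ) < t := by exact_mod_cast ht
  set P := prob svc arr with hP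
  let q : ℕ → net.Sched → ℝ := fun τ J => P.real {ω | (run η ω (τ + 1)).sched = J}
  refine ⟨fun J => (∑ τ ∈ Finset.range t, q τ J) / t, fun J => ?_, ?_, fun i => ?_⟩
  · exact div_nonneg (Finset.sum_nonneg fun τ _ => measureReal_nonneg) htr.le
  · rw [← Finset.sum_div, Finset.sum_comm, div_eq_one_iff_eq htr.ne']
    have : ∀ τ, ∑ J, q τ J = 1 := fun τ => by
      have hm : Measurable fun ω : Sample N => (run η ω (τ + 1)).sched :=
        (Measurable.of_discrete (f := fun x : SysState net => x.sched)).comp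
          (measurable_run η (τ + 1))
      have := sum_measureReal_preimage_singleton (μ := P) (f := fun ω => (run η ω (τ + 1)).sched)
        Finset.univ (fun J _ => hm (measurableSet_singleton J))
      rw [show ∑ J, q τ J = _ from this]
      simp
    rw [Finset.sum_congr rfl fun τ _ => this τ]
    simp
  · have h1 := le_mean_mul_lintegral_arrivals svc arr t i
    have h2 := lintegral_done_le svc arr η t i
    have h3 : ∫⁻ ω, ((∑ τ ∈ Finset.range t, arrivals ω τ i : ℕ) : ℝ≥0∞) ∂P =
        ∫⁻ ω, ((run η ω t).queue i : ℝ≥0∞) ∂P + ∫⁻ ω, ((run η ω t).done i : ℝ≥0∞) ∂P := by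
      rw [← lintegral_add_left (f := fun ω => ((run η ω t).queue i : ℝ≥0∞))
        ((Measurable.of_discrete (f := fun x : SysState net => (x.queue i : ℝ≥0∞))).comp
          (measurable_run η t))]
      refine lintegral_congr fun ω => ?_
      rw [← queue_add_done η ω t i]
      push_cast
      rfl
    have h4 : ∫⁻ ω, ((run η ω t).queue i : ℝ≥0∞) ∂P ≤
        ∫⁻ ω, ∑ i, ((run η ω t).queue i : ℝ≥0∞) ∂P := lintegral_mono fun ω =>
      Finset.single_le_sum (f := fun i => ((run η ω t).queue i : ℝ≥0∞)) (fun _ _ => zero_le)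
        (Finset.mem_univ i)
    have h5 : (∑ τ ∈ Finset.range t, ∑ J : net.Sched, if i ∈ J.1 then
        ENNReal.ofReal (svc.mean i) * P {ω | (run η ω (τ + 1)).sched = J} else 0) =
        ENNReal.ofReal (∑ τ ∈ Finset.range t, ∑ J : net.Sched,
          if i ∈ J.1 then svc.mean i * q τ J else 0) := by
      have hnn : ∀ τ (J : net.Sched), 0 ≤ if i ∈ J.1 then svc.mean i * q τ J else 0 := by
        intro τ J
        split_ifs
        · exact mul_nonneg (svc.mean_nonneg i) measureReal_nonneg
        · exact le_rfl
      rw [ENNReal.ofReal_sum_of_nonneg fun τ _ => Finset.sum_nonneg fun J _ => hnn τ J]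
      refine Finset.sum_congr rfl fun τ _ => ?_
      rw [ENNReal.ofReal_sum_of_nonneg fun J _ => hnn τ J]
      refine Finset.sum_congr rfl fun J _ => ?_
      split_ifs
      · rw [ENNReal.ofReal_mul (svc.mean_nonneg i), ofReal_measureReal]
      · simp
    set S := ∑ τ ∈ Finset.range t, ∑ J : net.Sched, if i ∈ J.1 then svc.mean i * q τ J else 0
    have hS0 : 0 ≤ S := Finset.sum_nonneg fun τ _ => Finset.sum_nonneg fun J _ => by
      split_ifs
      · exact mul_nonneg (svc.mean_nonneg i) measureReal_nonneg
      · exact le_rfl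
    have h6 : (t : ℝ≥0∞) ≤ ENNReal.ofReal (arr.mean i * (δ * t + S)) := by
      refine h1.trans ?_
      rw [ENNReal.ofReal_mul (arr.mean_pos i).le, ENNReal.ofReal_add (by positivity) hS0]
      refine mul_le_mul' le_rfl ?_
      rw [h3]
      calc _ = ∫⁻ ω, ((run η ω t).queue i : ℝ≥0∞) ∂P + 1 +
            ∫⁻ ω, ((run η ω t).done i : ℝ≥0∞) ∂P := by ring
        _ ≤ _ := by
          gcongr
          · exact (add_le_add_left h4 1).trans hQ
          · exact h2.trans_eq h5
    rw [← ENNReal.ofReal_natCast, ENNReal.ofReal_le_ofReal_iff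
      (mul_nonneg (arr.mean_pos i).le (by positivity))] at h6
    have h7 : S = t * ((∑ J : net.Sched, if i ∈ J.1 then
        (∑ τ ∈ Finset.range t, q τ J) / t else 0) * svc.mean i) := by
      simp only [S]
      rw [Finset.sum_comm, Finset.sum_mul, Finset.mul_sum]
      refine Finset.sum_congr rfl fun J _ => ?_
      split_ifs
      · rw [← Finset.mul_sum]; field_simp
      · simp
    rw [arr.rate_eq, inv_le_iff_one_le_mul₀ (arr.mean_pos i)]
    rw [h7] at h6
    have : (t : ℝ) * 1 ≤ t * (((∑ J : net.Sched, if i ∈ J.1 then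
        (∑ τ ∈ Finset.range t, q τ J) / t else 0) * svc.mean i + δ) * arr.mean i) := by
      linarith
    exact le_of_mul_le_mul_left this htr

/-- The load of a queue: its arrival rate divided by its mean service. -/
def load (svc : ServiceLaw N) (arr : ArrivalLaw N) (i : Fin N) : ℝ := (arr.mean i * svc.mean i)⁻¹

/-- Rates in the interior of the capacity region leave a slack `ε` in each queue against a suitable
mixture of the schedules. -/
theorem exists_slack (h : arr.rate ∈ interior (capacityRegion net svc)) :
    ∃ ε : ℝ, 0 < ε ∧ (∀ i, 0 < svc.mean i) ∧ ∃ q : net.Sched → ℝ, (∀ J, 0 ≤ q J) ∧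
      ∑ J, q J = 1 ∧ ∀ i, load svc arr i + ε ≤ ∑ J, if i ∈ J.1 then q J else 0 := by
  obtain ⟨ρ, hρ, hball⟩ := Metric.mem_nhds_iff.1 (mem_interior_iff_mem_nhds.1 h)
  -- an admissible vector exceeds the given one by `ρ / 4` in each coordinate
  have hmem : (fun i => arr.rate i + ρ / 2) ∈ capacityRegion net svc := by
    refine hball ?_
    rw [Metric.mem_ball, dist_pi_lt_iff hρ]
    intro i
    rw [Real.dist_eq, add_sub_cancel_left, abs_of_pos (by positivity)]
    linarith
  obtain ⟨r, hr, hdist⟩ := Metric.mem_closure_iff.1 hmem (ρ / 4) (by positivity)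
  obtain ⟨q, hq0, hq1, hq⟩ := exists_mixture_of_admissible svc hr (δ := ρ / 8) (by positivity)
  have hle : ∀ i, arr.rate i + ρ / 8 ≤ (∑ J, if i ∈ J.1 then q J else 0) * svc.mean i := by
    intro i
    have h1 := (dist_le_pi_dist _ _ i).trans hdist.le
    rw [Real.dist_eq, abs_le] at h1
    have := hq i
    linarith [h1.2]
  have hmean : ∀ i, 0 < svc.mean i := by
    intro i
    refine lt_of_le_of_ne (svc.mean_nonneg i) fun h0 => ?_
    have h1 := hle i
    rw [← h0, mul_zero, arr.rate_eq] at h1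
    have := inv_pos.2 (arr.mean_pos i)
    linarith
  -- the mean services are at most `Smax + 1`, so that a common slack remains after division
  have hbd : ∀ i, svc.mean i ≤ svc.Smax + 1 := by
    intro i
    have : svc.mean i ≤ ∫ _, (svc.Smax : ℝ) ∂svc.law.toMeasure := by
      refine integral_mono_ae (svc.integrable i) (integrable_const _) ?_
      filter_upwards [svc.ae_le] with s hs
      exact_mod_cast hs i
    simp at this
    linarith
  refine ⟨ρ / 8 / (svc.Smax + 1), by positivity, hmean, q, hq0, hq1, fun i => ?_⟩
  have h1 : load svc arr i + ρ / 8 / svc.mean i ≤ ∑ J, if i ∈ J.1 then q J else 0 := by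
    have h2 : load svc arr i + ρ / 8 / svc.mean i = (arr.rate i + ρ / 8) / svc.mean i := by
      have := arr.mean_pos i
      have := hmean i
      rw [load, arr.rate_eq]
      field_simp
    rw [h2, div_le_iff₀ (hmean i)]
    exact hle i
  have h3 : ρ / 8 / (svc.Smax + 1) ≤ ρ / 8 / svc.mean i :=
    div_le_div_of_nonneg_left (by positivity) (hmean i) (hbd i)
  linarith

end Capacity

/-! ### The bias function -/

section Gain

/-- The function `s ↦ max {1, s^a}` in the switching condition. -/
def gain (a s : ℝ) : ℝ := max 1 (s ^ a)

variable {a : ℝ}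

lemma one_le_gain (s : ℝ) : 1 ≤ gain a s := le_max_left _ _

lemma gain_pos (s : ℝ) : 0 < gain a s := one_pos.trans_le (one_le_gain s)

lemma gain_mono (ha : 0 < a) {s t : ℝ} (hs : 0 ≤ s) (hst : s ≤ t) : gain a s ≤ gain a t :=
  max_le_max le_rfl (Real.rpow_le_rpow hs hst ha.le)

/-- The bias function grows at most linearly: `gain s / s` decreases. -/
lemma mul_gain_le (ha1 : a < 1) {s t : ℝ} (hs : 0 ≤ s) (hst : s ≤ t) :
    s * gain a t ≤ t * gain a s := by
  unfold gain
  rw [mul_max_of_nonneg _ _ hs, mul_max_of_nonneg _ _ (hs.trans hst)]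
  refine max_le ?_ ?_
  · exact le_max_of_le_left (by linarith)
  · rcases hs.eq_or_lt with rfl | hs0
    · simp only [zero_mul]
      exact le_max_of_le_left (by linarith)
    refine le_max_of_le_right ?_
    have ht0 : 0 < t := hs0.trans_le hst
    have h1 : ∀ x : ℝ, 0 < x → x = x ^ a * x ^ (1 - a) := fun x hx => by
      rw [← Real.rpow_add hx]; simp
    have h2 : s ^ (1 - a) ≤ t ^ (1 - a) := Real.rpow_le_rpow hs hst (by linarith)
    calc s * t ^ a = s ^ a * t ^ a * s ^ (1 - a) := by nth_rewrite 1 [h1 s hs0]; ring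
      _ ≤ s ^ a * t ^ a * t ^ (1 - a) := by gcongr
      _ = t * s ^ a := by nth_rewrite 3 [h1 t ht0]; ring

lemma gain_two_mul_le (ha0 : 0 < a) (ha1 : a < 1) {s t : ℝ} (hs : 0 ≤ s) (ht : 0 ≤ t)
    (hts : t ≤ 2 * s) : gain a t ≤ 2 * gain a s := by
  rcases hs.eq_or_lt with rfl | hs0
  · have : t = 0 := le_antisymm (by simpa using hts) ht
    subst this
    linarith [gain_pos (a := a) 0]
  · have h1 := mul_gain_le ha1 hs (show s ≤ 2 * s by linarith)
    have h2 : gain a (2 * s) ≤ 2 * gain a s := by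
      have : s * gain a (2 * s) ≤ s * (2 * gain a s) := by linarith
      exact le_of_mul_le_mul_left this hs0
    exact (gain_mono ha0 ht hts).trans h2

/-- The bias function is sublinear. -/
lemma exists_gain_le (ha0 : 0 < a) (ha1 : a < 1) {η : ℝ} (hη : 0 < η) :
    ∃ B, 0 ≤ B ∧ ∀ s, 0 ≤ s → gain a s ≤ η * s + B := by
  obtain ⟨S, hS⟩ := (tendsto_atTop.1
    (tendsto_rpow_atTop (show 0 < 1 - a by linarith)) η⁻¹).exists_forall_of_atTop
  set S₁ := max S 1
  refine ⟨1 + S₁ ^ a, by positivity, fun s hs => ?_⟩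
  have hS₁ : 0 ≤ S₁ ^ a := by positivity
  refine max_le (by nlinarith) ?_
  rcases le_total s S₁ with h | h
  · have := Real.rpow_le_rpow hs h ha0.le
    nlinarith
  · have hs0 : 0 < s := one_pos.trans_le ((le_max_right S 1).trans h)
    have h1 := hS s ((le_max_left S 1).trans h)
    have h2 : s = s ^ a * s ^ (1 - a) := by rw [← Real.rpow_add hs0]; simp
    have h3 : s ^ a ≤ η * s := by
      calc s ^ a = η * (s ^ a * η⁻¹) := by field_simp
        _ ≤ η * (s ^ a * s ^ (1 - a)) := by gcongr
        _ = η * s := by rw [← h2]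
    linarith

/-- The bias function is unbounded. -/
lemma exists_mul_le_gain (ha0 : 0 < a) {η C : ℝ} (hη : 0 < η) (hC : 0 ≤ C) :
    ∃ B, 0 ≤ B ∧ ∀ s, 0 ≤ s → C * s ≤ (η * s + B) * gain a (s / 3) := by
  obtain ⟨S, hS⟩ := (tendsto_atTop.1 (tendsto_rpow_atTop ha0) (C / η)).exists_forall_of_atTop
  set S₁ := max S 0
  refine ⟨C * (3 * S₁), by positivity, fun s hs => ?_⟩
  have h0 : 0 ≤ η * s := by positivity
  have h1 : 0 ≤ C * (3 * S₁) := by positivity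
  rcases le_total (s / 3) S₁ with h | h
  · have h2 : C * s ≤ C * (3 * S₁) := by gcongr; linarith
    nlinarith [one_le_gain (a := a) (s / 3)]
  · have h2 : C / η ≤ gain a (s / 3) := (hS _ ((le_max_left S 0).trans h)).trans (le_max_right _ _)
    calc C * s = η * s * (C / η) := by field_simp
      _ ≤ η * s * gain a (s / 3) := by gcongr
      _ ≤ _ := by gcongr; exacts [(gain_pos _).le, by linarith]

end Gain

/-! ### One slot of a queue -/

section OneQueue

lemma served_le (n : ℕ) (u : ℤ) (v : ℕ → ℕ) : served n u v ≤ n := by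
  induction n generalizing u v with
  | zero => exact le_rfl
  | succ n ih =>
    unfold served
    split_ifs
    · omega
    · have := ih (u - v 0) (fun l => v (l + 1)); omega

/-- A job that has waited long is followed by sufficiently many waiting jobs. -/
lemma served_eq_of_lt {n K : ℕ} {u : ℤ} {v : ℕ → ℕ} (hv : ∀ l, v l ≤ K)
    (hu : ((n * K : ℕ) : ℤ) < u) : served n u v = n := by
  induction n generalizing u v with
  | zero => rfl
  | succ n ih =>
    have h0 := hv 0
    have h1 : ((n + 1) * K : ℕ) = n * K + K := by ring
    rw [h1] at hu
    push_cast at hu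
    have h2 : (0 : ℤ) ≤ ((n * K : ℕ) : ℤ) := Int.natCast_nonneg _
    push_cast at h2
    unfold served
    rw [if_neg (by omega), ih (fun l => hv (l + 1)) (by push_cast; omega)]

lemma le_serve {n K : ℕ} {u : ℤ} {v : ℕ → ℕ} (hv : ∀ l, v l ≤ K) :
    min u (1 - K) ≤ serve n u v := by
  induction n generalizing u v with
  | zero => exact min_le_left _ _
  | succ n ih =>
    have h0 := hv 0
    unfold serve
    split_ifs with h
    · exact min_le_left _ _
    · refine le_trans ?_ (ih fun l => hv (l + 1))
      omega

lemma serve_le (n : ℕ) (u : ℤ) (v : ℕ → ℕ) : serve n u v ≤ u := by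
  rw [serve_eq]; omega

lemma sum_range_le_mul {n m K : ℕ} {v : ℕ → ℕ} (hv : ∀ l, v l ≤ K) (hnm : n ≤ m) :
    ∑ l ∈ Finset.range n, v l ≤ m * K := by
  calc ∑ l ∈ Finset.range n, v l ≤ ∑ l ∈ Finset.range n, K := Finset.sum_le_sum fun l _ => hv l
    _ = n * K := by simp
    _ ≤ m * K := Nat.mul_le_mul_right K hnm

/-- Squared excess of the waiting time over a level `a` after one slot. The increment is replaced by
the one of a queue in which all offered service is used; the two agree except at waiting times
below `S * K`, which contributes to the constant only. -/
lemma sq_excess_serve_le {n S K : ℕ} {u : ℤ} {v : ℕ → ℕ} (hv : ∀ l, v l ≤ K) (hn : n ≤ S)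
    {a : ℝ} (ha : 0 ≤ a) :
    (max (((serve n u v + 1).toNat : ℝ) - a) 0) ^ 2 ≤ (max ((u.toNat : ℝ) - a) 0) ^ 2 +
      2 * (max ((u.toNat : ℝ) - a) 0) * (1 - ((∑ l ∈ Finset.range n, v l : ℕ) : ℝ)) +
      5 * ((S * K : ℕ) + 1 : ℝ) ^ 2 := by
  set A : ℕ := ∑ l ∈ Finset.range n, v l with hA
  set B : ℕ := ∑ l ∈ Finset.range (served n u v), v l with hB
  have hAS : (A : ℝ) ≤ ((S * K : ℕ) : ℝ) := by exact_mod_cast sum_range_le_mul hv hn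
  have hBS : (B : ℝ) ≤ ((S * K : ℕ) : ℝ) := by
    exact_mod_cast sum_range_le_mul hv ((served_le n u v).trans hn)
  set T : ℝ := ((S * K : ℕ) : ℝ)
  have hA0 : (0 : ℝ) ≤ A := by positivity
  have hB0 : (0 : ℝ) ≤ B := by positivity
  set y : ℝ := (u.toNat : ℝ) - a with hy
  set e := max y 0 with he
  have he0 : 0 ≤ e := le_max_right _ _
  -- the waiting time moves by at most `1 - B`, apart from the truncation at `0`
  have h1 : ((serve n u v + 1).toNat : ℝ) - a ≤ max (y + (1 - B)) 0 := by
    have h2 : ((serve n u v + 1).toNat : ℤ) ≤ max ((u.toNat : ℤ) + 1 - B) 0 := by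
      rw [serve_eq]; omega
    have h3 : ((serve n u v + 1).toNat : ℝ) ≤ max ((u.toNat : ℝ) + 1 - B) 0 := by exact_mod_cast h2
    rcases le_max_iff.1 h3 with h | h
    · exact le_max_of_le_left (by rw [hy]; linarith)
    · exact le_max_of_le_right (by linarith)
  have h2 : max (((serve n u v + 1).toNat : ℝ) - a) 0 ≤ max (e + (1 - B)) 0 := by
    refine max_le (h1.trans (max_le_max ?_ le_rfl)) (le_max_right _ _)
    linarith [le_max_left y 0]
  have h3 : (max (((serve n u v + 1).toNat : ℝ) - a) 0) ^ 2 ≤ (e + (1 - B)) ^ 2 := by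
    calc _ ≤ (max (e + (1 - B)) 0) ^ 2 := by gcongr
      _ ≤ _ := by
        rcases le_total (e + (1 - B)) 0 with h | h
        · rw [max_eq_right h, zero_pow two_ne_zero]; exact sq_nonneg _
        · rw [max_eq_left h]
  have h4 : (1 - (B : ℝ)) ^ 2 ≤ (T + 1) ^ 2 := by
    apply sq_le_sq'
    · linarith
    · linarith
  have h5 : 2 * e * (1 - (B : ℝ)) ≤ 2 * e * (1 - (A : ℝ)) + 4 * (T + 1) ^ 2 := by
    by_cases hu : ((n * K : ℕ) : ℤ) < u
    · have : A = B := by rw [hA, hB, served_eq_of_lt hv hu]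
      rw [this]
      nlinarith [sq_nonneg (T + 1)]
    · have hn' : ((n * K : ℕ) : ℤ) ≤ ((S * K : ℕ) : ℤ) := by
        exact_mod_cast Nat.mul_le_mul_right K hn
      have hle : (u.toNat : ℤ) ≤ ((S * K : ℕ) : ℤ) := by
        have : (0 : ℤ) ≤ ((S * K : ℕ) : ℤ) := Int.natCast_nonneg _
        rw [Int.toNat_eq_max]
        exact max_le ((not_lt.1 hu).trans hn') this
      have hle' : (u.toNat : ℝ) ≤ T := Nat.cast_le.2 (Int.ofNat_le.1 hle)
      have heT : e ≤ T := max_le (by rw [hy]; linarith) (by linarith)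
      have : 2 * e * ((A : ℝ) - B) ≤ 2 * T * T := by
        have h6 : (A : ℝ) - B ≤ T := by linarith
        calc 2 * e * ((A : ℝ) - B) ≤ 2 * e * T := by gcongr
          _ ≤ 2 * T * T := by gcongr
      nlinarith
  nlinarith

lemma abs_toNat_serve_sub_le {n S K : ℕ} {u : ℤ} {v : ℕ → ℕ} (hv : ∀ l, v l ≤ K) (hn : n ≤ S) :
    |(((serve n u v + 1).toNat : ℝ)) - u.toNat| ≤ (S * K : ℕ) + 1 := by
  have h1 := sum_range_le_mul hv ((served_le n u v).trans hn)
  have h2 : |((serve n u v + 1).toNat : ℤ) - u.toNat| ≤ (S * K : ℕ) + 1 := by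
    rw [serve_eq, abs_le]
    constructor <;> omega
  exact_mod_cast h2

end OneQueue

/-! ### Weights of schedules -/

section Weights

variable {N : ℕ} {net : Network N}

/-- The total waiting time. -/
def total (w : Fin N → ℕ) : ℝ := ∑ i, (w i : ℝ)

lemma total_nonneg (w : Fin N → ℕ) : 0 ≤ total w := Finset.sum_nonneg fun _ _ => by positivity

lemma G_eq (a : ℝ) (w : Fin N → ℕ) : G a w = gain a (total w) := rfl

/-- The largest weight of a schedule. -/
def maxWeight (net : Network N) (w : Fin N → ℕ) : ℝ :=
  net.schedules.sup' net.nonempty fun J => weight J w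

lemma weight_le_maxWeight (J : net.Sched) (w : Fin N → ℕ) : weight J.1 w ≤ maxWeight net w :=
  Finset.le_sup' (fun J => weight J w) J.2

lemma weight_nonneg (I : Finset (Fin N)) (w : Fin N → ℕ) : 0 ≤ weight I w :=
  Finset.sum_nonneg fun _ _ => by positivity

lemma maxWeight_nonneg (w : Fin N → ℕ) : 0 ≤ maxWeight net w := by
  obtain ⟨J, hJ⟩ := net.nonempty
  exact (weight_nonneg J w).trans (weight_le_maxWeight ⟨J, hJ⟩ w)

lemma weight_le_total (I : Finset (Fin N)) (w : Fin N → ℕ) : weight I w ≤ total w :=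
  Finset.sum_le_sum_of_subset_of_nonneg (Finset.subset_univ _) fun _ _ _ => by positivity

lemma maxWeight_le_total (w : Fin N → ℕ) : maxWeight net w ≤ total w :=
  Finset.sup'_le _ _ fun J _ => weight_le_total J w

lemma weight_le_add {w w' : Fin N → ℕ} {K : ℝ} (hK : 0 ≤ K) (h : ∀ i, |(w' i : ℝ) - w i| ≤ K)
    (I : Finset (Fin N)) : |weight I w' - weight I w| ≤ N * K := by
  unfold weight
  rw [← Finset.sum_sub_distrib]
  calc |∑ i ∈ I, ((w' i : ℝ) - w i)| ≤ ∑ i ∈ I, |(w' i : ℝ) - w i| := Finset.abs_sum_le_sum_abs _ _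
    _ ≤ ∑ i ∈ I, K := Finset.sum_le_sum fun i _ => h i
    _ ≤ ∑ _i : Fin N, K :=
        Finset.sum_le_sum_of_subset_of_nonneg (Finset.subset_univ _) fun _ _ _ => hK
    _ = N * K := by simp

/-- If the loads stay below a mixture of the schedules with slack `ε`, then the load-weighted
waiting times stay below the largest weight. -/
lemma sum_load_le_maxWeight {ρ : Fin N → ℝ} {ε : ℝ} {q : net.Sched → ℝ} (hq0 : ∀ J, 0 ≤ q J)
    (hq1 : ∑ J, q J = 1) (hq : ∀ i, ρ i + ε ≤ ∑ J, if i ∈ J.1 then q J else 0)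
    (w : Fin N → ℕ) : ∑ i, (w i : ℝ) * ρ i + ε * total w ≤ maxWeight net w := by
  calc ∑ i, (w i : ℝ) * ρ i + ε * total w = ∑ i, (w i : ℝ) * (ρ i + ε) := by
        rw [total, Finset.mul_sum, ← Finset.sum_add_distrib]
        exact Finset.sum_congr rfl fun i _ => by ring
    _ ≤ ∑ i, (w i : ℝ) * ∑ J : net.Sched, (if i ∈ J.1 then q J else 0) :=
        Finset.sum_le_sum fun i _ => mul_le_mul_of_nonneg_left (hq i) (by positivity)
    _ = ∑ J : net.Sched, q J * weight J.1 w := by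
        simp only [Finset.mul_sum]
        rw [Finset.sum_comm]
        refine Finset.sum_congr rfl fun J _ => ?_
        rw [weight, Finset.mul_sum, ← Finset.sum_filter_add_sum_filter_not Finset.univ (· ∈ J.1),
          Finset.filter_mem_eq_inter, Finset.univ_inter]
        rw [Finset.sum_congr rfl fun i hi => by rw [if_pos hi, mul_comm],
          Finset.sum_eq_zero (s := Finset.univ.filter fun i => i ∉ J.1) fun i hi => by
            rw [if_neg (Finset.mem_filter.1 hi).2, mul_zero], add_zero]
    _ ≤ ∑ J : net.Sched, q J * maxWeight net w :=
        Finset.sum_le_sum fun J _ => mul_le_mul_of_nonneg_left (weight_le_maxWeight J w) (hq0 J)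
    _ = maxWeight net w := by rw [← Finset.sum_mul, hq1, one_mul]

lemma load_le_one_sub {ρ : Fin N → ℝ} {ε : ℝ} {q : net.Sched → ℝ} (hq0 : ∀ J, 0 ≤ q J)
    (hq1 : ∑ J, q J = 1) (hq : ∀ i, ρ i + ε ≤ ∑ J, if i ∈ J.1 then q J else 0) (i : Fin N) :
    ρ i ≤ 1 - ε := by
  have h : ∑ J : net.Sched, (if i ∈ J.1 then q J else 0) ≤ ∑ J, q J :=
    Finset.sum_le_sum fun J _ => by split_ifs; exacts [le_rfl, hq0 J]
  linarith [hq i]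

end Weights

/-! ### The Lyapunov function -/

section Lyapunov

variable {N : ℕ} {net : Network N}

/-- The coefficients of the Lyapunov function. -/
structure Coeffs where
  /-- coefficient of the squared excess of the waiting times over the memory -/
  excess : ℝ
  /-- cost of a switching slot per unit of waiting time -/
  lin : ℝ
  /-- fixed cost of a switching slot -/
  fixed : ℝ
  /-- credit for the loss of weight of the current schedule -/
  bias : ℝ
  /-- credit for the decrease of the waiting times since the latest switch -/
  mem : ℝ
  /-- cost of a job that is not about to arrive -/
  early : ℝ
  excess_nonneg : 0 ≤ excess
  lin_nonneg : 0 ≤ lin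
  fixed_nonneg : 0 ≤ fixed
  bias_nonneg : 0 ≤ bias
  mem_nonneg : 0 ≤ mem
  early_nonneg : 0 ≤ early

/-- The excess of the waiting time of queue `i` over twice the total waiting time in memory. -/
def excess (x : ChainState net) (i : Fin N) : ℝ := max ((x.waits i : ℝ) - 2 * total x.mem) 0

lemma excess_nonneg (x : ChainState net) (i : Fin N) : 0 ≤ excess x i := le_max_right _ _

lemma excess_le (x : ChainState net) (i : Fin N) : excess x i ≤ x.waits i :=
  max_le (by linarith [total_nonneg x.mem]) (by positivity)

/-- The Lyapunov function for loads `ρ` and inter-arrival times bounded by `V`. Besides the weighted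
sum of squares of the waiting times, it contains
* the squared excess of the waiting times in the current schedule over the memory, which decreases
  in ACTIVE mode and makes up for the weight that is lost while a small memory delays a switch,
* the cost of the remaining switching slots,
* two credits which pay for a switch: the weight lost against the best schedule, multiplied by the
  bias function, and the decrease of the waiting times below the memory,
* a cost of jobs whose arrival is more than `V` slots ahead. -/
def lyapunov (a : ℝ) (ρ : Fin N → ℝ) (V : ℕ) (k : Coeffs) (x : ChainState net) : ℝ :=
  ∑ i, ρ i * (x.waits i : ℝ) ^ 2 + k.excess * ∑ i ∈ x.sched.1, ρ i * excess x i ^ 2 +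
    x.rem * (k.lin * (total x.waits + N * x.rem) + k.fixed) +
    k.bias * ((maxWeight net x.waits - weight x.sched.1 x.waits) * gain a (total x.waits)) +
    k.mem * max (total x.mem - total x.waits) 0 +
    k.early * ∑ i, max (-(x.age i : ℝ) - V) 0

/-- The state after the decision of the server. -/
def decided (d : Rule net) (x : ChainState net) : ChainState net :=
  ⟨x.age, (decision d x).1, (decision d x).2.1, (decision d x).2.2⟩

/-- The rest of a slot after the decision. -/
def evolve (x : ChainState net) (v : Fin N → ℕ → ℕ) (s : Fin N → ℕ) : ChainState net :=
  ⟨fun i => serve (offered x.sched x.rem s i) (x.age i) (v i) + 1, x.sched, x.rem - 1, x.mem⟩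

lemma chainStep_eq_evolve (d : Rule net) (x : ChainState net) (v : Fin N → ℕ → ℕ) (s : Fin N → ℕ) :
    chainStep d x v s = evolve (decided d x) v s := rfl

lemma decided_of_none {d : Rule net} {x : ChainState net}
    (h : d x.waits x.sched x.rem x.mem = none) : decided d x = x := by
  simp [decided, decision, h, decide']

lemma decided_of_some {d : Rule net} {x : ChainState net} {J : net.Sched}
    (h : d x.waits x.sched x.rem x.mem = some J) : decided d x = ⟨x.age, J, net.Ts, x.waits⟩ := by
  simp [decided, decision, h, decide']

lemma offered_le {I : net.Sched} {r S : ℕ} {s : Fin N → ℕ} (hs : ∀ i, s i ≤ S) (i : Fin N) :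
    offered I r s i ≤ S := by
  unfold offered
  split_ifs
  · exact hs i
  · exact Nat.zero_le _

variable {a : ℝ} {ρ : Fin N → ℝ} {V : ℕ} {k : Coeffs}

lemma lyapunov_nonneg (hρ0 : ∀ i, 0 ≤ ρ i) (x : ChainState net) : 0 ≤ lyapunov a ρ V k x := by
  have h1 := sub_nonneg.2 (weight_le_maxWeight x.sched x.waits)
  have h2 := (gain_pos (a := a) (total x.waits)).le
  have h3 := total_nonneg x.waits
  have h4 : 0 ≤ ∑ i, ρ i * (x.waits i : ℝ) ^ 2 :=
    Finset.sum_nonneg fun i _ => mul_nonneg (hρ0 i) (by positivity)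
  have h5 : 0 ≤ ∑ i ∈ x.sched.1, ρ i * excess x i ^ 2 :=
    Finset.sum_nonneg fun i _ => mul_nonneg (hρ0 i) (by positivity)
  have h6 : 0 ≤ ∑ i, max (-(x.age i : ℝ) - V) 0 :=
    Finset.sum_nonneg fun i _ => le_max_right _ _
  have := k.excess_nonneg
  have := k.lin_nonneg
  have := k.fixed_nonneg
  have := k.bias_nonneg
  have := k.mem_nonneg
  have := k.early_nonneg
  unfold lyapunov
  positivity

/-- The credit `(M - I^T W) g(1^T W)` for the lost weight grows slowly. -/
lemma credit_le (ha0 : 0 < a) (ha1 : a < 1) {δ δ' s s' D : ℝ} (hs : 0 ≤ s) (hs' : 0 ≤ s')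
    (hδs : δ ≤ s) (hδ : 0 ≤ δ) (hδ' : δ' ≤ δ + D) (hD : 0 ≤ D) (hss' : s' ≤ s + D) :
    δ' * gain a s' ≤ δ * gain a s + 2 * D * gain a (s + D) := by
  have hg : gain a s' ≤ gain a (s + D) := gain_mono ha0 hs' hss'
  have hgs : gain a s ≤ gain a (s + D) := gain_mono ha0 hs (by linarith)
  have h1 : δ' * gain a s' ≤ δ * gain a s' + D * gain a (s + D) := by
    calc δ' * gain a s' ≤ (δ + D) * gain a s' := by
          gcongr; exact (gain_pos _).le
      _ = δ * gain a s' + D * gain a s' := by ring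
      _ ≤ _ := by gcongr
  have h2 : δ * gain a s' ≤ δ * gain a s + D * gain a (s + D) := by
    rcases le_total s' s with h | h
    · have := gain_mono ha0 hs' h
      have h3 : 0 ≤ D * gain a (s + D) := mul_nonneg hD (gain_pos _).le
      nlinarith
    · have h3 := mul_gain_le ha1 hs h
      have h4 := gain_mono ha0 hs h
      calc δ * gain a s' = δ * gain a s + δ * (gain a s' - gain a s) := by ring
        _ ≤ δ * gain a s + s * (gain a s' - gain a s) := by
          gcongr
        _ ≤ δ * gain a s + D * gain a s := by nlinarith [(gain_pos (a := a) s).le]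
        _ ≤ _ := by gcongr
  linarith

/-- The change of the Lyapunov function in the rest of a slot, for bounded samples. -/
lemma lyapunov_evolve_le (ha0 : 0 < a) (ha1 : a < 1) (hρ0 : ∀ i, 0 ≤ ρ i) (hρ1 : ∀ i, ρ i ≤ 1)
    {S : ℕ} {v : Fin N → ℕ → ℕ} {s : Fin N → ℕ} (hv : ∀ i l, v i l ≤ V) (hs : ∀ i, s i ≤ S)
    (x : ChainState net) {K D : ℝ} (hK : K = (S * V : ℕ) + 1) (hD : D = 2 * (N * K)) :
    lyapunov a ρ V k (evolve x v s) ≤ lyapunov a ρ V k x +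
      ∑ i, ρ i * (2 * x.waits i *
        (1 - ((∑ l ∈ Finset.range (offered x.sched x.rem s i), v i l : ℕ) : ℝ))) +
      k.excess * ∑ i ∈ x.sched.1, ρ i * (2 * excess x i *
        (1 - ((∑ l ∈ Finset.range (offered x.sched x.rem s i), v i l : ℕ) : ℝ))) -
      (if x.rem = 0 then 0 else k.lin * (total x.waits + N * x.rem) + k.fixed) +
      k.bias * (2 * D * gain a (total x.waits + D)) + k.mem * D -
      (if ∃ i, x.age i < -(V : ℤ) then k.early else 0) + (1 + k.excess) * (N * (5 * K ^ 2)) := by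
  set y := evolve x v s with hy
  have hK1 : 1 ≤ K := by rw [hK]; have : (0 : ℝ) ≤ ((S * V : ℕ) : ℝ) := by positivity
                         linarith
  have hN : (0 : ℝ) ≤ N := by positivity
  have hNK : (0 : ℝ) ≤ N * K := by positivity
  have hD0 : 0 ≤ D := by rw [hD]; positivity
  have hoff : ∀ i, offered x.sched x.rem s i ≤ S := offered_le hs
  have hΔ : ∀ i, |(y.waits i : ℝ) - x.waits i| ≤ K := fun i => by
    rw [hK]; exact abs_toNat_serve_sub_le (hv i) (hoff i)
  have hΔ1 : ∀ i, (y.waits i : ℝ) ≤ x.waits i + 1 := fun i => by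
    have h1 := serve_le (offered x.sched x.rem s i) (x.age i) (v i)
    have : (y.waits i : ℤ) ≤ x.waits i + 1 := by
      change ((serve _ _ _ + 1).toNat : ℤ) ≤ (x.age i).toNat + 1
      omega
    exact_mod_cast this
  have htot1 : total y.waits ≤ total x.waits + N := by
    calc total y.waits ≤ ∑ i, ((x.waits i : ℝ) + 1) := Finset.sum_le_sum fun i _ => hΔ1 i
      _ = _ := by rw [Finset.sum_add_distrib]; simp [total]
  have htotK : total x.waits ≤ total y.waits + N * K := by
    calc total x.waits ≤ ∑ i, ((y.waits i : ℝ) + K) :=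
          Finset.sum_le_sum fun i _ => by linarith [(abs_le.1 (hΔ i)).1]
      _ = _ := by rw [Finset.sum_add_distrib]; simp [total]
  have hND : (N : ℝ) ≤ D := by rw [hD]; nlinarith
  -- squares of the waiting times
  have e1 : ∑ i, ρ i * (y.waits i : ℝ) ^ 2 ≤ ∑ i, ρ i * (x.waits i : ℝ) ^ 2 +
      ∑ i, ρ i * (2 * x.waits i *
        (1 - ((∑ l ∈ Finset.range (offered x.sched x.rem s i), v i l : ℕ) : ℝ))) +
      N * (5 * K ^ 2) := by
    have : (N : ℝ) * (5 * K ^ 2) = ∑ _i : Fin N, 5 * K ^ 2 := by simp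
    rw [this, ← Finset.sum_add_distrib, ← Finset.sum_add_distrib]
    refine Finset.sum_le_sum fun i _ => ?_
    have h := sq_excess_serve_le (hv i) (hoff i) (u := x.age i) le_rfl
    simp only [sub_zero] at h
    rw [max_eq_left (by positivity), max_eq_left (by positivity), ← hK] at h
    change (y.waits i : ℝ) ^ 2 ≤ (x.waits i : ℝ) ^ 2 + 2 * (x.waits i) * _ + _ at h
    have h2 := mul_le_mul_of_nonneg_left h (hρ0 i)
    have h3 : ρ i * (5 * K ^ 2) ≤ 5 * K ^ 2 := mul_le_of_le_one_left (by positivity) (hρ1 i)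
    linarith
  -- squares of the excess over the memory
  have e2 : ∑ i ∈ y.sched.1, ρ i * excess y i ^ 2 ≤ ∑ i ∈ x.sched.1, ρ i * excess x i ^ 2 +
      ∑ i ∈ x.sched.1, ρ i * (2 * excess x i *
        (1 - ((∑ l ∈ Finset.range (offered x.sched x.rem s i), v i l : ℕ) : ℝ))) +
      N * (5 * K ^ 2) := by
    have : ∑ i ∈ x.sched.1, 5 * K ^ 2 ≤ N * (5 * K ^ 2) := by
      calc ∑ i ∈ x.sched.1, 5 * K ^ 2 ≤ ∑ _i : Fin N, 5 * K ^ 2 :=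
            Finset.sum_le_sum_of_subset_of_nonneg (Finset.subset_univ _) fun _ _ _ => by positivity
        _ = _ := by simp
    refine le_trans ?_ (add_le_add_right this _)
    rw [← Finset.sum_add_distrib, ← Finset.sum_add_distrib]
    refine Finset.sum_le_sum fun i _ => ?_
    have h := sq_excess_serve_le (hv i) (hoff i) (u := x.age i) (a := 2 * total x.mem)
      (by linarith [total_nonneg x.mem])
    rw [← hK] at h
    change excess y i ^ 2 ≤ excess x i ^ 2 + 2 * excess x i * _ + _ at h
    have h2 := mul_le_mul_of_nonneg_left h (hρ0 i)
    have h3 : ρ i * (5 * K ^ 2) ≤ 5 * K ^ 2 := mul_le_of_le_one_left (by positivity) (hρ1 i)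
    linarith
  -- remaining switching slots
  have e3 : (y.rem : ℝ) * (k.lin * (total y.waits + N * y.rem) + k.fixed) ≤
      x.rem * (k.lin * (total x.waits + N * x.rem) + k.fixed) -
      (if x.rem = 0 then 0 else k.lin * (total x.waits + N * x.rem) + k.fixed) := by
    change ((x.rem - 1 : ℕ) : ℝ) * (k.lin * (total y.waits + N * (x.rem - 1 : ℕ)) + k.fixed) ≤ _
    rcases Nat.eq_zero_or_pos x.rem with h0 | h0
    · simp [h0]
    · rw [if_neg h0.ne', Nat.cast_pred h0]
      have hr : (0 : ℝ) ≤ (x.rem : ℝ) - 1 := by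
        have : (1 : ℝ) ≤ x.rem := by exact_mod_cast h0
        linarith
      have h1 : k.lin * (total y.waits + N * ((x.rem : ℝ) - 1)) ≤
          k.lin * (total x.waits + N * x.rem) :=
        mul_le_mul_of_nonneg_left (by linarith) k.lin_nonneg
      nlinarith
  -- credit for the lost weight
  have e4 : (maxWeight net y.waits - weight y.sched.1 y.waits) * gain a (total y.waits) ≤
      (maxWeight net x.waits - weight x.sched.1 x.waits) * gain a (total x.waits) +
      2 * D * gain a (total x.waits + D) := by
    have hw := fun I => abs_le.1 (weight_le_add (by linarith) hΔ I)
    have hM : maxWeight net y.waits ≤ maxWeight net x.waits + N * K := by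
      refine Finset.sup'_le _ _ fun J hJ => ?_
      have h1 := weight_le_maxWeight (net := net) ⟨J, hJ⟩ x.waits
      linarith [(hw J).2]
    refine credit_le ha0 ha1 (total_nonneg _) (total_nonneg _) ?_
      (sub_nonneg.2 (weight_le_maxWeight _ _)) ?_ hD0 (htot1.trans (by linarith))
    · linarith [maxWeight_le_total (net := net) x.waits, weight_nonneg x.sched.1 x.waits]
    · change maxWeight net y.waits - weight x.sched.1 y.waits ≤ _
      linarith [(hw x.sched.1).1]
  -- credit for waiting times below the memory
  have e5 : max (total y.mem - total y.waits) 0 ≤ max (total x.mem - total x.waits) 0 + D := by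
    refine max_le ?_ (add_nonneg (le_max_right _ _) hD0)
    change total x.mem - total y.waits ≤ _
    have := le_max_left (total x.mem - total x.waits) 0
    rw [hD]
    linarith
  -- jobs that arrive late
  have e6 : k.early * ∑ i, max (-(y.age i : ℝ) - V) 0 ≤
      k.early * ∑ i, max (-(x.age i : ℝ) - V) 0 -
      (if ∃ i, x.age i < -(V : ℤ) then k.early else 0) := by
    have hterm : ∀ i, max (-(y.age i : ℝ) - V) 0 ≤
        max (-(x.age i : ℝ) - V) 0 - if x.age i < -(V : ℤ) then 1 else 0 := by
      intro i
      have h1 := le_serve (hv i) (n := offered x.sched x.rem s i) (u := x.age i)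
      have h2 : max (-(y.age i) - V) 0 ≤
          max (-(x.age i) - V : ℤ) 0 - if x.age i < -(V : ℤ) then 1 else 0 := by
        change max (-(serve _ _ _ + 1) - (V : ℤ)) 0 ≤ _
        split_ifs <;> omega
      have h3 : ((max (-(y.age i) - V) 0 : ℤ) : ℝ) ≤
          ((max (-(x.age i) - V : ℤ) 0 - if x.age i < -(V : ℤ) then 1 else 0 : ℤ) : ℝ) := by
        exact_mod_cast h2
      push_cast at h3
      exact h3
    have hsum : ∑ i, max (-(y.age i : ℝ) - V) 0 ≤ ∑ i, max (-(x.age i : ℝ) - V) 0 -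
        if ∃ i, x.age i < -(V : ℤ) then 1 else 0 := by
      refine (Finset.sum_le_sum fun i _ => hterm i).trans ?_
      rw [Finset.sum_sub_distrib]
      gcongr
      split_ifs with h
      · obtain ⟨i, hi⟩ := h
        refine le_trans (by simp [hi]) (Finset.single_le_sum
          (f := fun i => if x.age i < -(V : ℤ) then (1 : ℝ) else 0)
          (fun i _ => by positivity) (Finset.mem_univ i))
      · exact Finset.sum_nonneg fun i _ => by positivity
    refine (mul_le_mul_of_nonneg_left hsum k.early_nonneg).trans (le_of_eq ?_)
    split_ifs <;> ring
  have e2' := mul_le_mul_of_nonneg_left e2 k.excess_nonneg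
  have e4' := mul_le_mul_of_nonneg_left e4 k.bias_nonneg
  have e5' := mul_le_mul_of_nonneg_left e5 k.mem_nonneg
  unfold lyapunov
  linarith

/-- A switch is paid by the credits, up to a constant. -/
lemma lyapunov_switch_le (ha0 : 0 < a) (ha1 : a < 1) (hρ0 : ∀ i, 0 ≤ ρ i) {ε : ℝ}
    (hM : ∀ w : Fin N → ℕ, ε * total w ≤ maxWeight net w)
    (hbias : 4 * k.lin * net.Ts ≤ ε * k.bias) (hmem : k.lin * net.Ts ≤ k.mem)
    (x : ChainState net) (hc : SwitchCond net a x.waits x.sched x.mem) {J : net.Sched}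
    (hJ : ∀ J' : net.Sched, weight J'.1 x.waits ≤ weight J.1 x.waits) :
    lyapunov a ρ V k ⟨x.age, J, net.Ts, x.waits⟩ ≤ lyapunov a ρ V k x +
      net.Ts * (k.lin * (N * net.Ts) + k.fixed) := by
  set y : ChainState net := ⟨x.age, J, net.Ts, x.waits⟩ with hy
  have hyw : y.waits = x.waits := rfl
  set w := x.waits with hw
  have hs := total_nonneg w
  have hg0 := gain_pos (a := a) (total w)
  have hg1 := one_le_gain (a := a) (total w)
  have hGm := gain_pos (a := a) (total x.mem)
  have hTs : (1 : ℝ) ≤ net.Ts := by exact_mod_cast net.Ts_pos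
  have hJM : weight J.1 w = maxWeight net w :=
    le_antisymm (weight_le_maxWeight J w) (Finset.sup'_le _ _ fun I hI => hJ ⟨I, hI⟩)
  have hyexc : ∀ i, excess y i = 0 := fun i => by
    refine max_eq_right ?_
    change (w i : ℝ) - 2 * total w ≤ 0
    have : (w i : ℝ) ≤ total w :=
      Finset.single_le_sum (f := fun i => (w i : ℝ)) (fun _ _ => by positivity) (Finset.mem_univ i)
    linarith
  have hpay : k.lin * net.Ts * total w ≤
      k.bias * ((maxWeight net w - weight x.sched.1 w) * gain a (total w)) +
      k.mem * max (total x.mem - total w) 0 := by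
    have hδ := sub_nonneg.2 (weight_le_maxWeight x.sched w)
    have hMw := hM w
    have hM0 := maxWeight_nonneg (net := net) w
    have hb := k.bias_nonneg
    have hm := k.mem_nonneg
    have hl := k.lin_nonneg
    have hmax : 0 ≤ max (total x.mem - total w) 0 := le_max_right _ _
    unfold SwitchCond at hc
    rw [G_eq] at hc
    change _ ≤ maxWeight net w at hc
    -- it suffices that the first credit is at least a quarter of the largest weight
    have key : maxWeight net w ≤ 4 * ((maxWeight net w - weight x.sched.1 w) * gain a (total w)) →
        k.lin * net.Ts * total w ≤
        k.bias * ((maxWeight net w - weight x.sched.1 w) * gain a (total w)) +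
        k.mem * max (total x.mem - total w) 0 := by
      intro h
      have h1 : 4 * k.lin * net.Ts * total w ≤ k.bias * maxWeight net w := by
        calc 4 * k.lin * net.Ts * total w ≤ ε * k.bias * total w := by gcongr
          _ = k.bias * (ε * total w) := by ring
          _ ≤ _ := by gcongr
      have h2 := mul_le_mul_of_nonneg_left h hb
      have h3 := mul_nonneg hm hmax
      linarith
    rcases le_total (weight x.sched.1 w) (maxWeight net w / 2) with h | h
    · refine key ?_
      have : maxWeight net w / 2 ≤ maxWeight net w - weight x.sched.1 w := by linarith
      nlinarith
    rcases le_total (total x.mem) (2 * total w) with h' | h'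
    · refine key ?_
      have h2 := gain_two_mul_le ha0 ha1 hs (total_nonneg x.mem) h'
      have h3 : net.Ts / gain a (total x.mem) * weight x.sched.1 w ≤
          maxWeight net w - weight x.sched.1 w := by linarith
      have h4 : weight x.sched.1 w ≤
          (maxWeight net w - weight x.sched.1 w) * gain a (total x.mem) := by
        rw [div_mul_eq_mul_div, div_le_iff₀ hGm] at h3
        nlinarith [weight_nonneg x.sched.1 w]
      nlinarith
    · have h2 : total w ≤ max (total x.mem - total w) 0 := le_max_of_le_left (by linarith)
      have h3 : k.lin * net.Ts * total w ≤ k.mem * max (total x.mem - total w) 0 := by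
        calc k.lin * net.Ts * total w ≤ k.mem * total w := by gcongr
          _ ≤ _ := by gcongr
      have h4 : 0 ≤ k.bias * ((maxWeight net w - weight x.sched.1 w) * gain a (total w)) := by
        positivity
      linarith
  have hexc : 0 ≤ k.excess * ∑ i ∈ x.sched.1, ρ i * excess x i ^ 2 :=
    mul_nonneg k.excess_nonneg (Finset.sum_nonneg fun i _ => mul_nonneg (hρ0 i) (by positivity))
  have hrem : 0 ≤ (x.rem : ℝ) * (k.lin * (total w + N * x.rem) + k.fixed) := by
    have := k.lin_nonneg
    have := k.fixed_nonneg
    positivity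
  unfold lyapunov
  simp only [hyexc, hyw]
  change _ + _ * _ + (net.Ts : ℝ) * (k.lin * (total w + N * net.Ts) + k.fixed) +
    k.bias * ((maxWeight net w - weight J.1 w) * _) + k.mem * max (total w - total w) 0 + _ ≤ _
  rw [hJM]
  simp only [sub_self, zero_mul, mul_zero, max_self, add_zero, ne_eq, OfNat.ofNat_ne_zero,
    not_false_eq_true, zero_pow, Finset.sum_const_zero]
  linarith

/-- In ACTIVE mode without a switch, the weight that is lost against the best schedule is
compensated, either by the slack or by the decrease of the excess over the memory. -/
lemma active_drift_le (ha0 : 0 < a) {ε B : ℝ} (hε : 0 < ε)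
    (hB : ∀ s, 0 ≤ s → 2 * net.Ts * s ≤ (ε / 2 * s + B) * gain a (s / 3)) (hB0 : 0 ≤ B)
    (hM : ∀ w : Fin N → ℕ, ∑ i, (w i : ℝ) * ρ i + ε * total w ≤ maxWeight net w)
    (hρ : ∀ i, ρ i ≤ 1 - ε) (hexc : 3 * net.Ts ≤ ε * k.excess)
    (x : ChainState net) (hc : ¬ SwitchCond net a x.waits x.sched x.mem) :
    ∑ i, 2 * (x.waits i : ℝ) * (ρ i - if i ∈ x.sched.1 then 1 else 0) +
      k.excess * ∑ i ∈ x.sched.1, 2 * excess x i * (ρ i - 1) ≤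
      -(2 * ε) * total x.waits + ε / 2 * total x.waits + N * B := by
  set w := x.waits with hw
  have hGm := gain_pos (a := a) (total x.mem)
  have hG1 := one_le_gain (a := a) (total x.mem)
  have hTs : (1 : ℝ) ≤ net.Ts := by exact_mod_cast net.Ts_pos
  unfold SwitchCond at hc
  rw [G_eq, not_le] at hc
  change maxWeight net w < _ at hc
  have h1 : ∑ i, 2 * (w i : ℝ) * (ρ i - if i ∈ x.sched.1 then 1 else 0) =
      2 * ∑ i, (w i : ℝ) * ρ i - 2 * weight x.sched.1 w := by
    rw [weight, ← Finset.sum_filter_add_sum_filter_not Finset.univ (· ∈ x.sched.1),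
      ← Finset.sum_filter_add_sum_filter_not Finset.univ (· ∈ x.sched.1) fun i => (w i : ℝ) * ρ i]
    rw [Finset.filter_mem_eq_inter, Finset.univ_inter, mul_add, Finset.mul_sum, Finset.mul_sum,
      Finset.mul_sum, add_sub_right_comm, ← Finset.sum_sub_distrib]
    congr 1
    · exact Finset.sum_congr rfl fun i hi => by rw [if_pos hi]; ring
    · exact Finset.sum_congr rfl fun i hi => by rw [if_neg (Finset.mem_filter.1 hi).2]; ring
  have h2 : 2 * (maxWeight net w - weight x.sched.1 w) +
      k.excess * ∑ i ∈ x.sched.1, 2 * excess x i * (ρ i - 1) ≤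
      ∑ i ∈ x.sched.1, (ε / 2 * (w i : ℝ) + B) := by
    have h3 : 2 * (maxWeight net w - weight x.sched.1 w) ≤
        ∑ i ∈ x.sched.1, 2 * net.Ts / gain a (total x.mem) * (w i : ℝ) := by
      rw [← Finset.mul_sum]
      change _ ≤ _ * weight x.sched.1 w
      have : 2 * net.Ts / gain a (total x.mem) * weight x.sched.1 w =
        2 * (net.Ts / gain a (total x.mem) * weight x.sched.1 w) := by ring
      rw [this]
      linarith
    refine (add_le_add_left h3 _).trans ?_
    rw [Finset.mul_sum, ← Finset.sum_add_distrib]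
    refine Finset.sum_le_sum fun i _ => ?_
    have hwi : (0 : ℝ) ≤ w i := by positivity
    have he := excess_nonneg x i
    have h4 : k.excess * (2 * excess x i * (ρ i - 1)) ≤ -(6 * net.Ts) * excess x i := by
      have : k.excess * (ρ i - 1) ≤ -(3 * net.Ts) := by
        nlinarith [hρ i, k.excess_nonneg]
      nlinarith
    rcases le_total (w i : ℝ) (3 * total x.mem) with h | h
    · have h5 : gain a ((w i : ℝ) / 3) ≤ gain a (total x.mem) :=
        gain_mono ha0 (by positivity) (by linarith)
      have h6 : 2 * net.Ts / gain a (total x.mem) * (w i : ℝ) ≤ ε / 2 * (w i : ℝ) + B := by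
        rw [div_mul_eq_mul_div, div_le_iff₀ hGm]
        refine (hB _ hwi).trans ?_
        gcongr
      nlinarith
    · have h5 : (w i : ℝ) / 3 ≤ excess x i := le_max_of_le_left (by linarith)
      have h6 : 2 * net.Ts / gain a (total x.mem) * (w i : ℝ) ≤ 2 * net.Ts * (w i : ℝ) := by
        gcongr
        exact div_le_self (by positivity) hG1
      have h7 : 0 ≤ ε / 2 * (w i : ℝ) + B := by positivity
      nlinarith
  have h3 : ∑ i ∈ x.sched.1, (ε / 2 * (w i : ℝ) + B) ≤ ε / 2 * total w + N * B := by
    calc ∑ i ∈ x.sched.1, (ε / 2 * (w i : ℝ) + B) ≤ ∑ i, (ε / 2 * (w i : ℝ) + B) :=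
          Finset.sum_le_sum_of_subset_of_nonneg (Finset.subset_univ _) fun _ _ _ => by positivity
      _ = _ := by rw [Finset.sum_add_distrib, ← Finset.mul_sum]; simp [total]
  have h4 := hM w
  linarith

end Lyapunov

/-! ### The drift of the chain -/

section Drift

variable {N : ℕ} {net : Network N} (svc : ServiceLaw N) (arr : ArrivalLaw N)

/-- The sum of the inter-arrival times behind the jobs of queue `i` that the offered service could
complete in one slot. -/
def offeredTime (I : net.Sched) (r : ℕ) (i : Fin N) (ω : Sample N) : ℝ :=
  ((∑ l ∈ Finset.range (offered I r (ω.2 0) i), ω.1 i l : ℕ) : ℝ)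

lemma measurable_offeredTime (I : net.Sched) (r : ℕ) (i : Fin N) :
    Measurable (offeredTime I r i) := by
  have h1 : Measurable fun q : ℕ × (ℕ → ℕ) => ∑ l ∈ Finset.range q.1, q.2 l :=
    measurable_from_prod_countable_right fun n =>
      Finset.measurable_sum (Finset.range n) fun l _ => measurable_pi_apply l
  have h2 : Measurable fun ω : Sample N => (offered I r (ω.2 0) i, ω.1 i) :=
    ((measurable_offered I r i).comp ((measurable_pi_apply 0).comp measurable_snd)).prodMk
      ((measurable_pi_apply i).comp measurable_fst)
  have h3 : Measurable fun ω : Sample N =>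
      ∑ l ∈ Finset.range (offered I r (ω.2 0) i), ω.1 i l := h1.comp h2
  have h4 : Measurable fun n : ℕ => (n : ℝ) := Measurable.of_discrete
  exact h4.comp h3

lemma integrable_offeredTime (I : net.Sched) (r : ℕ) (i : Fin N) :
    Integrable (offeredTime I r i) (prob svc arr) := by
  refine Integrable.of_bound (C := ((svc.Smax * arr.Vmax : ℕ) : ℝ))
    (measurable_offeredTime I r i).aestronglyMeasurable ?_
  filter_upwards [ae_bounded svc arr] with ω hω
  rw [offeredTime, Real.norm_natCast]
  exact Nat.cast_le.2 (sum_range_le_mul (hω.1 i) (offered_le (hω.2 0) i))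

lemma integral_offeredTime (I : net.Sched) (r : ℕ) (i : Fin N) :
    ∫ ω, offeredTime I r i ω ∂(prob svc arr) =
      if r = 0 ∧ i ∈ I.1 then svc.mean i * arr.mean i else 0 := by
  have hV : ∀ l, MeasurePreserving (fun V : Fin N → ℕ → ℕ => V i l)
      (Measure.pi fun i => Measure.infinitePi fun _ : ℕ => (arr.law i).toMeasure)
      (arr.law i).toMeasure := fun l =>
    (measurePreserving_eval_infinitePi (fun _ : ℕ => (arr.law i).toMeasure) l).comp
      (measurePreserving_eval (fun i => Measure.infinitePi fun _ : ℕ => (arr.law i).toMeasure) i)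
  have hVint : ∀ l, Integrable (fun V : Fin N → ℕ → ℕ => (V i l : ℝ))
      (Measure.pi fun i => Measure.infinitePi fun _ : ℕ => (arr.law i).toMeasure) := fun l =>
    (hV l).integrable_comp_of_integrable (arr.integrable i)
  have hmean : ∀ l, ∫ V : Fin N → ℕ → ℕ, (V i l : ℝ)
      ∂(Measure.pi fun i => Measure.infinitePi fun _ : ℕ => (arr.law i).toMeasure) = arr.mean i :=
    fun l => by
      rw [ArrivalLaw.mean, ← (hV l).map_eq, integral_map (hV l).measurable.aemeasurable
        Measurable.of_discrete.aestronglyMeasurable]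
  have hint := integrable_offeredTime svc arr I r i
  rw [prob] at hint ⊢
  rw [integral_prod_symm _ hint]
  have hinner : ∀ S : ℕ → Fin N → ℕ, ∫ V : Fin N → ℕ → ℕ, offeredTime I r i (V, S)
      ∂(Measure.pi fun i => Measure.infinitePi fun _ : ℕ => (arr.law i).toMeasure) =
      (offered I r (S 0) i : ℝ) * arr.mean i := by
    intro S
    simp only [offeredTime, Nat.cast_sum]
    rw [integral_finsetSum _ fun l _ => hVint l]
    simp [hmean]
  simp only [hinner]
  rw [integral_mul_const]
  by_cases h : r = 0 ∧ i ∈ I.1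
  · simp only [offered, h, and_self, if_true]
    congr 1
    have h0 := measurePreserving_eval_infinitePi (fun _ : ℕ => svc.law.toMeasure) 0
    have h1 := integral_map (μ := Measure.infinitePi fun _ : ℕ => svc.law.toMeasure)
      h0.measurable.aemeasurable (f := fun s : Fin N → ℕ => (s i : ℝ))
      Measurable.of_discrete.aestronglyMeasurable
    rw [h0.map_eq] at h1
    exact h1.symm
  · simp [offered, h]

variable {a : ℝ} {k : Coeffs}

/-- The one-slot drift in terms of the state after the decision. -/
lemma expStep_lyapunov_le (ha0 : 0 < a) (ha1 : a < 1) (hmean : ∀ i, 0 < svc.mean i)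
    (hρ1 : ∀ i, load svc arr i ≤ 1) (d : Rule net) (x : ChainState net) {K D : ℝ}
    (hK : K = (svc.Smax * arr.Vmax : ℕ) + 1) (hD : D = 2 * (N * K)) :
    ∃ R : ℝ, 0 ≤ R ∧
      expStep (transition svc arr d)
        (fun y => ENNReal.ofReal (lyapunov a (load svc arr) arr.Vmax k y)) x ≤ ENNReal.ofReal R ∧
      R = lyapunov a (load svc arr) arr.Vmax k (decided d x) +
      ∑ i, 2 * ((decided d x).waits i : ℝ) * (load svc arr i -
        if (decided d x).rem = 0 ∧ i ∈ (decided d x).sched.1 then 1 else 0) +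
      k.excess * ∑ i ∈ (decided d x).sched.1, 2 * excess (decided d x) i * (load svc arr i -
        if (decided d x).rem = 0 ∧ i ∈ (decided d x).sched.1 then 1 else 0) -
      (if (decided d x).rem = 0 then 0 else
        k.lin * (total (decided d x).waits + N * (decided d x).rem) + k.fixed) +
      k.bias * (2 * D * gain a (total (decided d x).waits + D)) + k.mem * D -
      (if ∃ i, (decided d x).age i < -(arr.Vmax : ℤ) then k.early else 0) +
      (1 + k.excess) * (N * (5 * K ^ 2)) := by
  set y := decided d x with hy
  have hρ0 : ∀ i, 0 ≤ load svc arr i := fun i =>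
    inv_nonneg.2 (mul_pos (arr.mean_pos i) (hmean i)).le
  set Δ : Fin N → Sample N → ℝ := fun i ω => 1 - offeredTime y.sched y.rem i ω with hΔ
  have hΔint : ∀ i, Integrable (Δ i) (prob svc arr) := fun i =>
    (integrable_const _).sub (integrable_offeredTime svc arr _ _ i)
  have hΔmean : ∀ i, load svc arr i * ∫ ω, Δ i ω ∂(prob svc arr) = load svc arr i -
      if y.rem = 0 ∧ i ∈ y.sched.1 then 1 else 0 := by
    intro i
    rw [integral_sub (integrable_const _) (integrable_offeredTime svc arr _ _ i),
      integral_offeredTime]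
    have h1 := arr.mean_pos i
    have h2 := hmean i
    simp only [integral_const, probReal_univ, smul_eq_mul, mul_one]
    split_ifs
    · rw [load]; field_simp
    · ring
  set c₁ : ℝ := lyapunov a (load svc arr) arr.Vmax k y with hc₁
  set c₂ : ℝ := - (if y.rem = 0 then 0 else k.lin * (total y.waits + N * y.rem) + k.fixed) +
      k.bias * (2 * D * gain a (total y.waits + D)) + k.mem * D -
      (if ∃ i, y.age i < -(arr.Vmax : ℤ) then k.early else 0) +
      (1 + k.excess) * (N * (5 * K ^ 2)) with hc₂
  set F : Sample N → ℝ := fun ω => c₁ + c₂ + ∑ i, load svc arr i * (2 * y.waits i * Δ i ω) +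
    k.excess * ∑ i ∈ y.sched.1, load svc arr i * (2 * excess y i * Δ i ω) with hF
  have hi1 : Integrable (fun ω => ∑ i, load svc arr i * (2 * y.waits i * Δ i ω)) (prob svc arr) :=
    integrable_finsetSum _ fun i _ => ((hΔint i).const_mul _).const_mul _
  have hi2 : Integrable (fun ω => k.excess * ∑ i ∈ y.sched.1,
      load svc arr i * (2 * excess y i * Δ i ω)) (prob svc arr) :=
    (integrable_finsetSum _ fun i _ => ((hΔint i).const_mul _).const_mul _).const_mul _
  have hi0 : Integrable (fun _ : Sample N => c₁ + c₂) (prob svc arr) := integrable_const _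
  have hFint : Integrable F (prob svc arr) := (hi0.add hi1).add hi2
  have hle : ∀ᵐ ω ∂(prob svc arr),
      lyapunov a (load svc arr) arr.Vmax k (chainStep d x ω.1 (ω.2 0)) ≤ F ω := by
    filter_upwards [ae_bounded svc arr] with ω hω
    have := lyapunov_evolve_le (k := k) ha0 ha1 hρ0 hρ1 hω.1 (hω.2 0) y hK hD
    rw [chainStep_eq_evolve]
    refine this.trans (le_of_eq ?_)
    simp only [hF, hc₁, hc₂, hΔ, offeredTime]
    ring
  have hF0 : 0 ≤ᵐ[prob svc arr] F := by
    filter_upwards [hle] with ω hω using (lyapunov_nonneg hρ0 _).trans hω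
  refine ⟨∫ ω, F ω ∂(prob svc arr), integral_nonneg_of_ae hF0, ?_, ?_⟩
  · rw [expStep_transition, ofReal_integral_eq_lintegral_ofReal hFint hF0]
    refine lintegral_mono_ae ?_
    filter_upwards [hle] with ω hω using ENNReal.ofReal_le_ofReal hω
  · have e1 : ∫ ω, F ω ∂(prob svc arr) = ∫ _, (c₁ + c₂) ∂(prob svc arr) +
        ∫ ω, ∑ i, load svc arr i * (2 * y.waits i * Δ i ω) ∂(prob svc arr) +
        ∫ ω, k.excess * ∑ i ∈ y.sched.1, load svc arr i * (2 * excess y i * Δ i ω)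
          ∂(prob svc arr) :=
      (integral_add (hi0.add hi1) hi2).trans (congrArg (· + _) (integral_add hi0 hi1))
    rw [e1, integral_const, probReal_univ,
      one_smul, integral_const_mul, 
      integral_finsetSum _ fun i _ => ((hΔint i).const_mul _).const_mul _,
      integral_finsetSum _ fun i _ => ((hΔint i).const_mul _).const_mul _]
    simp only [integral_const_mul]
    have h1 : ∀ i, load svc arr i * (2 * (y.waits i : ℝ) * ∫ ω, Δ i ω ∂(prob svc arr)) =
        2 * (y.waits i : ℝ) * (load svc arr i - if y.rem = 0 ∧ i ∈ y.sched.1 then 1 else 0) :=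
      fun i => by rw [← hΔmean i]; ring
    have h2 : ∀ i, load svc arr i * (2 * excess y i * ∫ ω, Δ i ω ∂(prob svc arr)) =
        2 * excess y i * (load svc arr i - if y.rem = 0 ∧ i ∈ y.sched.1 then 1 else 0) :=
      fun i => by rw [← hΔmean i]; ring
    simp only [h1, h2]
    rw [hc₂]
    ring

/-- The states in which the drift may be nonnegative: no job is far ahead, the waiting times are
small, and either no switch is in progress or a new switch is about to start. -/
def core (d : Rule net) (V : ℕ) (C : ℝ) : Set (ChainState net) :=
  {x | (∀ i, -(V : ℤ) ≤ x.age i) ∧ total x.waits ≤ C ∧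
    (x.rem = 0 ∨ d x.waits x.sched x.rem x.mem ≠ none)}

/-- The drift after the decision, in terms of the conditions that make the coefficients dominate
each other. -/
lemma drift_after_decision {d : Rule net} (ha0 : 0 < a) (ha1 : a < 1) (hd : IsWBMW net a d)
    (hmean : ∀ i, 0 < svc.mean i) {ε B₁ B₂ K D : ℝ} (hε : 0 < ε)
    (hM : ∀ w : Fin N → ℕ, ∑ i, (w i : ℝ) * load svc arr i + ε * total w ≤ maxWeight net w)
    (hρε : ∀ i, load svc arr i ≤ 1 - ε) (hB₁0 : 0 ≤ B₁)
    (hB₁ : ∀ s, 0 ≤ s → 2 * net.Ts * s ≤ (ε / 2 * s + B₁) * gain a (s / 3))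
    (hgain : ∀ s, 0 ≤ s → k.bias * (2 * D * gain a (s + D)) ≤ ε / 2 * s + B₂)
    (hexc : 3 * net.Ts ≤ ε * k.excess) (hlin : k.lin = 2 + 2 * k.excess + 2 * ε)
    (hK : K = (svc.Smax * arr.Vmax : ℕ) + 1) (hD : D = 2 * (N * K)) (x : ChainState net) :
    ∃ R : ℝ, 0 ≤ R ∧
      expStep (transition svc arr d)
        (fun y => ENNReal.ofReal (lyapunov a (load svc arr) arr.Vmax k y)) x ≤ ENNReal.ofReal R ∧
      R ≤ lyapunov a (load svc arr) arr.Vmax k (decided d x) - ε * total x.waits +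
        (N * B₁ + B₂ + k.mem * D + (1 + k.excess) * (N * (5 * K ^ 2))) -
        (if (decided d x).rem = 0 then 0 else k.fixed) -
        (if ∃ i, x.age i < -(arr.Vmax : ℤ) then k.early else 0) := by
  have hρ0 : ∀ i, 0 ≤ load svc arr i := fun i =>
    inv_nonneg.2 (mul_pos (arr.mean_pos i) (hmean i)).le
  have hρ1 : ∀ i, load svc arr i ≤ 1 := fun i => by linarith [hρε i]
  obtain ⟨R, hR0, hRle, hR⟩ := expStep_lyapunov_le svc arr (k := k) ha0 ha1 hmean hρ1 d x hK hD
  refine ⟨R, hR0, hRle, ?_⟩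
  set y := decided d x with hy
  have hyw : y.waits = x.waits := rfl
  have hya : y.age = x.age := rfl
  have hs := total_nonneg x.waits
  have hg := hgain _ hs
  rw [hyw, hya] at hR
  generalize lyapunov a (load svc arr) arr.Vmax k y = L at hR ⊢
  by_cases hr : y.rem = 0
  · -- No switch was started, and the switching condition fails.
    have hnone : d x.waits x.sched x.rem x.mem = none := by
      by_contra hcon
      obtain ⟨J, hJ⟩ := Option.ne_none_iff_exists'.1 hcon
      have : y.rem = net.Ts := by rw [hy, decided_of_some hJ]
      have := net.Ts_pos
      omega
    have hyx : y = x := decided_of_none hnone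
    rw [hyx] at hr hR ⊢
    have hc : ¬ SwitchCond net a x.waits x.sched x.mem := by
      intro hc
      rw [hr] at hnone
      exact hd.switch_if _ _ _ hc hnone
    have hact := active_drift_le (k := k) ha0 hε hB₁ hB₁0 hM hρε hexc x hc
    have h2 : ∀ i ∈ x.sched.1, 2 * excess x i * (load svc arr i -
        if True ∧ i ∈ x.sched.1 then 1 else 0) = 2 * excess x i * (load svc arr i - 1) :=
      fun i hi => by simp [hi]
    simp only [hr, if_true] at hR ⊢
    rw [Finset.sum_congr rfl h2] at hR
    simp only [true_and] at hR
    linarith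
  · simp only [hr, if_false, false_and, sub_zero] at hR ⊢
    have h1 : ∑ i, 2 * (x.waits i : ℝ) * load svc arr i ≤ 2 * total x.waits := by
      rw [total, Finset.mul_sum]
      exact Finset.sum_le_sum fun i _ => mul_le_of_le_one_right (by positivity) (hρ1 i)
    have h2 : ∑ i ∈ y.sched.1, 2 * excess y i * load svc arr i ≤ 2 * total x.waits := by
      calc ∑ i ∈ y.sched.1, 2 * excess y i * load svc arr i
          ≤ ∑ i, 2 * excess y i * load svc arr i :=
            Finset.sum_le_sum_of_subset_of_nonneg (Finset.subset_univ _) fun i _ _ =>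
              mul_nonneg (mul_nonneg two_pos.le (excess_nonneg y i)) (hρ0 i)
        _ ≤ ∑ i, 2 * (x.waits i : ℝ) := Finset.sum_le_sum fun i _ => by
            have h3 := excess_le y i
            have h4 := excess_nonneg y i
            rw [hyw] at h3
            nlinarith [hρ0 i, hρ1 i]
        _ = _ := by rw [total, Finset.mul_sum]
    have h2' := mul_le_mul_of_nonneg_left h2 k.excess_nonneg
    have h3 : 0 ≤ k.lin * (N * (y.rem : ℝ)) := by have := k.lin_nonneg; positivity
    have h4 : 0 ≤ N * B₁ := by positivity
    have h5 : k.lin * (total x.waits + N * y.rem) = 2 * total x.waits +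
        k.excess * (2 * total x.waits) + 2 * (ε * total x.waits) + k.lin * (N * y.rem) := by
      rw [mul_add, hlin]; ring
    have h6 : 0 ≤ ε * total x.waits := mul_nonneg hε.le hs
    linarith

/-- **Foster's drift condition.** For rates in the interior of the capacity region, some function
of the state decreases in mean by `ε` times the total waiting time, up to a constant, and by at
least `1` outside the core. -/
theorem exists_drift {d : Rule net} (ha0 : 0 < a) (ha1 : a < 1) (hd : IsWBMW net a d)
    (hrate : arr.rate ∈ interior (capacityRegion net svc)) :
    ∃ (Φ : ChainState net → ℝ) (ε b C : ℝ), 0 < ε ∧ 0 ≤ b ∧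
      (∀ x, x.rem = 0 → x.mem = 0 → (∀ i, -(arr.Vmax : ℤ) ≤ x.age i ∧ x.age i ≤ 0) → Φ x = 0) ∧
      (∀ x, expStep (transition svc arr d) (fun y => ENNReal.ofReal (Φ y)) x +
        ENNReal.ofReal (ε * total x.waits) ≤ ENNReal.ofReal (Φ x) + ENNReal.ofReal b) ∧
      ∀ x ∉ core d arr.Vmax C,
        expStep (transition svc arr d) (fun y => ENNReal.ofReal (Φ y)) x + 1 ≤
          ENNReal.ofReal (Φ x) := by
  obtain ⟨ε, hε, hmean, q, hq0, hq1, hq⟩ := exists_slack svc arr hrate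
  have hρ0 : ∀ i, 0 ≤ load svc arr i := fun i =>
    inv_nonneg.2 (mul_pos (arr.mean_pos i) (hmean i)).le
  have hM := sum_load_le_maxWeight hq0 hq1 hq
  have hρε := load_le_one_sub hq0 hq1 hq
  have hεM : ∀ w : Fin N → ℕ, ε * total w ≤ maxWeight net w := fun w => by
    have : 0 ≤ ∑ i, (w i : ℝ) * load svc arr i :=
      Finset.sum_nonneg fun i _ => mul_nonneg (by positivity) (hρ0 i)
    linarith [hM w]
  obtain ⟨K, hK⟩ : ∃ K : ℝ, K = (svc.Smax * arr.Vmax : ℕ) + 1 := ⟨_, rfl⟩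
  obtain ⟨D, hD⟩ : ∃ D : ℝ, D = 2 * (N * K) := ⟨_, rfl⟩
  have hK0 : 0 ≤ K := by rw [hK]; positivity
  have hD0 : 0 ≤ D := by rw [hD]; positivity
  -- The coefficients are chosen one after the other; each one dominates effects of earlier ones.
  obtain ⟨exc, hexc⟩ : ∃ c : ℝ, c = 3 * net.Ts / ε := ⟨_, rfl⟩
  have hexc0 : 0 ≤ exc := by rw [hexc]; positivity
  obtain ⟨lin, hlin⟩ : ∃ c : ℝ, c = 2 + 2 * exc + 2 * ε := ⟨_, rfl⟩
  have hlin0 : 0 ≤ lin := by rw [hlin]; positivity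
  obtain ⟨bias, hbias⟩ : ∃ c : ℝ, c = 4 * lin * net.Ts / ε := ⟨_, rfl⟩
  have hbias0 : 0 ≤ bias := by rw [hbias]; positivity
  obtain ⟨B₁, hB₁0, hB₁⟩ :=
    exists_mul_le_gain ha0 (half_pos hε) (show (0 : ℝ) ≤ 2 * net.Ts by positivity)
  obtain ⟨B₂, hB₂0, hgain⟩ : ∃ B₂ : ℝ, 0 ≤ B₂ ∧ ∀ s, 0 ≤ s →
      bias * (2 * D * gain a (s + D)) ≤ ε / 2 * s + B₂ := by
    have hc : 0 ≤ bias * (2 * D) := by positivity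
    obtain ⟨B, hB0, hB⟩ := exists_gain_le ha0 ha1
      (show 0 < ε / 2 / (bias * (2 * D) + 1) by positivity)
    refine ⟨ε / 2 * D + bias * (2 * D) * B, by positivity, fun s hs => ?_⟩
    have h1 : bias * (2 * D) * (ε / 2 / (bias * (2 * D) + 1)) ≤ ε / 2 := by
      rw [mul_div_assoc', div_le_iff₀ (by positivity)]
      nlinarith
    calc bias * (2 * D * gain a (s + D)) = bias * (2 * D) * gain a (s + D) := by ring
      _ ≤ bias * (2 * D) * (ε / 2 / (bias * (2 * D) + 1) * (s + D) + B) := by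
        gcongr; exact hB _ (by positivity)
      _ = bias * (2 * D) * (ε / 2 / (bias * (2 * D) + 1)) * (s + D) + bias * (2 * D) * B := by ring
      _ ≤ ε / 2 * (s + D) + bias * (2 * D) * B := by gcongr
      _ = _ := by ring
  obtain ⟨b₁, hb₁⟩ : ∃ c : ℝ, c = N * B₁ + B₂ + lin * net.Ts * D +
    (1 + exc) * (N * (5 * K ^ 2)) := ⟨_, rfl⟩
  have hb₁0 : 0 ≤ b₁ := by rw [hb₁]; positivity
  obtain ⟨c₁, hc₁⟩ : ∃ c : ℝ, c = net.Ts * (lin * (N * net.Ts) + (b₁ + 1)) := ⟨_, rfl⟩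
  have hc₁0 : 0 ≤ c₁ := by rw [hc₁]; positivity
  obtain ⟨k, hk1, hk2, hk3, hk4, hk5, hk6⟩ : ∃ k : Coeffs, k.excess = exc ∧ k.lin = lin ∧
      k.fixed = b₁ + 1 ∧ k.bias = bias ∧ k.mem = lin * net.Ts ∧ k.early = b₁ + c₁ + 1 :=
    ⟨⟨exc, lin, b₁ + 1, bias, lin * net.Ts, b₁ + c₁ + 1, hexc0, hlin0, by positivity, hbias0,
      by positivity, by positivity⟩, rfl, rfl, rfl, rfl, rfl, rfl⟩
  have hΦ0 := lyapunov_nonneg (net := net) (a := a) (V := arr.Vmax) (k := k) hρ0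
  have hpost := drift_after_decision svc arr (k := k) ha0 ha1 hd hmean hε hM hρε hB₁0 hB₁
    (by rwa [hk4]) (by rw [hk1, hexc, mul_div_cancel₀ _ hε.ne']) (by rw [hk2, hk1, hlin]) hK hD
  rw [hk5, hk1, ← hb₁, hk3, hk6] at hpost
  have hpre : ∀ x : ChainState net, lyapunov a (load svc arr) arr.Vmax k (decided d x) ≤
      lyapunov a (load svc arr) arr.Vmax k x +
        if d x.waits x.sched x.rem x.mem = none then 0 else c₁ := by
    intro x
    by_cases hn : d x.waits x.sched x.rem x.mem = none
    · rw [decided_of_none hn, if_pos hn, add_zero]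
    · rw [if_neg hn]
      obtain ⟨J, hJ⟩ := Option.ne_none_iff_exists'.1 hn
      rw [decided_of_some hJ, hc₁, ← hk2, ← hk3]
      obtain ⟨hc, hJmax⟩ := hd.switch_only _ _ _ _ _ hJ
      refine lyapunov_switch_le (k := k) ha0 ha1 hρ0 hεM ?_ ?_ x hc hJmax
      · rw [hk2, hk4, hbias, mul_div_cancel₀ _ hε.ne']
      · rw [hk2, hk5]
  refine ⟨lyapunov a (load svc arr) arr.Vmax k, ε, b₁ + c₁, (b₁ + c₁ + 1) / ε, hε, by positivity,
    ?_, ?_, ?_⟩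
  · intro x hr hm hage
    have hw : x.waits = 0 := by
      funext i
      have := (hage i).2
      simp only [ChainState.waits, Pi.zero_apply]
      omega
    have ht : total (0 : Fin N → ℕ) = 0 := by simp [total]
    have hwt : ∀ I, weight I (0 : Fin N → ℕ) = 0 := fun I => by simp [weight]
    have hmax : maxWeight net (0 : Fin N → ℕ) = 0 := by
      simp [maxWeight, hwt]
    have he : ∀ i, excess x i = 0 := fun i => by simp [excess, hw, hm, ht]
    have ha : ∀ i, max (-(x.age i : ℝ) - arr.Vmax) 0 = 0 := fun i => by
      refine max_eq_right ?_
      have : -(arr.Vmax : ℝ) ≤ x.age i := by exact_mod_cast (hage i).1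
      linarith
    simp [lyapunov, hw, hm, hr, ht, hwt, hmax, he, ha]
  · intro x
    obtain ⟨R, hR0, hRle, hR⟩ := hpost x
    have h1 := hpre x
    have h2 : R + ε * total x.waits ≤ lyapunov a (load svc arr) arr.Vmax k x + (b₁ + c₁) := by
      split_ifs at hR h1 <;> linarith
    have h3 : 0 ≤ ε * total x.waits := mul_nonneg hε.le (total_nonneg _)
    calc _ ≤ ENNReal.ofReal R + ENNReal.ofReal (ε * total x.waits) := by gcongr
      _ = ENNReal.ofReal (R + ε * total x.waits) := (ENNReal.ofReal_add hR0 h3).symm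
      _ ≤ ENNReal.ofReal (lyapunov a (load svc arr) arr.Vmax k x + (b₁ + c₁)) :=
        ENNReal.ofReal_le_ofReal h2
      _ = _ := ENNReal.ofReal_add (hΦ0 x) (by positivity)
  · intro x hx
    obtain ⟨R, hR0, hRle, hR⟩ := hpost x
    have h1 := hpre x
    have h3 : 0 ≤ ε * total x.waits := mul_nonneg hε.le (total_nonneg _)
    have h2 : R + 1 ≤ lyapunov a (load svc arr) arr.Vmax k x := by
      by_cases hneg : ∃ i, x.age i < -(arr.Vmax : ℤ)
      · rw [if_pos hneg] at hR
        split_ifs at hR h1 <;> linarith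
      by_cases hbig : total x.waits ≤ (b₁ + c₁ + 1) / ε
      · have hcore : x.rem ≠ 0 ∧ d x.waits x.sched x.rem x.mem = none := by
          by_contra hcon
          refine hx ⟨fun i => not_lt.1 fun hi => hneg ⟨i, hi⟩, hbig, ?_⟩
          by_contra! h
          exact hcon h
        rw [decided_of_none hcore.2, if_neg hcore.1, if_neg hneg] at hR
        linarith
      · have h4 : b₁ + c₁ + 1 < ε * total x.waits := by
          rw [not_le, div_lt_iff₀ hε] at hbig
          linarith
        split_ifs at hR h1 <;> linarith
    calc _ ≤ ENNReal.ofReal R + ENNReal.ofReal 1 := by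
          rw [ENNReal.ofReal_one]; gcongr
      _ = ENNReal.ofReal (R + 1) := (ENNReal.ofReal_add hR0 one_pos.le).symm
      _ ≤ _ := ENNReal.ofReal_le_ofReal h2

end Drift

/-! ### Composition of trials -/

section Trials

variable {X : Type*} {p : X → X → ℝ≥0∞}

/-- A visit to a set from which the target is hit with probability `q` turns into a visit to the
target. -/
lemma survival_add_le (hp : ∀ x, ∑' y, p x y = 1) {A B : Set X} {m : ℕ} {q : ℝ≥0∞} (hq1 : q ≤ 1)
    (hB : ∀ y ∈ B, survival p A m y ≤ 1 - q) (n : ℕ) (x : X) :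
    survival p A (n + m) x ≤ (1 - q) + q * survival p B n x := by
  by_cases hxB : x ∈ B
  · exact (survival_antitone hp A x (Nat.le_add_left m n)).trans
      ((hB x hxB).trans le_self_add)
  induction n generalizing x with
  | zero =>
    rw [survival_zero_of_notMem hxB, mul_one, tsub_add_cancel_of_le hq1]
    exact survival_le_one hp A _ x
  | succ n ih =>
    by_cases hxA : x ∈ A
    · simp [survival_of_mem hxA]
    rw [add_right_comm, survival_succ_of_notMem hxA, survival_succ_of_notMem hxB,
      ← expStep_const_mul, ← expStep_const hp (1 - q) x, ← expStep_add]
    refine expStep_mono x fun y _ => ?_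
    by_cases hyB : y ∈ B
    · exact (survival_antitone hp A y (Nat.le_add_left m n)).trans ((hB y hyB).trans le_self_add)
    · exact ih y hyB

lemma survival_add_le_of_le (hp : ∀ x, ∑' y, p x y = 1) {A B : Set X} {n m : ℕ} {q r : ℝ≥0∞}
    (hq1 : q ≤ 1) (hr1 : r ≤ 1) (hB : ∀ y ∈ B, survival p A m y ≤ 1 - q) {x : X}
    (hx : survival p B n x ≤ 1 - r) : survival p A (n + m) x ≤ 1 - q * r := by
  refine (survival_add_le hp hq1 hB n x).trans ?_
  have hqt : q ≠ ⊤ := ne_top_of_le_ne_top ENNReal.one_ne_top hq1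
  have hrt : r ≠ ⊤ := ne_top_of_le_ne_top ENNReal.one_ne_top hr1
  refine ENNReal.le_sub_of_add_le_right (ENNReal.mul_ne_top hqt hrt) ?_
  calc 1 - q + q * survival p B n x + q * r ≤ 1 - q + q * (1 - r) + q * r := by gcongr
    _ = 1 - q + q * (1 - r + r) := by ring
    _ = 1 := by rw [tsub_add_cancel_of_le hr1, mul_one, tsub_add_cancel_of_le hq1]

lemma survival_succ_le_of_le (hp : ∀ x, ∑' y, p x y = 1) {A : Set X} {n : ℕ} {q : ℝ≥0∞}
    (hq1 : q ≤ 1) {x y : X} (hy : survival p A n y ≤ 1 - q) :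
    survival p A (n + 1) x ≤ 1 - p x y * q := by
  by_cases hxA : x ∈ A
  · simp [survival_of_mem hxA]
  have hpxy : p x y ≤ 1 := (ENNReal.le_tsum y).trans_eq (hp x)
  have hpt : p x y * q ≠ ⊤ := ne_top_of_le_ne_top ENNReal.one_ne_top (mul_le_one' hpxy hq1)
  rw [survival_succ_of_notMem hxA]
  refine ENNReal.le_sub_of_add_le_right hpt ?_
  classical
  have h1 : p x y * q = expStep p (fun z => if z = y then q else 0) x := by
    unfold expStep
    rw [tsum_eq_single y fun z hz => by simp [hz]]
    simp
  rw [h1, ← expStep_add]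
  refine (expStep_mono x fun z _ => ?_).trans_eq (expStep_const hp 1 x)
  split_ifs with hz
  · subst hz
    calc survival p A n z + q ≤ 1 - q + q := by gcongr
      _ = 1 := tsub_add_cancel_of_le hq1
  · simpa using survival_le_one hp A n z

lemma eventually_inv_le {q : ℝ≥0∞} (hq : q ≠ 0) :
    ∀ᶠ k : ℕ in atTop, ((k : ℝ≥0∞) + 1)⁻¹ ≤ q := by
  obtain ⟨n, hn⟩ := ENNReal.exists_inv_nat_lt hq
  filter_upwards [eventually_ge_atTop n] with k hk
  refine le_trans (ENNReal.inv_le_inv.2 ?_) hn.le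
  exact (Nat.cast_le.2 hk).trans le_self_add

lemma inv_succ_le_one (k : ℕ) : ((k : ℝ≥0∞) + 1)⁻¹ ≤ 1 := ENNReal.inv_le_one.2 le_add_self

lemma inv_succ_ne_zero (k : ℕ) : ((k : ℝ≥0∞) + 1)⁻¹ ≠ 0 :=
  ENNReal.inv_ne_zero.2 (ENNReal.add_ne_top.2 ⟨ENNReal.natCast_ne_top k, ENNReal.one_ne_top⟩)

end Trials

/-! ### Frozen states and positive recurrence -/

section Frozen

variable {N : ℕ} {net : Network N}

/-- The rule that never switches. -/
def stay : Rule net := fun _ _ _ _ => none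

/-- A bijection of the memory vectors, as a bijection of the states. -/
def memEquiv (τ : Equiv.Perm (Fin N → ℕ)) : ChainState net ≃ ChainState net where
  toFun x := ⟨x.age, x.sched, x.rem, τ x.mem⟩
  invFun x := ⟨x.age, x.sched, x.rem, τ.symm x.mem⟩
  left_inv x := by simp
  right_inv x := by simp

lemma memEquiv_symm_apply (τ : Equiv.Perm (Fin N → ℕ)) (x : ChainState net) :
    memEquiv τ.symm (memEquiv τ x) = x := by
  simp [memEquiv]

/-- The current schedule has the largest weight, and this weight is positive. -/
def IsOptimal (x : ChainState net) : Prop :=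
  0 < maxWeight net x.waits ∧ maxWeight net x.waits ≤ weight x.sched.1 x.waits

/-- The states with bounded entries; the ages lie between `-V` and `K`. -/
def box (net : Network N) (V K : ℕ) : Set (ChainState net) :=
  {x | (∀ i, -(V : ℤ) ≤ x.age i ∧ x.age i ≤ K) ∧ x.rem ≤ K ∧ ∀ i, x.mem i ≤ K}

lemma finite_box (V K : ℕ) : (box net V K).Finite := by
  refine Set.Finite.of_finite_image (f := ChainState.equivProd net) ?_
    (ChainState.equivProd net).injective.injOn
  refine Set.Finite.subset ((Set.finite_Icc (fun _ : Fin N => -(V : ℤ)) fun _ => (K : ℤ)).prod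
    ((Set.finite_univ (α := net.Sched)).prod
      ((Set.finite_Iic K).prod (Set.finite_Iic fun _ : Fin N => K)))) ?_
  rintro _ ⟨x, ⟨h1, h2, h3⟩, rfl⟩
  exact ⟨⟨fun i => (h1 i).1, fun i => (h1 i).2⟩, trivial, h2, h3⟩

lemma box_mono (V : ℕ) {K L : ℕ} (h : K ≤ L) : box net V K ⊆ box net V L :=
  fun _ hx => ⟨fun i => ⟨(hx.1 i).1, (hx.1 i).2.trans (by exact_mod_cast h)⟩, hx.2.1.trans h,
    fun i => (hx.2.2 i).trans h⟩

variable (svc : ServiceLaw N) (arr : ArrivalLaw N)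

/-- The states in ACTIVE mode such that the current schedule stays optimal whatever happens as long
as it is kept. -/
def frozen (net : Network N) : Set (ChainState net) :=
  {x | x.rem = 0 ∧ ∀ y, Accessible (transition svc arr stay) x y → IsOptimal y}

lemma transition_congr {d d' : Rule net} {x : ChainState net}
    (h : d x.waits x.sched x.rem x.mem = d' x.waits x.sched x.rem x.mem) (y : ChainState net) :
    transition svc arr d x y = transition svc arr d' x y := by
  unfold transition
  simp only [chainStep_eq_evolve, decided, decision, h]

lemma transition_stay_memEquiv (τ : Equiv.Perm (Fin N → ℕ)) (x y : ChainState net) :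
    transition svc arr stay (memEquiv τ x) (memEquiv τ y) = transition svc arr stay x y := by
  have h : ∀ (v : Fin N → ℕ → ℕ) s,
      chainStep stay (memEquiv τ x) v s = memEquiv τ (chainStep stay x v s) := fun _ _ => rfl
  simp only [transition, h, (memEquiv τ).injective.eq_iff]

lemma accessible_stay_memEquiv (τ : Equiv.Perm (Fin N → ℕ)) {x y : ChainState net}
    (h : Accessible (transition svc arr stay) x y) :
    Accessible (transition svc arr stay) (memEquiv τ x) (memEquiv τ y) := by
  induction h with
  | refl => exact Relation.ReflTransGen.refl
  | tail _ hbc ih => exact ih.tail (by rwa [transition_stay_memEquiv])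

lemma memEquiv_mem_frozen (τ : Equiv.Perm (Fin N → ℕ)) {x : ChainState net}
    (hx : x ∈ frozen svc arr net) : memEquiv τ x ∈ frozen svc arr net := by
  refine ⟨hx.1, fun y hy => ?_⟩
  have h := accessible_stay_memEquiv svc arr τ.symm hy
  rw [memEquiv_symm_apply] at h
  have hopt := hx.2 _ h
  exact hopt

/-- A possible transition changes the ages in a controlled way. -/
lemma age_of_transition_ne_zero {d : Rule net} {x y : ChainState net}
    (h : transition svc arr d x y ≠ 0) (i : Fin N) :
    (-(arr.Vmax : ℤ) ≤ x.age i → -(arr.Vmax : ℤ) ≤ y.age i) ∧ y.age i ≤ x.age i + 1 := by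
  obtain ⟨ω, hω, rfl⟩ := exists_bounded_of_transition_ne_zero svc arr h
  rw [chainStep_age]
  have h1 := le_serve (n := offered (decision d x).1 (decision d x).2.1 (ω.2 0) i)
    (u := x.age i) (hω.1 i)
  have h2 := serve_le (offered (decision d x).1 (decision d x).2.1 (ω.2 0) i) (x.age i) (ω.1 i)
  omega

lemma eq_of_transition_ne_zero {d : Rule net} {x y : ChainState net}
    (h : transition svc arr d x y ≠ 0) :
    y.sched = (decided d x).sched ∧ y.rem = (decided d x).rem - 1 ∧ y.mem = (decided d x).mem := by
  obtain ⟨ω, -, rfl⟩ := exists_bounded_of_transition_ne_zero svc arr h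
  exact ⟨rfl, rfl, rfl⟩

variable {a : ℝ} {d : Rule net}

/-- A switch leads into a box whose size depends only on the ages. -/
lemma survival_box_of_switch {x : ChainState net} {K : ℕ}
    (hx : ∀ i, -(arr.Vmax : ℤ) ≤ x.age i ∧ x.age i ≤ K)
    (hd : d x.waits x.sched x.rem x.mem ≠ none) {n : ℕ} (hn : 0 < n) {L : ℕ}
    (hL : K + 1 + net.Ts ≤ L) :
    survival (transition svc arr d) (box net arr.Vmax L) n x = 0 := by
  obtain ⟨J, hJ⟩ := Option.ne_none_iff_exists'.1 hd
  obtain ⟨n, rfl⟩ := Nat.exists_eq_succ_of_ne_zero hn.ne'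
  by_cases hxA : x ∈ box net arr.Vmax L
  · exact survival_of_mem hxA _
  rw [survival_succ_of_notMem hxA, ← expStep_const (transition_tsum svc arr d) 0 x]
  refine expStep_congr x fun y hy => survival_of_mem ?_ _
  obtain ⟨-, h2, h3⟩ := eq_of_transition_ne_zero svc arr hy
  rw [decided_of_some hJ] at h2 h3
  refine ⟨fun i => ?_, ?_, fun i => ?_⟩
  · obtain ⟨h4, h5⟩ := age_of_transition_ne_zero svc arr hy i
    have := hx i
    exact ⟨h4 this.1, by omega⟩
  · simp only at h2; omega
  · have := hx i
    simp only [h3, ChainState.waits]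
    omega

/-- With a large memory, the switching condition holds unless the schedule is optimal. -/
lemma exists_switchCond (ha0 : 0 < a) {x : ChainState net} (hx : ¬ IsOptimal x) :
    ∃ R : ℕ, ∀ m : Fin N → ℕ, (∃ i, R < m i) → SwitchCond net a x.waits x.sched m := by
  have hw0 := weight_nonneg x.sched.1 x.waits
  have hM0 := maxWeight_nonneg (net := net) x.waits
  have hle := weight_le_maxWeight x.sched x.waits
  rcases hle.lt_or_eq with hlt | heq
  · obtain ⟨S, hS⟩ := (tendsto_atTop.1 (tendsto_rpow_atTop ha0)
      (net.Ts * weight x.sched.1 x.waits / (maxWeight net x.waits - weight x.sched.1 x.waits)))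
      |>.exists_forall_of_atTop
    obtain ⟨R, hR⟩ := exists_nat_ge S
    refine ⟨R, fun m ⟨i, hi⟩ => ?_⟩
    have hm : (m i : ℝ) ≤ total m :=
      Finset.single_le_sum (f := fun i => (m i : ℝ)) (fun _ _ => by positivity) (Finset.mem_univ i)
    have hRm : (R : ℝ) < m i := by exact_mod_cast hi
    have hg := (hS _ (hR.trans (hRm.le.trans hm))).trans (le_max_right 1 _)
    change _ ≤ gain a (total m) at hg
    have hgp := gain_pos (a := a) (total m)
    rw [div_le_iff₀ (by linarith)] at hg
    change (1 + (net.Ts : ℝ) / G a m) * weight x.sched.1 x.waits ≤ maxWeight net x.waits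
    rw [G_eq, add_mul, one_mul, div_mul_eq_mul_div, ← le_sub_iff_add_le', div_le_iff₀ hgp]
    linarith
  · have h0 : weight x.sched.1 x.waits = 0 := by
      by_contra h
      exact hx ⟨by rw [← heq]; exact lt_of_le_of_ne hw0 (Ne.symm h), heq.ge⟩
    refine ⟨0, fun m _ => ?_⟩
    change (1 + (net.Ts : ℝ) / G a m) * weight x.sched.1 x.waits ≤ maxWeight net x.waits
    rw [h0, mul_zero]
    exact hM0

lemma decision_eq_none_of_isOptimal (hd : IsWBMW net a d) {x : ChainState net}
    (hx : IsOptimal x) : d x.waits x.sched x.rem x.mem = none := by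
  by_contra h
  obtain ⟨J, hJ⟩ := Option.ne_none_iff_exists'.1 h
  have h1 := (hd.switch_only _ _ _ _ _ hJ).1
  change (1 + (net.Ts : ℝ) / G a x.mem) * weight x.sched.1 x.waits ≤ maxWeight net x.waits at h1
  have hw : weight x.sched.1 x.waits = maxWeight net x.waits :=
    le_antisymm (weight_le_maxWeight _ _) hx.2
  have hT : (0 : ℝ) < net.Ts := by exact_mod_cast net.Ts_pos
  have hg : 0 < (net.Ts : ℝ) / G a x.mem * maxWeight net x.waits :=
    mul_pos (div_pos hT (G_eq a x.mem ▸ gain_pos _)) hx.1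
  rw [hw] at h1
  linarith

lemma transition_eq_of_mem_frozen (hd : IsWBMW net a d) {x : ChainState net}
    (hx : x ∈ frozen svc arr net) (y : ChainState net) :
    transition svc arr d x y = transition svc arr stay x y :=
  transition_congr svc arr
    (decision_eq_none_of_isOptimal hd (hx.2 x Relation.ReflTransGen.refl)) y

/-- The frozen set is closed, and on it the chain keeps the schedule and the memory. -/
lemma frozen_closed (hd : IsWBMW net a d) {x y : ChainState net} (hx : x ∈ frozen svc arr net)
    (hy : transition svc arr d x y ≠ 0) :
    y ∈ frozen svc arr net ∧ y.sched = x.sched ∧ y.mem = x.mem := by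
  obtain ⟨h1, h2, h3⟩ := eq_of_transition_ne_zero svc arr hy
  rw [decided_of_none (decision_eq_none_of_isOptimal hd (hx.2 x Relation.ReflTransGen.refl))]
    at h1 h2 h3
  refine ⟨⟨by simp [h2, hx.1], fun z hz => hx.2 z (Relation.ReflTransGen.head ?_ hz)⟩, h1, h3⟩
  rwa [← transition_eq_of_mem_frozen svc arr hd hx]

lemma transition_memEquiv_of_mem_frozen (hd : IsWBMW net a d) (τ : Equiv.Perm (Fin N → ℕ))
    {x : ChainState net} (hx : x ∈ frozen svc arr net) (y : ChainState net) :
    transition svc arr d (memEquiv τ x) (memEquiv τ y) = transition svc arr d x y := by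
  rw [transition_eq_of_mem_frozen svc arr hd hx,
    transition_eq_of_mem_frozen svc arr hd (memEquiv_mem_frozen svc arr τ hx),
    transition_stay_memEquiv]

/-- From an ACTIVE state that is not frozen, the chain reaches a bounded set with a probability and
in a time that do not depend on the memory: with a large memory, a switch resets the memory as soon
as the schedule is not optimal. -/
lemma eventually_survival_box_le (ha0 : 0 < a) (hd : IsWBMW net a d) {x : ChainState net}
    (hage : ∀ i, -(arr.Vmax : ℤ) ≤ x.age i) (hr : x.rem = 0) (hx : x ∉ frozen svc arr net) :
    ∀ᶠ k : ℕ in atTop, ∀ τ, survival (transition svc arr d) (box net arr.Vmax k) k (memEquiv τ x) ≤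
      1 - ((k : ℝ≥0∞) + 1)⁻¹ := by
  obtain ⟨y, hxy, hy⟩ : ∃ y, Accessible (transition svc arr stay) x y ∧ ¬ IsOptimal y := by
    by_contra! hcon
    exact hx ⟨hr, hcon⟩
  have hp := transition_tsum svc arr d
  have hlim : ∀ x : ChainState net, ∃ K : ℕ, ∀ i, x.age i ≤ K := fun x => by
    refine ⟨∑ i, (x.age i).toNat, fun i => ?_⟩
    have := Finset.single_le_sum (f := fun i => (x.age i).toNat) (fun _ _ => Nat.zero_le _)
      (Finset.mem_univ i)
    omega
  clear hx
  suffices h : ∃ (q : ℝ≥0∞) (n : ℕ), q ≠ 0 ∧ q ≤ 1 ∧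
      ∀ τ, survival (transition svc arr d) (box net arr.Vmax n) n (memEquiv τ x) ≤ 1 - q by
    obtain ⟨q, n, hq, hq1, h⟩ := h
    filter_upwards [eventually_ge_atTop n, eventually_inv_le hq] with k hk hkq τ
    calc _ ≤ survival (transition svc arr d) (box net arr.Vmax n) k (memEquiv τ x) :=
          survival_anti_set (box_mono _ hk) _ _
      _ ≤ survival (transition svc arr d) (box net arr.Vmax n) n (memEquiv τ x) :=
          survival_antitone hp _ _ hk
      _ ≤ 1 - q := h τ
      _ ≤ _ := tsub_le_tsub_left hkq _
  induction hxy using Relation.ReflTransGen.head_induction_on with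
  | refl =>
    obtain ⟨R, hR⟩ := exists_switchCond ha0 hy
    obtain ⟨K, hK⟩ := hlim y
    refine ⟨1, K + 1 + net.Ts + R, one_ne_zero, le_rfl, fun τ => ?_⟩
    rw [tsub_self, nonpos_iff_eq_zero]
    by_cases hm : ∃ i, R < (memEquiv τ y).mem i
    · refine survival_box_of_switch svc arr (x := memEquiv τ y) (K := K)
        (fun i => ⟨hage i, hK i⟩) ?_ (by omega) (by omega)
      have := hd.switch_if _ _ _ (hR _ hm)
      rw [← hr] at this
      exact this
    · push Not at hm
      have hbox : memEquiv τ y ∈ box net arr.Vmax (K + 1 + net.Ts + R) :=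
        ⟨fun i => ⟨hage i, (hK i).trans (by push_cast; omega)⟩, hr.trans_le (Nat.zero_le _),
          fun i => (hm i).trans (by omega)⟩
      exact survival_of_mem hbox _
  | @head x z hxz _ ih =>
    obtain ⟨-, h2, -⟩ := eq_of_transition_ne_zero svc arr hxz
    rw [decided_of_none rfl, hr] at h2
    obtain ⟨q, n, hq, hq1, h⟩ :=
      ih (fun i => (age_of_transition_ne_zero svc arr hxz i).1 (hage i)) h2
    obtain ⟨K, hK⟩ := hlim x
    have hle1 : transition svc arr stay x z ≤ 1 :=
      (ENNReal.le_tsum z).trans_eq (transition_tsum svc arr stay x)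
    refine ⟨transition svc arr stay x z * q, n + (K + 1 + net.Ts) + 1, mul_ne_zero hxz hq,
      mul_le_one' hle1 hq1, fun τ => ?_⟩
    by_cases hn : d (memEquiv τ x).waits (memEquiv τ x).sched (memEquiv τ x).rem
        (memEquiv τ x).mem = none
    · rw [← transition_stay_memEquiv svc arr τ,
        ← transition_congr svc arr (d := d) (d' := stay) (x := memEquiv τ x) hn]
      refine survival_succ_le_of_le hp hq1 ?_
      calc _ ≤ survival (transition svc arr d) (box net arr.Vmax n) (n + (K + 1 + net.Ts))
            (memEquiv τ z) := survival_anti_set (box_mono _ (by omega)) _ _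
        _ ≤ survival (transition svc arr d) (box net arr.Vmax n) n (memEquiv τ z) :=
            survival_antitone hp _ _ (by omega)
        _ ≤ 1 - q := h τ
    · rw [survival_box_of_switch svc arr (x := memEquiv τ x) (K := K)
        (fun i => ⟨hage i, hK i⟩) hn (by omega) (by omega)]
      exact zero_le

lemma age_le_of_mem_core {V : ℕ} {C : ℝ} {x : ChainState net} (hx : x ∈ core d V C) (i : Fin N) :
    -(V : ℤ) ≤ x.age i ∧ x.age i ≤ ⌈C⌉₊ := by
  refine ⟨hx.1 i, ?_⟩
  have h1 : ((x.age i).toNat : ℝ) ≤ total x.waits :=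
    Finset.single_le_sum (f := fun i => (x.waits i : ℝ)) (fun _ _ => by positivity)
      (Finset.mem_univ i)
  have h2 : ((x.age i).toNat : ℝ) ≤ (⌈C⌉₊ : ℕ) := h1.trans (hx.2.1.trans (Nat.le_ceil C))
  have h3 : (x.age i).toNat ≤ ⌈C⌉₊ := by exact_mod_cast h2
  omega

/-- Each state arises from the one with memory `0` by a bijection of the memories. -/
lemma exists_erased (x : ChainState net) :
    ∃ τ, x = memEquiv τ (⟨x.age, x.sched, x.rem, 0⟩ : ChainState net) :=
  ⟨Equiv.swap 0 x.mem, by simp [memEquiv]⟩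

/-- Uniformity over the ACTIVE core states: a property that holds eventually for all memories holds
eventually on the core, since the ages in the core are bounded. -/
lemma eventually_forall_core {V : ℕ} {C : ℝ} {S : Set (ChainState net)}
    {P : ℕ → ChainState net → Prop} (hS : ∀ τ x, memEquiv τ x ∈ S → x ∈ S)
    (h : ∀ x ∈ S, (∀ i, -(V : ℤ) ≤ x.age i) → x.rem = 0 → ∀ᶠ k in atTop, ∀ τ, P k (memEquiv τ x)) :
    ∀ᶠ k in atTop, ∀ x ∈ core d V C, x.rem = 0 → x ∈ S → P k x := by
  have hfin : (box net V ⌈C⌉₊ ∩ S ∩ {x | x.rem = 0}).Finite :=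
    ((finite_box V _).inter_of_left _).inter_of_left _
  have h1 := (eventually_all_finite hfin (l := atTop)
    (p := fun x k => ∀ τ, P k (memEquiv τ x))).2 fun x hx =>
      h x hx.1.2 (fun i => (hx.1.1.1 i).1) hx.2
  filter_upwards [h1] with k hk x hx hr hxS
  obtain ⟨τ, hτ⟩ := exists_erased x
  have hbox : (⟨x.age, x.sched, x.rem, 0⟩ : ChainState net) ∈ box net V ⌈C⌉₊ :=
    ⟨fun i => age_le_of_mem_core hx i, hr.trans_le (Nat.zero_le _), fun i => Nat.zero_le _⟩
  rw [hτ] at hxS ⊢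
  exact hk _ ⟨⟨hbox, hS τ _ hxS⟩, hr⟩ τ

/-- The W-BMW chain is positive recurrent for all rates in the interior of the capacity region. -/
theorem positiveRecurrent (ha0 : 0 < a) (ha1 : a < 1) (hd : IsWBMW net a d)
    (hrate : arr.rate ∈ interior (capacityRegion net svc)) :
    PositiveRecurrent (transition svc arr d) := by
  obtain ⟨Φ, ε, b, C, hε, hb, -, hall, hout⟩ := exists_drift svc arr ha0 ha1 hd hrate
  set p := transition svc arr d with hpdef
  have hp : ∀ x, ∑' y, p x y = 1 := transition_tsum svc arr d
  have hall' : ∀ x, expStep p (fun y => ENNReal.ofReal (Φ y)) x ≤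
      ENNReal.ofReal (Φ x) + ENNReal.ofReal b := fun x => le_self_add.trans (hall x)
  have hfreeze : ∀ x ∈ frozen svc arr net, ∀ y, p x y ≠ 0 → y ∈ frozen svc arr net :=
    fun x hx y hy => (frozen_closed svc arr hd hx hy).1
  -- A set that is hit from the core by trials is hit in a time that is bounded by `Φ`.
  have htrials : ∀ (A : Set (ChainState net)) (T : ℕ) (q : ℝ≥0∞), 0 < T → q ≠ 0 → q ≤ 1 →
      (∀ x ∈ core d arr.Vmax C, survival p A T x ≤ 1 - q) → ∃ c : ℝ≥0∞, c ≠ ⊤ ∧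
        ∀ x, expectedHitting p A x ≤ ENNReal.ofReal (Φ x) + c := fun A T q hT hq hq1 h =>
    ⟨T * (1 + ENNReal.ofReal b) / q, (ENNReal.div_lt_top (ENNReal.mul_ne_top
        (ENNReal.natCast_ne_top T)
        (ENNReal.add_ne_top.2 ⟨ENNReal.one_ne_top, ENNReal.ofReal_ne_top⟩)) hq).ne,
      expectedHitting_le_of_trials hT hq hq1 hp (fun x _ hx => hout x hx) (fun x _ => hall' x) h⟩
  -- Such a bound is finite and stays finite after one more step.
  have hfinite : ∀ (A : Set (ChainState net)) (c : ℝ≥0∞), c ≠ ⊤ →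
      (∀ x, expectedHitting p A x ≤ ENNReal.ofReal (Φ x) + c) →
      ∀ x, expectedHitting p A x < ⊤ ∧ expStep p (expectedHitting p A) x < ⊤ := by
    refine fun A c hc h x => ⟨(h x).trans_lt ?_, ?_⟩
    · exact ENNReal.add_lt_top.2 ⟨ENNReal.ofReal_lt_top, hc.lt_top⟩
    · calc expStep p (expectedHitting p A) x
          ≤ expStep p (fun y => ENNReal.ofReal (Φ y) + c) x := expStep_mono x fun y _ => h y
        _ = expStep p (fun y => ENNReal.ofReal (Φ y)) x + c := by
            rw [expStep_add, expStep_const hp]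
        _ ≤ ENNReal.ofReal (Φ x) + ENNReal.ofReal b + c := by gcongr; exact hall' x
        _ < ⊤ := ENNReal.add_lt_top.2 ⟨ENNReal.add_lt_top.2
            ⟨ENNReal.ofReal_lt_top, ENNReal.ofReal_lt_top⟩, hc.lt_top⟩
  -- From the core outside the frozen set, a box is hit uniformly.
  have hbox : ∀ᶠ k : ℕ in atTop, ∀ x ∈ core d arr.Vmax C, x ∉ frozen svc arr net →
      survival p (box net arr.Vmax k) k x ≤ 1 - ((k : ℝ≥0∞) + 1)⁻¹ := by
    have h1 := eventually_forall_core (d := d) (V := arr.Vmax) (C := C)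
      (S := (frozen svc arr net)ᶜ)
      (P := fun k x => survival p (box net arr.Vmax k) k x ≤ 1 - ((k : ℝ≥0∞) + 1)⁻¹)
      (fun τ x hx h => hx (memEquiv_mem_frozen svc arr τ h))
      fun x hx hage hr => eventually_survival_box_le svc arr ha0 hd hage hr hx
    filter_upwards [h1, eventually_ge_atTop (⌈C⌉₊ + 1 + net.Ts)] with k hk hkC x hx hxf
    rcases hx.2.2 with hr | hn
    · exact hk x hx hr hxf
    · rw [hpdef, survival_box_of_switch svc arr (K := ⌈C⌉₊) (age_le_of_mem_core hx) hn
        (by omega) (by omega)]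
      exact zero_le
  obtain ⟨k₁, hk₁, hk₁0⟩ := (hbox.and (eventually_gt_atTop 0)).exists
  -- A positive recurrent state is accessible from each state.
  have hfrozen : ∀ x ∈ frozen svc arr net, ∃ y, PosRecState p y ∧ Accessible p x y := by
    intro x hx
    obtain ⟨c, hc, hbd⟩ := htrials (core d arr.Vmax C) 1 1 one_pos one_ne_zero le_rfl
      fun y hy => by simp [survival_of_mem hy]
    set Y : Set (ChainState net) :=
      {y | y ∈ frozen svc arr net ∧ y.sched = x.sched ∧ y.mem = x.mem} with hY
    have hYcl : ∀ z ∈ Y, ∀ y, p z y ≠ 0 → y ∈ Y := fun z hz y hy => by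
      obtain ⟨h1, h2, h3⟩ := frozen_closed svc arr hd hz.1 hy
      exact ⟨h1, h2.trans hz.2.1, h3.trans hz.2.2⟩
    have heq : ∀ z ∈ Y, expectedHitting p (core d arr.Vmax C ∩ Y) z =
        expectedHitting p (core d arr.Vmax C) z := fun z hz =>
      tsum_congr fun n => survival_congr_closed hYcl (fun w hw => by simp [hw]) n hz
    refine exists_accessible_posRecState hp (F := core d arr.Vmax C ∩ Y) (Y := Y) ?_ hYcl ?_ ?_
      ⟨hx, rfl, rfl⟩
    · refine (finite_box arr.Vmax (⌈C⌉₊ + ∑ i, x.mem i)).subset ?_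
      rintro z ⟨hz, hzY⟩
      refine ⟨fun i => ?_, by rw [hzY.1.1]; exact Nat.zero_le _, fun i => ?_⟩
      · have := age_le_of_mem_core hz i
        exact ⟨this.1, this.2.trans (by push_cast; exact le_add_of_nonneg_right (by positivity))⟩
      · rw [hzY.2.2]
        exact (Finset.single_le_sum (f := fun i => x.mem i) (fun _ _ => Nat.zero_le _)
          (Finset.mem_univ i)).trans (Nat.le_add_left _ _)
    · intro z hz
      rw [heq z hz]
      exact (hfinite _ c hc hbd z).1
    · intro z _ hz
      rw [expStep_congr z fun y hy => heq y (hYcl z hz y hy)]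
      exact (hfinite _ c hc hbd z).2
  have hacc : ∀ x, ∃ y, PosRecState p y ∧ Accessible p x y := by
    intro x
    by_cases hx : ∃ y ∈ frozen svc arr net, Accessible p x y
    · obtain ⟨y, hy, hxy⟩ := hx
      obtain ⟨z, hz, hyz⟩ := hfrozen y hy
      exact ⟨z, hz, hxy.trans hyz⟩
    push Not at hx
    obtain ⟨c, hc, hbd⟩ := htrials (box net arr.Vmax k₁ ∪ frozen svc arr net) k₁ _ hk₁0
      (inv_succ_ne_zero k₁) (inv_succ_le_one k₁) fun y hy => by
        by_cases hyf : y ∈ frozen svc arr net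
        · rw [survival_of_mem (Set.mem_union_right _ hyf)]; exact zero_le
        · exact (survival_anti_set Set.subset_union_left _ _).trans (hk₁ y hy hyf)
    have hYcl : ∀ z ∈ {y | Accessible p x y}, ∀ y, p z y ≠ 0 → y ∈ {y | Accessible p x y} :=
      fun z hz y hy => hz.tail hy
    have heq : ∀ z ∈ {y | Accessible p x y}, expectedHitting p (box net arr.Vmax k₁) z =
        expectedHitting p (box net arr.Vmax k₁ ∪ frozen svc arr net) z := fun z hz =>
      tsum_congr fun n => survival_congr_closed hYcl
        (fun w hw => ⟨Or.inl, fun h => h.resolve_right fun hf => hx w hf hw⟩) n hz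
    refine exists_accessible_posRecState hp (finite_box arr.Vmax k₁) hYcl ?_ ?_
      Relation.ReflTransGen.refl
    · intro z hz
      rw [heq z hz]
      exact (hfinite _ c hc hbd z).1
    · intro z _ hz
      rw [expStep_congr z fun y hy => heq y (hYcl z hz y hy)]
      exact (hfinite _ c hc hbd z).2
  -- The positive recurrent states are hit uniformly from the core.
  have hlt : ∀ x, ∃ n, survival p {y | PosRecState p y} n x < 1 := fun x => by
    obtain ⟨y, hy, hxy⟩ := hacc x
    exact exists_survival_lt_one hp hxy hy
  have hpos : ∀ᶠ k : ℕ in atTop, ∀ x ∈ core d arr.Vmax C, x.rem = 0 → x ∈ frozen svc arr net →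
      survival p {y | PosRecState p y} k x ≤ 1 - ((k : ℝ≥0∞) + 1)⁻¹ := by
    refine eventually_forall_core (P := fun k x =>
      survival p {y | PosRecState p y} k x ≤ 1 - ((k : ℝ≥0∞) + 1)⁻¹)
      (fun τ x hx => by
        simpa only [memEquiv_symm_apply] using memEquiv_mem_frozen svc arr τ.symm hx)
      fun x hx _ _ => ?_
    obtain ⟨n, hn⟩ := hlt x
    filter_upwards [eventually_ge_atTop n, eventually_inv_le (tsub_pos_iff_lt.2 hn).ne'] with
      k hk hkq τ
    rw [survival_equiv (memEquiv τ) hfreeze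
      (fun z hz y => transition_memEquiv_of_mem_frozen svc arr hd τ hz y)
      (fun z hz => posRecState_equiv (memEquiv τ) hfreeze
        (fun z hz y => transition_memEquiv_of_mem_frozen svc arr hd τ hz y) hz) k hx]
    calc survival p {y | PosRecState p y} k x ≤ survival p {y | PosRecState p y} n x :=
          survival_antitone hp _ _ hk
      _ = 1 - (1 - survival p {y | PosRecState p y} n x) :=
          (ENNReal.sub_sub_cancel ENNReal.one_ne_top hn.le).symm
      _ ≤ _ := tsub_le_tsub_left hkq _
  obtain ⟨k₂, hk₂⟩ := hpos.exists
  obtain ⟨T, hT, q, hq, hq1, hbox'⟩ := exists_uniform_trial hp (finite_box (net := net) arr.Vmax k₁)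
    fun x _ => hlt x
  -- A frozen core state succeeds within `k₂` steps, and any other one within `k₁ + T` steps, by
  -- way of the box.
  obtain ⟨c, hc, hbd⟩ := htrials {y | PosRecState p y} (k₂ + (k₁ + T))
    (((k₂ : ℝ≥0∞) + 1)⁻¹ * (q * ((k₁ : ℝ≥0∞) + 1)⁻¹)) (by omega)
    (mul_ne_zero (inv_succ_ne_zero _) (mul_ne_zero hq (inv_succ_ne_zero _)))
    (mul_le_one' (inv_succ_le_one _) (mul_le_one' hq1 (inv_succ_le_one _))) fun x hx => by
      by_cases hxf : x ∈ frozen svc arr net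
      · refine (survival_antitone hp _ x (Nat.le_add_right k₂ _)).trans
          ((hk₂ x hx hxf.1 hxf).trans (tsub_le_tsub_left ?_ _))
        exact mul_le_of_le_one_right' (mul_le_one' hq1 (inv_succ_le_one _))
      · refine (survival_antitone hp _ x (Nat.le_add_left (k₁ + T) _)).trans
          ((survival_add_le_of_le hp hq1 (inv_succ_le_one k₁) hbox' (hk₁ x hx hxf)).trans
            (tsub_le_tsub_left ?_ _))
        exact mul_le_of_le_one_left' (inv_succ_le_one _)
  exact fun x => (hfinite _ c hc hbd x).1

end Frozen

/-! ### Strong stability -/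

section Stability

variable {N : ℕ} {net : Network N} (svc : ServiceLaw N) (arr : ArrivalLaw N)

/-- The Markov property in integrated form: given the state in slot `t`, the future sample has the
law of a fresh sample. -/
lemma lintegral_path_future (d : Rule net) (I₀ : net.Sched) (t : ℕ)
    {F : ChainState net → Sample N → ℝ≥0∞} (hF : ∀ x, Measurable (F x)) :
    ∫⁻ ω, F (path d I₀ ω t).1 (future d I₀ t ω) ∂(prob svc arr) =
      ∫⁻ ω, ∫⁻ ω', F (path d I₀ ω t).1 ω' ∂(prob svc arr) ∂(prob svc arr) := by
  set E : ChainState net → Set (Sample N) := fun x => {ω | (path d I₀ ω t).1 = x} with hEdef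
  have hE : ∀ x, MeasurableSet (E x) := fun x =>
    (measurable_fst.comp (measurable_path d I₀ t)) (measurableSet_singleton x)
  have hU : ⋃ x, E x = Set.univ := by
    ext ω
    simp [hEdef]
  have hdisj : Pairwise (Function.onFun Disjoint E) := fun x y hxy =>
    Set.disjoint_left.2 fun ω hx hy => hxy (hx.symm.trans hy)
  rw [← setLIntegral_univ, ← setLIntegral_univ (fun ω => ∫⁻ ω', F (path d I₀ ω t).1 ω' ∂_), ← hU,
    lintegral_iUnion hE hdisj, lintegral_iUnion hE hdisj]
  refine tsum_congr fun x => ?_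
  rw [setLIntegral_congr_fun (g := fun ω => F x (future d I₀ t ω)) (hE x) fun ω hω => by
      simp only [show (path d I₀ ω t).1 = x from hω],
    setLIntegral_congr_fun (f := fun ω => ∫⁻ ω', F (path d I₀ ω t).1 ω' ∂_)
      (g := fun _ => ∫⁻ ω', F x ω' ∂(prob svc arr)) (hE x) fun ω hω => by
      simp only [show (path d I₀ ω t).1 = x from hω],
    setLIntegral_const, lintegral_future svc arr d I₀ t (hE x) _ (hF x), mul_comm]
  intro ω ω' h hω
  change (path d I₀ ω' t).1 = x
  rw [h t le_rfl]
  exact hω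

lemma lintegral_path_succ (d : Rule net) (I₀ : net.Sched) (t : ℕ) (f : ChainState net → ℝ≥0∞) :
    ∫⁻ ω, f (path d I₀ ω (t + 1)).1 ∂(prob svc arr) =
      ∫⁻ ω, expStep (transition svc arr d) f (path d I₀ ω t).1 ∂(prob svc arr) := by
  simp only [path_succ_fst, expStep_transition]
  exact lintegral_path_future svc arr d I₀ t (F := fun x ω => f (chainStep d x ω.1 (ω.2 0)))
    fun x => Measurable.of_discrete.comp (measurable_chainStep d x)

/-- The waiting time controls the expected queue length. -/
lemma lintegral_queue_le (d : Rule net) (I₀ : net.Sched) (t : ℕ) (i : Fin N) :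
    ∫⁻ ω, ((run (d.toPolicy I₀) ω t).queue i : ℝ≥0∞) ∂(prob svc arr) ≤
      (ENNReal.ofReal (arr.mean i))⁻¹ *
        (∫⁻ ω, ENNReal.ofReal (total (path d I₀ ω t).1.waits) ∂(prob svc arr) + arr.Vmax) := by
  have h1 : ∫⁻ ω, ((run (d.toPolicy I₀) ω t).queue i : ℝ≥0∞) ∂(prob svc arr) =
      ∫⁻ ω, renewalCount ((path d I₀ ω t).1.waits i) ((future d I₀ t ω).1 i) ∂(prob svc arr) :=
    lintegral_congr_ae <| by
      filter_upwards [ae_regular svc arr] with ω hω using queue_eq_renewalCount d I₀ hω t i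
  have hmeas : Measurable fun ω : Sample N => ω.1 i := (measurable_pi_apply i).comp measurable_fst
  have hm0 : ENNReal.ofReal (arr.mean i) ≠ 0 := by simpa using arr.mean_pos i
  rw [h1, lintegral_path_future svc arr d I₀ t (F := fun x ω => renewalCount (x.waits i) (ω.1 i))
    fun x => (measurable_renewalCount _).comp hmeas, ← ENNReal.mul_le_iff_le_inv hm0
    ENNReal.ofReal_ne_top, ← lintegral_const_mul' _ _ ENNReal.ofReal_ne_top]
  calc _ ≤ ∫⁻ ω, (ENNReal.ofReal (total (path d I₀ ω t).1.waits) + arr.Vmax) ∂(prob svc arr) := by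
        refine lintegral_mono fun ω => ?_
        have h2 := mean_mul_lintegral_renewalCount_le (arr.ae_le i) ((path d I₀ ω t).1.waits i)
        rw [arr.lintegral_eq, ← (measurePreserving_arrivals svc arr i).lintegral_comp
          (measurable_renewalCount _)] at h2
        refine h2.trans ?_
        gcongr
        rw [← ENNReal.ofReal_natCast]
        exact ENNReal.ofReal_le_ofReal (Finset.single_le_sum
          (f := fun i => ((path d I₀ ω t).1.waits i : ℝ)) (fun _ _ => by positivity)
          (Finset.mem_univ i))
    _ = _ := by
        rw [lintegral_add_right _ measurable_const, lintegral_const, measure_univ, mul_one]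

/-- Summing the drift inequality over the slots bounds the time averages of the expected waiting
times, and hence those of the queue lengths. -/
theorem stronglyStable {a : ℝ} {d : Rule net} (ha0 : 0 < a) (ha1 : a < 1) (hd : IsWBMW net a d)
    (I₀ : net.Sched) (hrate : arr.rate ∈ interior (capacityRegion net svc)) :
    StronglyStable svc arr (d.toPolicy I₀) := by
  obtain ⟨Φ, ε, b, C, hε, hb, hzero, hall, -⟩ := exists_drift svc arr ha0 ha1 hd hrate
  set w : ℕ → ℝ≥0∞ := fun t =>
    ∫⁻ ω, ENNReal.ofReal (total (path d I₀ ω t).1.waits) ∂(prob svc arr) with hw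
  set u : ℕ → ℝ≥0∞ := fun t => ∫⁻ ω, ENNReal.ofReal (Φ (path d I₀ ω t).1) ∂(prob svc arr) with hu
  have hε0 : ENNReal.ofReal ε ≠ 0 := by simpa using hε
  have hmeas : ∀ (f : ChainState net → ℝ≥0∞) t, Measurable fun ω => f (path d I₀ ω t).1 :=
    fun f t => Measurable.of_discrete.comp (measurable_fst.comp (measurable_path d I₀ t))
  have hu0 : u 0 = 0 := by
    rw [hu, lintegral_eq_zero_iff (hmeas (fun x => ENNReal.ofReal (Φ x)) 0)]
    filter_upwards [ae_bounded svc arr] with ω hω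
    have := hzero (path d I₀ ω 0).1 rfl rfl fun i => by
      have := hω.1 i 0
      change -(arr.Vmax : ℤ) ≤ -(ω.1 i 0 : ℤ) ∧ -(ω.1 i 0 : ℤ) ≤ 0
      omega
    simp [this]
  have hstep : ∀ t, u (t + 1) + ENNReal.ofReal ε * w t ≤ u t + ENNReal.ofReal b := by
    intro t
    have h1 : u (t + 1) = ∫⁻ ω, expStep (transition svc arr d) (fun y => ENNReal.ofReal (Φ y))
        (path d I₀ ω t).1 ∂(prob svc arr) :=
      lintegral_path_succ svc arr d I₀ t fun y => ENNReal.ofReal (Φ y)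
    rw [h1, hw, ← lintegral_const_mul' _ _ ENNReal.ofReal_ne_top,
      ← lintegral_add_left (hmeas _ t)]
    calc _ ≤ ∫⁻ ω, (ENNReal.ofReal (Φ (path d I₀ ω t).1) + ENNReal.ofReal b) ∂(prob svc arr) := by
          refine lintegral_mono fun ω => ?_
          rw [← ENNReal.ofReal_mul hε.le]
          exact hall _
      _ = _ := by
          rw [lintegral_add_right _ measurable_const, lintegral_const, measure_univ, mul_one]
  have hsum : ∀ t : ℕ, u t + ENNReal.ofReal ε * ∑ τ ∈ Finset.range t, w τ ≤
      t * ENNReal.ofReal b := by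
    intro t
    induction t with
    | zero => simp [hu0]
    | succ t ih =>
      rw [Finset.sum_range_succ, mul_add]
      calc _ = (u (t + 1) + ENNReal.ofReal ε * w t) +
            ENNReal.ofReal ε * ∑ τ ∈ Finset.range t, w τ := by ring
        _ ≤ (u t + ENNReal.ofReal b) + ENNReal.ofReal ε * ∑ τ ∈ Finset.range t, w τ := by
            exact add_le_add_left (hstep t) _
        _ = (u t + ENNReal.ofReal ε * ∑ τ ∈ Finset.range t, w τ) + ENNReal.ofReal b := by ring
        _ ≤ t * ENNReal.ofReal b + ENNReal.ofReal b := by gcongr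
        _ = _ := by push_cast; ring
  have hwsum : ∀ t : ℕ, ∑ τ ∈ Finset.range t, w τ ≤
      (ENNReal.ofReal ε)⁻¹ * (t * ENNReal.ofReal b) := fun t => by
    rw [← ENNReal.mul_le_iff_le_inv hε0 ENNReal.ofReal_ne_top]
    exact le_add_self.trans (hsum t)
  set κ : ℝ≥0∞ := ∑ i, (ENNReal.ofReal (arr.mean i))⁻¹ with hκ
  have hκt : κ ≠ ⊤ := ENNReal.sum_ne_top.2 fun i _ =>
    ENNReal.inv_ne_top.2 (by simpa using arr.mean_pos i)
  have hqueue : ∀ τ, ∫⁻ ω, ∑ i, ((run (d.toPolicy I₀) ω τ).queue i : ℝ≥0∞) ∂(prob svc arr) ≤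
      κ * (w τ + arr.Vmax) := by
    intro τ
    rw [lintegral_finsetSum _ fun i _ => ?_, hκ, Finset.sum_mul]
    · exact Finset.sum_le_sum fun i _ => lintegral_queue_le svc arr d I₀ τ i
    · exact (Measurable.of_discrete (f := fun x : SysState net => (x.queue i : ℝ≥0∞))).comp
        (measurable_run _ τ)
  refine lt_of_le_of_lt (limsup_le_of_le (h := Eventually.of_forall (f := atTop) fun t : ℕ => ?_)
    (a := κ * ((ENNReal.ofReal ε)⁻¹ * ENNReal.ofReal b + arr.Vmax))) ?_
  · refine ENNReal.div_le_of_le_mul ?_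
    calc _ ≤ ∑ τ ∈ Finset.range t, κ * (w τ + arr.Vmax) :=
          Finset.sum_le_sum fun τ _ => hqueue τ
      _ = κ * (∑ τ ∈ Finset.range t, w τ + t * arr.Vmax) := by
          rw [← Finset.mul_sum, Finset.sum_add_distrib]; simp
      _ ≤ κ * ((ENNReal.ofReal ε)⁻¹ * (t * ENNReal.ofReal b) + t * arr.Vmax) := by
          gcongr; exact hwsum t
      _ = _ := by ring
  · refine ENNReal.mul_lt_top hκt.lt_top (ENNReal.add_lt_top.2 ⟨ENNReal.mul_lt_top ?_
      ENNReal.ofReal_lt_top, ENNReal.natCast_lt_top _⟩)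
    exact ENNReal.inv_lt_top.2 (pos_iff_ne_zero.2 hε0)

end Stability

end BMW

end

theorem mainTheorem4 {N : ℕ} (net : BMW.Network N) (svc : BMW.ServiceLaw N)
    (α : ℝ) (hα₀ : 0 < α) (hα₁ : α < 1)
    (d : BMW.Rule net) (hd : BMW.IsWBMW net α d) (I₀ : net.Sched) :
    BMW.ThroughputOptimal net svc (d.toPolicy I₀) ∧
    ∀ arr : BMW.ArrivalLaw N, arr.rate ∈ interior (BMW.capacityRegion net svc) →
      BMW.IsMarkovChain (BMW.prob svc arr) (BMW.chain (d.toPolicy I₀))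
        (BMW.transition svc arr d) ∧
      BMW.PositiveRecurrent (BMW.transition svc arr d) :=
  ⟨fun arr hrate => BMW.stronglyStable svc arr hα₀ hα₁ hd I₀ hrate, fun arr hrate =>
    ⟨BMW.isMarkovChain svc arr d I₀, BMW.positiveRecurrent svc arr hα₀ hα₁ hd hrate⟩⟩
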